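/- Let $(\mathcal C,\otimes,1_\otimes)$ be a symmetric monoidal category with all small limits, with final object $\star_{\mathcal C}$. \emph{Wreath categories.} Let $\Sigma_*$ be the category of finite sets and bijections. For a category $\mathcal A$ let $\Sigma_*\wr\mathcal A$ be the category of finite families $\{A_s\}_{s\in S}$ of objects of $\mathcal A$; a morphism $\{A_s\}_{s\in S}\to\{B_t\}_{t\in T}$ is a bijection $\sigma:S\to T$ with morphisms $A_s\to B_{\sigma(s)}$. Put $\Sigma_*^{\wr 1}=\Sigma_*$ and $\Sigma_*^{\wr(n+1)}=\Sigma_*\wr\Sigma_*^{\wr n}$. Let $\gamma^2:\Sigma_*\wr\Sigma_*\to\Sigma_*$, $\{S_t\}_{t\in T}\mapsto\coprod_{t}S_t$, and let $\gamma^n:\Sigma_*^{\wr n}\to\Sigma_*$ be the iterated disjoint union. For $1\le i\le n-1$ let $\partial^n_i=\mathrm{Id}\wr\gamma^2\wr\mathrm{Id}:\Sigma_*^{\wr n}\to\Sigma_*^{\wr(n-1)}$ be the functor that applies $\gamma^2$ to the $i$-th and $(i+1)$-st factors, and for $0\le j<n$ let $s^n_j:\Sigma_*^{\wr n}\to\Sigma_*^{\wr(n+1)}$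 be the functor that replaces each $A$ at level $j$ (counted from the outside) by the one-element family $\{A\}_{\star}$. Then canonically $\gamma^{n-1}\partial^n_i\cong\gamma^n$ and $\gamma^{n+1}s^n_j\cong\gamma^n$. \emph{Products.} A symmetric sequence is a functor $\Sigma_*\to\mathcal C$. For a symmetric sequence $A$ and a functor $B:\mathcal A\to\mathcal C$ let $A\circledcirc B:\Sigma_*\wr\mathcal A\to\mathcal C$, $\{a_s\}_{s\in S}\mapsto A(S)\otimes\bigotimes_{s\in S}B(a_s)$. For symmetric sequences put $A_1\circledcirc\cdots\circledcirc A_n=A_1\circledcirc(A_2\circledcirc\cdots):\Sigma_*^{\wr n}\to\mathcal C$, and let $A_1\hat\circ\cdots\hat\circ A_n:\Sigma_*\to\mathcal C$ be its right Kan extension along $\gamma^n$, with universal transformation $\iota:(A_1\hat\circ\cdots\hat\circ A_n)\gamma^n\to A_1\circledcirc\cdots\circledcirc A_n$ (for $n=1$ this is $A_1$ and $\iota=\mathrm{id}$). \emph{Cooperads and comodules.} Let $\mathbb 1$ be the symmetric sequence with $\mathbb 1(T)=1_\otimes$ if $|T|=1$ and $\mathbb 1(T)=\star_{\mathcal C}$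 otherwise. A counital cooperad is a symmetric sequence $\mathcal O$ with natural transformations $\tilde\Delta:\mathcal O\gamma^2\to\mathcal O\circledcirc\mathcal O$ and $\tilde\epsilon:\mathcal O\to\mathbb 1$ such that the two transformations $\mathcal O\gamma^3\to\mathcal O\circledcirc\mathcal O\circledcirc\mathcal O$ (apply $\tilde\Delta$, then $\tilde\Delta$ to the first, respectively to the second, factor) agree, and such that the compositions $\mathcal O=\mathcal O\gamma^2s^1_0\to(\mathcal O\circledcirc\mathcal O)s^1_0\to(\mathbb 1\circledcirc\mathcal O)s^1_0=\mathcal O$ and $\mathcal O=\mathcal O\gamma^2s^1_1\to(\mathcal O\circledcirc\mathcal O)s^1_1\to(\mathcal O\circledcirc\mathbb 1)s^1_1=\mathcal O$, where $s^1_1(S)=\{\star\}_{s\in S}$, are identities. A left $\mathcal O$-comodule is a symmetric sequence $M$ with a natural transformation $\tilde\Delta_M:M\gamma^2\to\mathcal O\circledcirc M$ such that the two transformations $M\gamma^3\to\mathcal O\circledcirc\mathcal O\circledcirc M$ (apply $\tilde\Delta_M$, then $\tilde\Delta$ to $\mathcal O$, respectively $\tilde\Delta_M$ to $M$) agree, and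 such that $M=M\gamma^2s^1_0\to(\mathcal O\circledcirc M)s^1_0\to(\mathbb 1\circledcirc M)s^1_0=M$ is the identity. \emph{Theorem.} Let $\mathcal O$ be a counital cooperad, $M$ a left $\mathcal O$-comodule, and $X^n=\mathcal O^{\hat\circ n}\hat\circ M$ ($n$ factors $\mathcal O$, $X^0=M$) for $n\ge0$. For $n\ge 0$ and $1\le i\le n+1$ let $\tilde\Delta_i:(\mathcal O^{\circledcirc n}\circledcirc M)\,\partial^{n+2}_i\to\mathcal O^{\circledcirc(n+1)}\circledcirc M$ apply $\tilde\Delta$ at the $i$-th factor $\mathcal O$ if $i\le n$, and $\tilde\Delta_M$ at $M$ if $i=n+1$; for $0\le j\le n$ let $\tilde\epsilon_j:(\mathcal O^{\circledcirc(n+1)}\circledcirc M)\,s^{n+1}_j\to\mathcal O^{\circledcirc n}\circledcirc M$ apply $\tilde\epsilon$ at the $(j+1)$-st factor $\mathcal O$. Then: \begin{enumerate} \item There are unique natural transformations $\Delta_i:X^n\to X^{n+1}$ ($1\le i\le n+1$) and $\epsilon_j:X^{n+1}\to X^n$ ($0\le j\le n$) with $\iota\circ\Delta_i\gamma^{n+2}=\tilde\Delta_i\circ\iota\partial^{n+2}_i$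 and $\iota\circ\epsilon_j\gamma^{n+1}=\tilde\epsilon_j\circ\iota s^{n+1}_j$ (up to the canonical identifications $\gamma\partial_i\cong\gamma$, $\gamma s_j\cong\gamma$). \item These maps make $M\to\mathcal O\hat\circ M\rightrightarrows\mathcal O^{\hat\circ2}\hat\circ M\cdots$ a coaugmented cosimplicial symmetric sequence with one extra codegeneracy: there is a cosimplicial object with $k$-th term $X^{k+1}$, cofaces $d^i=\Delta_{i+1}:X^{k+1}\to X^{k+2}$ ($0\le i\le k+1$) and codegeneracies $s^j=\epsilon_{j+1}:X^{k+2}\to X^{k+1}$ ($0\le j\le k$), coaugmented by $\Delta_1:M\to\mathcal O\hat\circ M$; and the maps $s^{-1}=\epsilon_0:X^{k+1}\to X^{k}$ ($k\ge0$) satisfy, together with the coaugmentation and the other maps, $s^{-1}d^0=\mathrm{id}$ (including $\epsilon_0\Delta_1=\mathrm{id}_M$), $s^{-1}d^{i+1}=d^is^{-1}$ (including $\epsilon_0\Delta_2=\Delta_1\epsilon_0$ on $\mathcal O\hat\circ M$), $s^{-1}s^0=s^{-1}s^{-1}$ and $s^{-1}s^{j+1}=s^js^{-1}$. \end{enumerate}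 -/

import Mathlib

open CategoryTheory MonoidalCategory Limits

noncomputable section

namespace CooperadComplex

universe v u

/-! ### Unordered finite tensor products in a symmetric monoidal category -/

section Tensor

variable {C : Type u} [Category.{v} C] [MonoidalCategory C]

/-- The tensor product `X a₁ ⊗ (X a₂ ⊗ (⋯ ⊗ 𝟙_ C))` along a list. -/
abbrev listTensor {κ : Type} (X : κ → C) : List κ → C
  | [] => 𝟙_ C
  | a :: l => X a ⊗ listTensor X l

/-- Factorwise morphisms between tensor products along a list. -/
def listTensorMap {κ : Type} {X Y : κ → C} (f : ∀ k, X k ⟶ Y k) :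
    ∀ l : List κ, listTensor X l ⟶ listTensor Y l
  | [] => 𝟙 _
  | a :: l => f a ⊗ₘ listTensorMap f l

/-- Renaming the indices of a tensor product along a list (factorwise the identity). -/
def listTensorRelabel {ι κ : Type} (e : ι → κ) (Y : κ → C) :
    ∀ l : List ι, listTensor (fun i => Y (e i)) l ≅ listTensor Y (l.map e)
  | [] => Iso.refl _
  | a :: l => whiskerLeftIso (Y (e a)) (listTensorRelabel e Y l)

/-- The tensor product along a concatenation (reassociation). -/
def listTensorAppend {κ : Type} (X : κ → C) :
    ∀ l l' : List κ, listTensor X (l ++ l') ≅ listTensor X l ⊗ listTensor X l'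
  | [], l' => (λ_ (listTensor X l')).symm
  | a :: l, l' =>
      whiskerLeftIso (X a) (listTensorAppend X l l') ≪≫ (α_ (X a) _ _).symm

/-- Rearrangements of a list, as words in adjacent transpositions. -/
inductive Rearr {κ : Type} : List κ → List κ → Type
  | nil : Rearr [] []
  | cons (a : κ) {l l' : List κ} : Rearr l l' → Rearr (a :: l) (a :: l')
  | swap (a b : κ) (l : List κ) : Rearr (a :: b :: l) (b :: a :: l)
  | trans {l l' l'' : List κ} : Rearr l l' → Rearr l' l'' → Rearr l l''

theorem Rearr.nonempty_of_perm {κ : Type} {l l' : List κ} (h : l.Perm l') :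
    Nonempty (Rearr l l') := by
  induction h with
  | nil => exact ⟨.nil⟩
  | cons a _ ih => exact ⟨.cons a ih.some⟩
  | swap a b l => exact ⟨.swap b a l⟩
  | trans _ _ ih ih' => exact ⟨.trans ih.some ih'.some⟩

theorem Rearr.perm {κ : Type} {l l' : List κ} (w : Rearr l l') : l.Perm l' := by
  induction w with
  | nil => exact .nil
  | cons a _ ih => exact .cons a ih
  | swap a b l => exact .swap b a l
  | trans _ _ ih ih' => exact .trans ih ih'

def Rearr.refl {κ : Type} : ∀ l : List κ, Rearr l l
  | [] => .nil
  | a :: l => .cons a (Rearr.refl l)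

def Rearr.map {ι κ : Type} (e : ι → κ) : ∀ {l l' : List ι}, Rearr l l' → Rearr (l.map e) (l'.map e)
  | _, _, .nil => .nil
  | _, _, .cons a w => .cons (e a) (w.map e)
  | _, _, .swap a b l => .swap (e a) (e b) (l.map e)
  | _, _, .trans w w' => .trans (w.map e) (w'.map e)

theorem listTensorMap_id {κ : Type} (X : κ → C) (l : List κ) :
    listTensorMap (fun k => 𝟙 (X k)) l = 𝟙 _ := by
  induction l with
  | nil => rfl
  | cons a l ih => simp [listTensorMap, ih]

theorem listTensorMap_comp {κ : Type} {X Y Z : κ → C} (f : ∀ k, X k ⟶ Y k) (g : ∀ k, Y k ⟶ Z k)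
    (l : List κ) : listTensorMap (fun k => f k ≫ g k) l = listTensorMap f l ≫ listTensorMap g l := by
  induction l with
  | nil => simp [listTensorMap]
  | cons a l ih => simp [listTensorMap, ih]

theorem listTensorRelabel_natural {ι κ : Type} (e : ι → κ) {Y Z : κ → C} (g : ∀ k, Y k ⟶ Z k)
    (l : List ι) : (listTensorRelabel e Y l).hom ≫ listTensorMap g (l.map e) =
      listTensorMap (fun i => g (e i)) l ≫ (listTensorRelabel e Z l).hom := by
  induction l with
  | nil => exact (Category.id_comp _).trans (Category.comp_id _).symm
  | cons a l ih =>
    change Y (e a) ◁ (listTensorRelabel e Y l).hom ≫ (g (e a) ⊗ₘ listTensorMap g (l.map e)) =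
      (g (e a) ⊗ₘ listTensorMap (fun i => g (e i)) l) ≫ Z (e a) ◁ (listTensorRelabel e Z l).hom
    rw [← id_tensorHom, ← id_tensorHom, tensorHom_comp_tensorHom, tensorHom_comp_tensorHom, ih]
    simp

section Symm

variable [SymmetricCategory C]

/-- Exchanging the first two of three factors by the braiding. -/
def swapFirst (A B Z : C) : A ⊗ (B ⊗ Z) ⟶ B ⊗ (A ⊗ Z) :=
  (α_ A B Z).inv ≫ (β_ A B).hom ▷ Z ≫ (α_ B A Z).hom

/-- A rearrangement acts on tensor products through the braiding of adjacent factors. -/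
def Rearr.hom {κ : Type} (X : κ → C) :
    ∀ {l l' : List κ}, Rearr l l' → (listTensor X l ⟶ listTensor X l')
  | _, _, .nil => 𝟙 _
  | _, _, .cons a w => X a ◁ w.hom X
  | _, _, .swap a b l => swapFirst (X a) (X b) (listTensor X l)
  | _, _, .trans w w' => w.hom X ≫ w'.hom X

theorem Rearr.hom_refl {κ : Type} (X : κ → C) (l : List κ) :
    (Rearr.refl l).hom X = 𝟙 _ := by
  induction l with
  | nil => rfl
  | cons a l ih => simp only [Rearr.refl, Rearr.hom, ih]; exact MonoidalCategory.whiskerLeft_id _ _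

theorem swapFirst_swapFirst (A B Z : C) : swapFirst A B Z ≫ swapFirst B A Z = 𝟙 _ := by
  simp [swapFirst, ← comp_whiskerRight_assoc]

theorem swapFirst_natural {A A' B B' Z Z' : C} (f : A ⟶ A') (g : B ⟶ B') (h : Z ⟶ Z') :
    (f ⊗ₘ (g ⊗ₘ h)) ≫ swapFirst A' B' Z' = swapFirst A B Z ≫ (g ⊗ₘ (f ⊗ₘ h)) := by
  simp only [swapFirst, Category.assoc]
  rw [associator_inv_naturality_assoc, ← tensorHom_id, ← tensorHom_id,
    tensorHom_comp_tensorHom_assoc, BraidedCategory.braiding_naturality, Category.comp_id,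
    ← associator_naturality, tensorHom_comp_tensorHom_assoc, Category.id_comp]

theorem swapFirst_yangBaxter (A B D Z : C) :
    swapFirst A B (D ⊗ Z) ≫ B ◁ swapFirst A D Z ≫ swapFirst B D (A ⊗ Z) =
      A ◁ swapFirst B D Z ≫ swapFirst A D (B ⊗ Z) ≫ D ◁ swapFirst A B Z := by
  have h := congrArg (fun f => f ▷ Z) (BraidedCategory.yang_baxter A B D)
  calc
    _ = 𝟙 _ ⊗≫ ((α_ A B D).inv ≫ (β_ A B).hom ▷ D ≫ (α_ B A D).hom ≫ B ◁ (β_ A D).hom ≫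
          (α_ B D A).inv ≫ (β_ B D).hom ▷ A ≫ (α_ D B A).hom) ▷ Z ⊗≫ 𝟙 _ := by
      simp only [swapFirst]; monoidal
    _ = 𝟙 _ ⊗≫ (A ◁ (β_ B D).hom ≫ (α_ A D B).inv ≫ (β_ A D).hom ▷ B ≫ (α_ D A B).hom ≫
          D ◁ (β_ A B).hom) ▷ Z ⊗≫ 𝟙 _ := by rw [h]
    _ = _ := by simp only [swapFirst]; monoidal

/-- Positions of `a` in a list, together with the list that remains. -/
inductive Del {κ : Type} (a : κ) : List κ → List κ → Type
  | here (l : List κ) : Del a (a :: l) l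
  | there (b : κ) {l l' : List κ} : Del a l l' → Del a (b :: l) (b :: l')

theorem Del.mem {κ : Type} {a : κ} {l m : List κ} (d : Del a l m) : a ∈ l := by
  induction d with
  | here => simp
  | there b _ ih => simp [ih]

def Del.hom {κ : Type} (X : κ → C) {a : κ} :
    ∀ {l m : List κ}, Del a l m → (listTensor X l ⟶ X a ⊗ listTensor X m)
  | _, _, .here _ => 𝟙 _
  | _, _, .there b d => X b ◁ d.hom X ≫ swapFirst (X b) (X a) _

theorem Del.unique {κ : Type} {a : κ} {l m m' : List κ} (hl : l.Nodup) (d : Del a l m)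
    (d' : Del a l m') : (⟨m, d⟩ : Σ m, Del a l m) = ⟨m', d'⟩ := by
  induction d generalizing m' with
  | here l =>
    cases d' with
    | here => rfl
    | there b d' => exact absurd d'.mem (List.nodup_cons.1 hl).1
  | there b d ih =>
    cases d' with
    | here => exact absurd d.mem (List.nodup_cons.1 hl).1
    | there b d' => cases ih (List.nodup_cons.1 hl).2 d'; rfl

theorem Rearr.hom_del {κ : Type} (X : κ → C) {a : κ} {l l' : List κ} (w : Rearr l l') :
    ∀ {m' : List κ} (d' : Del a l' m'), ∃ (m : List κ) (d : Del a l m) (w' : Rearr m m'),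
      w.hom X ≫ d'.hom X = d.hom X ≫ X a ◁ w'.hom X := by
  induction w with
  | nil => intro m' d'; cases d'
  | cons b w ih =>
    intro m' d'
    cases d' with
    | here => exact ⟨_, .here _, w, by simp [Rearr.hom, Del.hom]⟩
    | there b d' =>
      obtain ⟨m, d, w', h⟩ := ih d'
      refine ⟨_, .there b d, .cons b w', ?_⟩
      simp only [Rearr.hom, Del.hom, Category.assoc]
      rw [← MonoidalCategory.whiskerLeft_comp_assoc, h]
      have := swapFirst_natural (𝟙 (X b)) (𝟙 (X a)) (w'.hom X)
      simp only [id_tensorHom] at this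
      rw [← this, MonoidalCategory.whiskerLeft_comp_assoc]
  | swap b c l =>
    intro m' d'
    cases d' with
    | here =>
      refine ⟨_, .there b (.here _), Rearr.refl _, ?_⟩
      simp [Rearr.hom, Del.hom, Rearr.hom_refl]
    | there _ d' =>
      cases d' with
      | here =>
        refine ⟨_, .here _, Rearr.refl _, ?_⟩
        simp [Rearr.hom, Del.hom, Rearr.hom_refl, swapFirst_swapFirst]
      | there _ d' =>
        refine ⟨_, .there b (.there c d'), .swap b c _, ?_⟩
        have h := swapFirst_natural (𝟙 (X b)) (𝟙 (X c)) (d'.hom X)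
        simp only [id_tensorHom] at h
        simp only [Rearr.hom, Del.hom, MonoidalCategory.whiskerLeft_comp, Category.assoc]
        rw [← reassoc_of% h, swapFirst_yangBaxter]
  | trans w w' ih ih' =>
    intro m' d'
    obtain ⟨m₁, d₁, w₁, h₁⟩ := ih' d'
    obtain ⟨m₂, d₂, w₂, h₂⟩ := ih d₁
    refine ⟨_, d₂, .trans w₂ w₁, ?_⟩
    simp only [Rearr.hom, Category.assoc, h₁, MonoidalCategory.whiskerLeft_comp]
    rw [reassoc_of% h₂]

theorem Rearr.hom_nil {κ : Type} (X : κ → C) {l l' : List κ} (w : Rearr l l') (h : l = []) :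
    w.hom X = eqToHom (by have := w.perm; subst h; rw [List.nil_perm.1 this]) := by
  induction w with
  | nil => rfl
  | cons => cases h
  | swap => cases h
  | trans w w' ih ih' =>
    have := w.perm
    subst h
    simp [Rearr.hom, ih rfl, ih' (List.nil_perm.1 this)]

/-- Coherence: on a list without repetitions, the induced morphism only depends on the rearranged
list, not on the chosen word in transpositions. -/
theorem Rearr.coherence {κ : Type} (X : κ → C) {l l' : List κ} (hl : l.Nodup)
    (w w' : Rearr l l') : w.hom X = w'.hom X := by
  induction l' generalizing l with
  | nil =>
    have := List.perm_nil.1 w.perm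
    rw [w.hom_nil X this, w'.hom_nil X this]
  | cons a m ih =>
    obtain ⟨k, d, v, h⟩ := w.hom_del X (Del.here (a := a) m)
    obtain ⟨k', d', v', h'⟩ := w'.hom_del X (Del.here (a := a) m)
    cases Del.unique hl d d'
    have hm : m.Nodup := (List.nodup_cons.1 (w.perm.nodup_iff.1 hl)).2
    have := ih (v.perm.nodup_iff.2 hm) v v'
    rw [this, ← h'] at h
    have e : ∀ f : listTensor X l ⟶ listTensor X (a :: m), 
        f ≫ (Del.here (a := a) m).hom X = f := fun f => Category.comp_id f
    rwa [e, e] at h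


theorem Rearr.hom_natural {κ : Type} {X Y : κ → C} (f : ∀ k, X k ⟶ Y k) {l l' : List κ}
    (w : Rearr l l') : w.hom X ≫ listTensorMap f l' = listTensorMap f l ≫ w.hom Y := by
  induction w with
  | nil => simp [Rearr.hom]
  | cons a w ih =>
    simp only [Rearr.hom, listTensorMap]
    rw [← id_tensorHom, ← id_tensorHom, tensorHom_comp_tensorHom, tensorHom_comp_tensorHom, ih]
    simp
  | swap a b l => exact (swapFirst_natural _ _ _).symm
  | trans w w' ih ih' =>
    simp only [Rearr.hom, Category.assoc]
    rw [ih', reassoc_of% ih]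

theorem Rearr.hom_relabel {ι κ : Type} (e : ι → κ) (Y : κ → C) {l l' : List ι}
    (w : Rearr l l') : w.hom (fun i => Y (e i)) ≫ (listTensorRelabel e Y l').hom =
      (listTensorRelabel e Y l).hom ≫ (w.map e).hom Y := by
  induction w with
  | nil => simp [Rearr.hom, listTensorRelabel, Rearr.map]
  | cons a w ih =>
    simp only [Rearr.hom, listTensorRelabel, Rearr.map, whiskerLeftIso_hom]
    rw [← MonoidalCategory.whiskerLeft_comp, ← MonoidalCategory.whiskerLeft_comp, ih]
  | swap a b l =>
    have h := swapFirst_natural (𝟙 (Y (e a))) (𝟙 (Y (e b))) (listTensorRelabel e Y l).hom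
    simp only [id_tensorHom] at h
    exact h.symm
  | trans w w' ih ih' =>
    simp only [Rearr.hom, Category.assoc, Rearr.map]
    rw [ih', reassoc_of% ih]

/-- The canonical symmetry morphism between the tensor products along two orderings. On lists
without repetitions it is independent of the chosen word, by `Rearr.coherence`. -/
def permHom {κ : Type} (X : κ → C) {l l' : List κ} (h : l.Perm l') :
    listTensor X l ⟶ listTensor X l' :=
  (Rearr.nonempty_of_perm h).some.hom X

theorem permHom_eq {κ : Type} (X : κ → C) {l l' : List κ} (hl : l.Nodup) (h : l.Perm l')
    (w : Rearr l l') : permHom X h = w.hom X :=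
  Rearr.coherence X hl _ w

/-- A chosen ordering of a finite set. -/
def enum (κ : Type) [Fintype κ] : List κ := (Finset.univ : Finset κ).toList

theorem enum_nodup (κ : Type) [Fintype κ] : (enum κ).Nodup := Finset.nodup_toList _

theorem mem_enum {κ : Type} [Fintype κ] (k : κ) : k ∈ enum κ := by simp [enum]

theorem enum_perm {κ : Type} [Fintype κ] {l : List κ} (hl : l.Nodup) (h : ∀ k, k ∈ l) :
    l.Perm (enum κ) :=
  (List.perm_ext_iff_of_nodup hl (enum_nodup κ)).2 fun k => by simp [h, mem_enum]

theorem enum_map_perm {ι κ : Type} [Fintype ι] [Fintype κ] (e : ι ≃ κ) :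
    ((enum ι).map e).Perm (enum κ) :=
  enum_perm ((enum_nodup ι).map e.injective) fun k => by
    simpa using ⟨e.symm k, mem_enum _, by simp⟩

/-- The unordered tensor product `⨂_{k ∈ κ} X k` over a finite set `κ`. -/
def tensorOver {κ : Type} [Fintype κ] (X : κ → C) : C := listTensor X (enum κ)

/-- Functoriality of unordered tensor products: a bijection `e : ι ≃ κ` together with morphisms
`X i ⟶ Y (e i)` induces `⨂_{i ∈ ι} X i ⟶ ⨂_{k ∈ κ} Y k`. -/
def tensorOverMap {ι κ : Type} [Fintype ι] [Fintype κ] {X : ι → C} {Y : κ → C} (e : ι ≃ κ)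
    (f : ∀ i, X i ⟶ Y (e i)) : tensorOver X ⟶ tensorOver Y :=
  listTensorMap f (enum ι) ≫ (listTensorRelabel e Y (enum ι)).hom ≫ permHom Y (enum_map_perm e)

/-- The identity relabelling, up to rewriting the list. -/
theorem listTensorRelabel_id {κ : Type} (X : κ → C) (l : List κ) (w : Rearr (l.map id) l)
    (hl : l.Nodup) : (listTensorRelabel id X l).hom ≫ w.hom X = 𝟙 _ := by
  have key : ∀ l : List κ, ∃ w : Rearr (l.map id) l,
      (listTensorRelabel id X l).hom ≫ w.hom X = 𝟙 _ := by
    intro l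
    induction l with
    | nil => exact ⟨.nil, by simp [Rearr.hom, listTensorRelabel]⟩
    | cons a l ih =>
      obtain ⟨w, h⟩ := ih
      refine ⟨.cons a w, ?_⟩
      simp only [Rearr.hom, listTensorRelabel, whiskerLeftIso_hom]
      erw [← MonoidalCategory.whiskerLeft_comp, h]
      simp
  obtain ⟨w', h⟩ := key l
  rw [Rearr.coherence X (by simpa using hl) w w', h]

theorem listTensorRelabel_comp {ι κ τ : Type} (e : ι → κ) (e' : κ → τ) (X : τ → C) (l : List ι) :
    ∃ w : Rearr ((l.map e).map e') (l.map fun i => e' (e i)),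
      (listTensorRelabel e (fun k => X (e' k)) l).hom ≫ (listTensorRelabel e' X (l.map e)).hom ≫
        w.hom X = (listTensorRelabel (fun i => e' (e i)) X l).hom := by
  induction l with
  | nil => exact ⟨.nil, (Category.id_comp _).trans (Category.id_comp _)⟩
  | cons a l ih =>
    obtain ⟨w, h⟩ := ih
    refine ⟨.cons _ w, ?_⟩
    change X (e' (e a)) ◁ (listTensorRelabel e (fun k => X (e' k)) l).hom ≫
      X (e' (e a)) ◁ (listTensorRelabel e' X (l.map e)).hom ≫ X (e' (e a)) ◁ w.hom X =
      X (e' (e a)) ◁ (listTensorRelabel (fun i => e' (e i)) X l).hom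
    rw [← MonoidalCategory.whiskerLeft_comp, ← MonoidalCategory.whiskerLeft_comp, h]

theorem tensorOverMap_id {κ : Type} [Fintype κ] (X : κ → C) :
    tensorOverMap (Equiv.refl κ) (fun k => 𝟙 (X k)) = 𝟙 (tensorOver X) := by
  have h : ((enum κ).map id).Perm (enum κ) := by simp
  change listTensorMap (fun k => 𝟙 (X k)) (enum κ) ≫ (listTensorRelabel id X (enum κ)).hom ≫
    permHom X h = 𝟙 _
  rw [listTensorMap_id, Category.id_comp]
  exact listTensorRelabel_id X (enum κ) _ (enum_nodup κ)

theorem tensorOverMap_comp {ι κ τ : Type} [Fintype ι] [Fintype κ] [Fintype τ] {X : ι → C}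
    {Y : κ → C} {Z : τ → C} (e : ι ≃ κ) (e' : κ ≃ τ) (f : ∀ i, X i ⟶ Y (e i))
    (g : ∀ k, Y k ⟶ Z (e' k)) :
    tensorOverMap (Y := Z) (e.trans e') (fun i => f i ≫ g (e i)) =
      tensorOverMap e f ≫ tensorOverMap e' g := by
  obtain ⟨w, hw⟩ := listTensorRelabel_comp e e' Z (enum ι)
  let p := (Rearr.nonempty_of_perm (enum_map_perm e)).some
  let q := (Rearr.nonempty_of_perm (enum_map_perm e')).some
  have h₁ := p.hom_natural g
  have h₂ := p.hom_relabel e' Z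
  have h₃ := listTensorRelabel_natural e g (enum ι)
  have hn : (((enum ι).map e).map e').Nodup :=
    ((enum_nodup ι).map e.injective).map e'.injective
  have h₄ : (p.map e').hom Z ≫ q.hom Z =
      w.hom Z ≫ permHom Z (enum_map_perm (e.trans e')) :=
    Rearr.coherence Z hn ((p.map e').trans q)
      (w.trans (Rearr.nonempty_of_perm (enum_map_perm (e.trans e'))).some)
  have hc := listTensorMap_comp f (fun i => g (e i)) (enum ι)
  change listTensorMap (fun i => f i ≫ g (e i)) (enum ι) ≫
      (listTensorRelabel (fun i => e' (e i)) Z (enum ι)).hom ≫ permHom Z _ =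
    (listTensorMap f (enum ι) ≫ (listTensorRelabel e Y (enum ι)).hom ≫ p.hom Y) ≫
      listTensorMap g (enum κ) ≫ (listTensorRelabel e' Z (enum κ)).hom ≫ q.hom Z
  rw [hc, ← hw]
  simp only [Category.assoc]
  rw [reassoc_of% h₁, reassoc_of% h₂, reassoc_of% h₃, h₄]

/-- The tensor product over a one-point set is its only factor. -/
def tensorOverPUnit (X : PUnit.{1} → C) : tensorOver X ⟶ X PUnit.unit :=
  permHom X (enum_perm (l := [PUnit.unit]) (by simp) (by simp)).symm ≫ (ρ_ (X PUnit.unit)).hom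

/-- A tensor product of monoidal units is the monoidal unit. -/
def listTensorUnits {κ : Type} : ∀ l : List κ, listTensor (fun _ => 𝟙_ C) l ⟶ 𝟙_ C
  | [] => 𝟙 _
  | _ :: l => (λ_ _).hom ≫ listTensorUnits l

def tensorOverUnits (κ : Type) [Fintype κ] : tensorOver (fun _ : κ => 𝟙_ C) ⟶ 𝟙_ C :=
  listTensorUnits (enum κ)

/-- The interchange `(⨂ U k) ⊗ (⨂ V k) ⟶ ⨂ (U k ⊗ V k)`. -/
def listTensorZip {κ : Type} (U V : κ → C) :
    ∀ l : List κ, listTensor U l ⊗ listTensor V l ⟶ listTensor (fun k => U k ⊗ V k) l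
  | [] => (λ_ (𝟙_ C)).hom
  | a :: l => tensorμ (U a) (listTensor U l) (V a) (listTensor V l) ≫
      (U a ⊗ V a) ◁ listTensorZip U V l

def tensorOverZip {κ : Type} [Fintype κ] (U V : κ → C) :
    tensorOver U ⊗ tensorOver V ⟶ tensorOver (fun k => U k ⊗ V k) :=
  listTensorZip U V (enum κ)

/-- Grouping a tensor product over a disjoint union: `⨂_{(i,b)} Y (i,b) ⟶ ⨂_i ⨂_b Y (i,b)`. -/
def listTensorSigma {ι : Type} {β : ι → Type} (Y : (Σ i, β i) → C) (m : ∀ i, List (β i)) :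
    ∀ l : List ι, listTensor Y (l.sigma m) ⟶
      listTensor (fun i => listTensor (fun b => Y ⟨i, b⟩) (m i)) l
  | [] => 𝟙 _
  | i :: l => (listTensorAppend Y ((m i).map (Sigma.mk i)) (l.sigma m)).hom ≫
      ((listTensorRelabel (Sigma.mk i) Y (m i)).inv ⊗ₘ listTensorSigma Y m l)

theorem enum_sigma_perm {ι : Type} {β : ι → Type} [Fintype ι] [∀ i, Fintype (β i)] :
    ((enum ι).sigma fun i => enum (β i)).Perm (enum (Σ i, β i)) :=
  enum_perm ((enum_nodup ι).sigma fun i => enum_nodup (β i)) fun _ =>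
    List.mem_sigma.2 ⟨mem_enum _, mem_enum _⟩

def tensorOverSigma {ι : Type} {β : ι → Type} [Fintype ι] [∀ i, Fintype (β i)]
    (Y : (Σ i, β i) → C) :
    tensorOver Y ⟶ tensorOver (fun i => tensorOver fun b : β i => Y ⟨i, b⟩) :=
  permHom Y enum_sigma_perm.symm ≫ listTensorSigma Y (fun i => enum (β i)) (enum ι)

end Symm
end Tensor

/-! ### Finite sets and wreath product categories -/

/-- The category `Σ_*` of finite sets and bijections. -/
structure FinBij : Type 1 where
  carrier : Type
  [fintype : Fintype carrier]

attribute [instance] FinBij.fintype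

@[ext]
structure FinBij.Hom (S T : FinBij) where
  equiv : S.carrier ≃ T.carrier

instance FinBij.category : Category.{0} FinBij where
  Hom := FinBij.Hom
  id S := ⟨Equiv.refl S.carrier⟩
  comp f g := ⟨f.equiv.trans g.equiv⟩

/-- The one-point set `⋆`. -/
def FinBij.point : FinBij := ⟨PUnit⟩

section Wreath

universe v₁ u₁ v₂ u₂

/-- Objects of the wreath product category `Σ_* ≀ 𝒜`: finite families of objects of `𝒜`. -/
structure Wreath (𝒜 : Type u₁) : Type (max 1 u₁) where
  index : FinBij
  fam : index.carrier → 𝒜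

variable {𝒜 : Type u₁} [Category.{v₁} 𝒜] {ℬ : Type u₂} [Category.{v₂} ℬ]

/-- Morphisms of `Σ_* ≀ 𝒜`: a bijection of index sets and morphisms of `𝒜` along it. -/
structure Wreath.Hom (X Y : Wreath 𝒜) where
  base : X.index ⟶ Y.index
  app : ∀ s : X.index.carrier, X.fam s ⟶ Y.fam (base.equiv s)

instance Wreath.category : Category.{v₁} (Wreath 𝒜) where
  Hom := Wreath.Hom
  id X := ⟨𝟙 X.index, fun s => 𝟙 (X.fam s)⟩
  comp f g := ⟨f.base ≫ g.base, fun s => f.app s ≫ g.app (f.base.equiv s)⟩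
  id_comp f := by
    change Wreath.Hom.mk _ _ = Wreath.Hom.mk _ _
    congr 1
    funext s
    exact Category.id_comp (f.app s)
  comp_id f := by
    change Wreath.Hom.mk _ _ = Wreath.Hom.mk _ _
    congr 1
    funext s
    exact Category.comp_id (f.app s)
  assoc f g h := by
    congr 1
    funext s
    exact Category.assoc (f.app s) _ _

theorem Wreath.hom_ext {X Y : Wreath 𝒜} {f g : X ⟶ Y} (h : ∀ s, f.base.equiv s = g.base.equiv s)
    (h' : ∀ s, f.app s ≫ eqToHom (congrArg Y.fam (h s)) = g.app s) : f = g := by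
  obtain ⟨⟨b⟩, a⟩ := f
  obtain ⟨⟨b'⟩, a'⟩ := g
  obtain rfl : b = b' := Equiv.ext h
  have : a = a' := funext fun s => by simpa using h' s
  rw [this]

/-- The functor `Id ≀ F : Σ_* ≀ 𝒜 ⥤ Σ_* ≀ ℬ`. -/
def Wreath.map (F : 𝒜 ⥤ ℬ) : Wreath 𝒜 ⥤ Wreath ℬ where
  obj W := ⟨W.index, fun s => F.obj (W.fam s)⟩
  map f := ⟨f.base, fun s => F.map (f.app s)⟩
  map_id W := by
    change _ = Wreath.Hom.mk _ _
    congr 1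
    funext s
    exact F.map_id (W.fam s)
  map_comp f g := by
    change Wreath.Hom.mk _ _ = Wreath.Hom.mk _ _
    congr 1
    funext s
    exact F.map_comp (f.app s) _

/-- The functor `γ² : Σ_* ≀ Σ_* ⥤ Σ_*` that sends a family of finite sets to its disjoint union. -/
def coprod : Wreath FinBij ⥤ FinBij where
  obj W := ⟨Σ s, (W.fam s).carrier⟩
  map f := ⟨Equiv.sigmaCongr f.base.equiv fun s => (f.app s).equiv⟩
  map_id _ := FinBij.Hom.ext (Equiv.ext fun _ => rfl)
  map_comp _ _ := FinBij.Hom.ext (Equiv.ext fun _ => rfl)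

/-- The shape of a family of families: forget the innermost objects. -/
def Wreath.shape (W : Wreath (Wreath 𝒜)) : Wreath FinBij :=
  ⟨W.index, fun s => (W.fam s).index⟩

/-- The functor `γ² ≀ Id : (Σ_* ≀ Σ_*) ≀ 𝒜 ⥤ Σ_* ≀ 𝒜` that merges the two levels of index sets. -/
def merge : Wreath (Wreath 𝒜) ⥤ Wreath 𝒜 where
  obj W := ⟨coprod.obj W.shape, fun p => (W.fam p.1).fam p.2⟩
  map f := ⟨⟨Equiv.sigmaCongr f.base.equiv fun s => (f.app s).base.equiv⟩,
    fun p => (f.app p.1).app p.2⟩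
  map_id _ := Wreath.hom_ext (fun _ => rfl) fun _ => Category.comp_id _
  map_comp _ _ := Wreath.hom_ext (fun _ => rfl) fun _ => Category.comp_id _

/-- The functor `𝒜 ⥤ Σ_* ≀ 𝒜`, `a ↦ {a}_⋆`, that creates a new bottom vertex. -/
def singleFam : 𝒜 ⥤ Wreath 𝒜 where
  obj a := ⟨FinBij.point, fun _ => a⟩
  map f := ⟨𝟙 _, fun _ => f⟩
  map_comp f g := rfl

end Wreath

/-- `Level n` is the wreath product category `Σ_*^{≀ (n+1)} = Σ_* ≀ (⋯ ≀ (Σ_* ≀ Σ_*))`. -/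
abbrev Level : ℕ → Type 1
  | 0 => FinBij
  | n + 1 => Wreath (Level n)

instance Level.category : ∀ n, Category.{0} (Level n)
  | 0 => FinBij.category
  | n + 1 => @Wreath.category (Level n) (Level.category n)

/-- The functor `γ : Σ_*^{≀ (n+1)} ⥤ Σ_*`, which only keeps the set of leaves. -/
def gamma : ∀ n, Level n ⥤ FinBij
  | 0 => 𝟭 FinBij
  | n + 1 => Wreath.map (gamma n) ⋙ coprod

/-- The face functors `Σ_*^{≀ (n+2)} ⥤ Σ_*^{≀ (n+1)}`; the index `i = 0, …, n` composes the levels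
`i` and `i + 1`, by `Id ≀ γ² ≀ Id`. -/
def face : ∀ n, Fin (n + 1) → (Level (n + 1) ⥤ Level n)
  | 0 => fun _ => coprod
  | n + 1 => Fin.cases (merge (𝒜 := Level n)) fun i => Wreath.map (face n i)

/-- The degeneracy functors `Σ_*^{≀ (n+1)} ⥤ Σ_*^{≀ (n+2)}` that double the vertices of height
`j = 0, …, n` (the doubling of the leaves is not among them). -/
def degen : ∀ n, Fin (n + 1) → (Level n ⥤ Level (n + 1))
  | 0 => fun _ => singleFam (𝒜 := Level 0)
  | n + 1 => Fin.cases (singleFam (𝒜 := Level (n + 1))) fun j => Wreath.map (degen n j)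

/-- The canonical bijection `γ W ≅ γ (∂ᵢ W)`. -/
def gammaFace : ∀ (n : ℕ) (i : Fin (n + 1)) (W : Level (n + 1)),
    (gamma (n + 1)).obj W ⟶ (gamma n).obj ((face n i).obj W)
  | 0 => fun _ W => 𝟙 (coprod.obj W)
  | n + 1 => Fin.cases
      (fun W => ⟨(Equiv.sigmaAssoc fun (s : W.index.carrier) (t : (W.fam s).index.carrier) =>
          ((gamma n).obj ((W.fam s).fam t)).carrier).symm⟩)
      fun i W => ⟨Equiv.sigmaCongrRight fun s => (gammaFace n i (W.fam s)).equiv⟩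

/-- The canonical bijection of a set with the disjoint union of the one-element family of it. -/
def sigmaPoint (S : FinBij) : S ⟶ coprod.obj (singleFam.obj S) :=
  ⟨(Equiv.uniqueSigma fun _ : PUnit => S.carrier).symm⟩

/-- The canonical bijection `γ W ≅ γ (sⱼ W)`. -/
def gammaDegen : ∀ (n : ℕ) (j : Fin (n + 1)) (W : Level n),
    (gamma n).obj W ⟶ (gamma (n + 1)).obj ((degen n j).obj W)
  | 0 => fun _ W => sigmaPoint W
  | n + 1 => Fin.cases (fun W => sigmaPoint ((gamma (n + 1)).obj W))
      fun j W => ⟨Equiv.sigmaCongrRight fun s => (gammaDegen n j (W.fam s)).equiv⟩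

theorem Level.exists_small : ∀ n, ∃ (K : Type) (f : K → Level n),
    ∀ W, ∃ k, Nonempty (f k ≅ W)
  | 0 => by
    refine ⟨ℕ, fun n => (⟨Fin n⟩ : FinBij), fun (W : FinBij) => ⟨Fintype.card W.carrier, ⟨?_⟩⟩⟩
    let e := Fintype.equivFin W.carrier
    exact ⟨⟨e.symm⟩, ⟨e⟩, FinBij.Hom.ext (e.symm_trans_self), FinBij.Hom.ext (e.self_trans_symm)⟩
  | n + 1 => by
    obtain ⟨K, f, hf⟩ := Level.exists_small n
    refine ⟨Σ m : ℕ, (Fin m → K), fun p => (⟨⟨Fin p.1⟩, fun i => f (p.2 i)⟩ : Wreath (Level n)),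
      fun (W : Wreath (Level n)) => ?_⟩
    let e := Fintype.equivFin W.index.carrier
    choose k hk using fun i => hf (W.fam (e.symm i))
    refine ⟨⟨Fintype.card W.index.carrier, k⟩, ⟨?_⟩⟩
    let φ i := (hk i).some
    refine ⟨⟨⟨e.symm⟩, fun i => (φ i).hom⟩,
      ⟨⟨e⟩, fun s => eqToHom (by simp) ≫ (φ (e s)).inv⟩, ?_, ?_⟩
    · refine Wreath.hom_ext (fun s => e.apply_symm_apply s) fun s => ?_
      have key : ∀ (s t : Fin (Fintype.card W.index.carrier)) (h : t = s),
          ((φ s).hom ≫ eqToHom (by rw [h]) ≫ (φ t).inv) ≫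
            eqToHom (congrArg (fun i => f (k i)) h) = 𝟙 (f (k s)) := by
        rintro s _ rfl
        simp
      exact key s _ (e.apply_symm_apply s)
    · refine Wreath.hom_ext (fun s => e.symm_apply_apply s) fun s => ?_
      have h := congrArg W.fam (e.symm_apply_apply s)
      have key : ((eqToHom h.symm ≫ (φ (e s)).inv) ≫ (φ (e s)).hom) ≫ eqToHom h =
          𝟙 (W.fam s) := by simp
      exact key

instance Level.essentiallySmall (n : ℕ) : EssentiallySmall.{0} (Level n) := by
  obtain ⟨K, f, hf⟩ := Level.exists_small n
  refine (essentiallySmall_iff _).2 ⟨small_of_surjective (f := fun k => toSkeleton (f k)) ?_,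
    inferInstance⟩
  intro W
  obtain ⟨k, ⟨e⟩⟩ := hf ((fromSkeleton _).obj W)
  exact ⟨k, (toSkeleton_eq_iff.2 ⟨e⟩).trans (by simp)⟩


/-! ### Composition products of symmetric sequences -/

section Sequences

variable (C : Type u) [Category.{v} C]

/-- Symmetric sequences in `C`: functors `Σ_* ⥤ C`. -/
abbrev SymSeq := FinBij ⥤ C

variable {C}

section Kan

variable [HasLimitsOfSize.{0, 0} C]

instance hasRightKanExtension (n : ℕ) (F : Level n ⥤ C) :
    (gamma n).HasRightKanExtension F := by
  have (S : FinBij) : HasLimitsOfShape (StructuredArrow S (gamma n)) C :=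
    hasLimitsOfShape_of_equivalence (equivSmallModel.{0} (StructuredArrow S (gamma n))).symm
  infer_instance

/-- The right Kan extension `R_γ F : Σ_* ⥤ C` of `F : Σ_*^{≀ (n+1)} ⥤ C` along `γ`. -/
def kan (n : ℕ) (F : Level n ⥤ C) : SymSeq C := (gamma n).rightKanExtension F

/-- The universal transformation `ι : (R_γ F) γ ⟶ F`. -/
def kanCounit (n : ℕ) (F : Level n ⥤ C) : gamma n ⋙ kan n F ⟶ F :=
  (gamma n).rightKanExtensionCounit F

end Kan

variable [MonoidalCategory C] [SymmetricCategory C]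

universe v₁ u₁

section Odot

variable {𝒜 : Type u₁} [Category.{v₁} 𝒜]

/-- The product `A ⊚ B : Σ_* ≀ 𝒜 ⥤ C`, `{a_s}_{s ∈ S} ↦ A(S) ⊗ ⨂_{s ∈ S} B(a_s)`. -/
def odot (A : SymSeq C) (B : 𝒜 ⥤ C) : Wreath 𝒜 ⥤ C where
  obj W := A.obj W.index ⊗ tensorOver fun s : W.index.carrier => B.obj (W.fam s)
  map f := A.map f.base ⊗ₘ tensorOverMap f.base.equiv fun s => B.map (f.app s)
  map_id W := by
    have h : (tensorOverMap (Equiv.refl W.index.carrier) fun s => B.map (𝟙 (W.fam s))) = 𝟙 _ := by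
      simp only [B.map_id]
      exact tensorOverMap_id _
    have h' : A.map (𝟙 W.index) = 𝟙 _ := A.map_id _
    exact (congrArg₂ (fun a b => a ⊗ₘ b) h' h).trans (id_tensorHom_id _ _)
  map_comp {X Y Z} f g := by
    have h := tensorOverMap_comp (X := fun s => B.obj (X.fam s)) (Y := fun s => B.obj (Y.fam s))
      (Z := fun s => B.obj (Z.fam s)) f.base.equiv g.base.equiv (fun s => B.map (f.app s))
      (fun s => B.map (g.app s))
    rw [tensorHom_comp_tensorHom, ← A.map_comp, ← h]
    exact congrArg (fun t => A.map (f.base ≫ g.base) ⊗ₘ tensorOverMap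
      (X := fun s => B.obj (X.fam s)) (Y := fun s => B.obj (Z.fam s))
      (f.base.equiv.trans g.base.equiv) t) (funext fun s => B.map_comp (f.app s) _)

/-- `Id ⊚ f` at an object `W` of a wreath product, for a family of morphisms
`f s : b_s ⟶ b'_s` between objects of `C` indexed by the index set of `W`. -/
def odotWhisker (A : SymSeq C) {S : FinBij} {b b' : S.carrier → C} (f : ∀ s, b s ⟶ b' s) :
    A.obj S ⊗ tensorOver b ⟶ A.obj S ⊗ tensorOver b' :=
  A.obj S ◁ tensorOverMap (Equiv.refl S.carrier) f

/-- The associativity `(A ⊚ A') ⊚ B ⟶ A ⊚ (A' ⊚ B)` of `⊚`, at an object of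
`Σ_* ≀ (Σ_* ≀ 𝒜)`. -/
def odotAssoc (A A' : SymSeq C) (B : 𝒜 ⥤ C) (W : Wreath (Wreath 𝒜)) :
    (odot A A').obj W.shape ⊗
        tensorOver (fun p : Σ s, (W.fam s).index.carrier => B.obj ((W.fam p.1).fam p.2)) ⟶
      (odot A (odot A' B)).obj W :=
  (α_ (A.obj W.index) _ _).hom ≫
    A.obj W.index ◁ (_ ◁ tensorOverSigma _ ≫ tensorOverZip _ _)

/-- The transformation `Δ̃ ≀ Id : (A ⊚ B)(γ² ≀ Id) ⟶ A ⊚ A ⊚ B` at an object of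
`Σ_* ≀ (Σ_* ≀ 𝒜)`, which applies a cocomposition `Δ̃` to the lowest level. -/
def cocompBottom {A : SymSeq C} (Δ : coprod ⋙ A ⟶ odot A A) (B : 𝒜 ⥤ C)
    (W : Wreath (Wreath 𝒜)) :
    (odot A B).obj (merge.obj W) ⟶ (odot A (odot A B)).obj W :=
  Δ.app W.shape ▷ _ ≫ odotAssoc A A B W

end Odot

variable [HasLimitsOfSize.{0, 0} C]

variable (C) in
/-- The counit symmetric sequence: the monoidal unit on one-element sets and the final object
on all other finite sets. -/
def counitSeq : SymSeq C where
  obj T := if Fintype.card T.carrier = 1 then 𝟙_ C else ⊤_ C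
  map f := eqToHom (by rw [Fintype.card_congr f.equiv])

/-- The value of the counit sequence on the one-point set is the monoidal unit. -/
def counitSeqPoint : (counitSeq C).obj FinBij.point ⟶ 𝟙_ C :=
  eqToHom (if_pos (t := 𝟙_ C) (e := ⊤_ C) (c := Fintype.card PUnit.{1} = 1) Fintype.card_punit)

section Counit

variable {𝒜 : Type u₁} [Category.{v₁} 𝒜]

/-- The transformation `(A ⊚ B) s₀ ⟶ (𝟙 ⊚ B) s₀ = B` induced by a counit `ε̃ : A ⟶ 𝟙`. -/
def counitBottom {A : SymSeq C} (ε : A ⟶ counitSeq C) (B : 𝒜 ⥤ C) (a : 𝒜) :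
    (odot A B).obj (singleFam.obj a) ⟶ B.obj a :=
  ((ε.app FinBij.point ≫ counitSeqPoint) ⊗ₘ tensorOverPUnit fun _ => B.obj a) ≫
    (λ_ (B.obj a)).hom

end Counit

/-- The canonical bijection between the two iterated disjoint unions of a family of families of
finite sets (both of which are `γ³`). -/
def coprodAssoc (W : Wreath (Wreath FinBij)) :
    coprod.obj ((Wreath.map coprod).obj W) ⟶ coprod.obj (merge.obj W) :=
  ⟨(Equiv.sigmaAssoc fun (s : W.index.carrier) (t : (W.fam s).index.carrier) =>
    ((W.fam s).fam t).carrier).symm⟩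

/-- The compatibility of a left coaction `Δ̃_M : M γ² ⟶ A ⊚ M` with the cocomposition
`Δ̃ : A γ² ⟶ A ⊚ A`: both ways from `M γ³` to `A ⊚ A ⊚ M` agree. -/
def IsCoassociative {A M : SymSeq C} (Δ : coprod ⋙ A ⟶ odot A A) (ΔM : coprod ⋙ M ⟶ odot A M) :
    Prop :=
  ∀ W : Wreath (Wreath FinBij),
    M.map (coprodAssoc W) ≫ ΔM.app (merge.obj W) ≫ cocompBottom Δ M W =
      ΔM.app ((Wreath.map coprod).obj W) ≫ odotWhisker A fun s => ΔM.app (W.fam s)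

/-- The compatibility of a left coaction with the counit `ε̃ : A ⟶ 𝟙` and `s₀`. -/
def IsLeftCounital {A M : SymSeq C} (ε : A ⟶ counitSeq C) (ΔM : coprod ⋙ M ⟶ odot A M) : Prop :=
  ∀ S : FinBij,
    M.map (sigmaPoint S) ≫ ΔM.app (singleFam.obj S) ≫ counitBottom ε M S = 𝟙 (M.obj S)

/-- The canonical bijection of a set with the disjoint union of one-point sets indexed by it. -/
def sigmaPoints (S : FinBij) : S ⟶ coprod.obj ⟨S, fun _ => FinBij.point⟩ :=
  ⟨(Equiv.sigmaPUnit S.carrier).symm⟩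

/-- The compatibility of a cocomposition with the counit `ε̃ : A ⟶ 𝟙` and `s₁`. -/
def IsRightCounital {A : SymSeq C} (ε : A ⟶ counitSeq C) (Δ : coprod ⋙ A ⟶ odot A A) : Prop :=
  ∀ S : FinBij,
    A.map (sigmaPoints S) ≫ Δ.app ⟨S, fun _ => FinBij.point⟩ ≫
      (odotWhisker A (S := S) fun _ => ε.app FinBij.point ≫ counitSeqPoint) ≫
      A.obj S ◁ tensorOverUnits S.carrier ≫ (ρ_ (A.obj S)).hom = 𝟙 (A.obj S)

variable (C) in
/-- Counital cooperads in `C`. -/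
structure Cooperad where
  seq : SymSeq C
  cocomp : coprod ⋙ seq ⟶ odot seq seq
  counit : seq ⟶ counitSeq C
  coassoc : IsCoassociative cocomp cocomp
  left_counit : IsLeftCounital counit cocomp
  right_counit : IsRightCounital counit cocomp

/-- Left comodules over a counital cooperad. -/
structure LeftComodule (O : Cooperad C) where
  seq : SymSeq C
  coact : coprod ⋙ seq ⟶ odot O.seq seq
  coassoc : IsCoassociative O.cocomp coact
  left_counit : IsLeftCounital O.counit coact

variable {O : Cooperad C} (M : LeftComodule O)

namespace LeftComodule

/-- The functor `O ⊚ ⋯ ⊚ O ⊚ M : Σ_*^{≀ (n+1)} ⥤ C` with `n` factors `O`. -/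
def iter : ∀ n, Level n ⥤ C
  | 0 => M.seq
  | n + 1 => odot O.seq (iter n)

/-- `Δ̃ᵢ : (O^{⊚ n} ⊚ M) ∂ᵢ ⟶ O^{⊚ (n+1)} ⊚ M` at an object: apply the cocomposition of `O` (or,
at the top level `i = n`, the coaction of `M`) at level `i`. -/
def cofaceApp : ∀ (n : ℕ) (i : Fin (n + 1)) (W : Level (n + 1)),
    (M.iter n).obj ((face n i).obj W) ⟶ (M.iter (n + 1)).obj W
  | 0 => fun _ W => M.coact.app W
  | n + 1 => Fin.cases (fun W => cocompBottom O.cocomp (M.iter n) W)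
      fun i W => odotWhisker O.seq (S := W.index) fun s => cofaceApp n i (W.fam s)

/-- `ε̃ⱼ : (O^{⊚ (n+1)} ⊚ M) sⱼ ⟶ O^{⊚ n} ⊚ M` at an object: apply the counit of `O` at
level `j`. -/
def codegenApp : ∀ (n : ℕ) (j : Fin (n + 1)) (W : Level n),
    (M.iter (n + 1)).obj ((degen n j).obj W) ⟶ (M.iter n).obj W
  | 0 => fun _ W => counitBottom O.counit (M.iter 0) W
  | n + 1 => Fin.cases (fun W => counitBottom O.counit (M.iter (n + 1)) W)
      fun j W => odotWhisker O.seq (S := W.index) fun s => codegenApp n j (W.fam s)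

/-- The symmetric sequence `O ∘̂ ⋯ ∘̂ O ∘̂ M` with `n` factors `O`: the right Kan extension of
`O^{⊚ n} ⊚ M` along `γ`. For `n = 0` it is `M`, as `γ` is then the identity functor. -/
def compProd : ℕ → SymSeq C
  | 0 => M.seq
  | n + 1 => kan (n + 1) (M.iter (n + 1))

/-- The universal transformation `ι : (O^{∘̂ n} ∘̂ M) γ ⟶ O^{⊚ n} ⊚ M`. -/
def iota : ∀ n, gamma n ⋙ M.compProd n ⟶ M.iter n
  | 0 => (Functor.leftUnitor M.seq).hom
  | n + 1 => kanCounit (n + 1) (M.iter (n + 1))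

/-- `d : O^{∘̂ n} ∘̂ M ⟶ O^{∘̂ (n+1)} ∘̂ M` is the map induced on right Kan extensions
by `Δ̃ᵢ`. -/
def IsCoface (n : ℕ) (i : Fin (n + 1)) (d : M.compProd n ⟶ M.compProd (n + 1)) : Prop :=
  ∀ W : Level (n + 1), d.app ((gamma (n + 1)).obj W) ≫ (M.iota (n + 1)).app W =
    (M.compProd n).map (gammaFace n i W) ≫ (M.iota n).app ((face n i).obj W) ≫ M.cofaceApp n i W

/-- `s : O^{∘̂ (n+1)} ∘̂ M ⟶ O^{∘̂ n} ∘̂ M` is the map induced on right Kan extensions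
by `ε̃ⱼ`. -/
def IsCodegen (n : ℕ) (j : Fin (n + 1)) (s : M.compProd (n + 1) ⟶ M.compProd n) : Prop :=
  ∀ W : Level n, s.app ((gamma n).obj W) ≫ (M.iota n).app W =
    (M.compProd (n + 1)).map (gammaDegen n j W) ≫ (M.iota (n + 1)).app ((degen n j).obj W) ≫
      M.codegenApp n j W

end LeftComodule

end Sequences

/-- An extra codegeneracy (below the codegeneracy `σ 0`) of a coaugmented cosimplicial object. -/
structure ExtraCodegeneracy {D : Type u} [Category.{v} D]
    (X : CosimplicialObject.Augmented D) where
  s' : X.right.obj (.mk 0) ⟶ X.left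
  s : ∀ n : ℕ, X.right.obj (.mk (n + 1)) ⟶ X.right.obj (.mk n)
  aug_s' : X.hom.app (.mk 0) ≫ s' = 𝟙 X.left
  δ_one_s : X.right.δ 1 ≫ s 0 = s' ≫ X.hom.app (.mk 0)
  δ_zero_s : ∀ n : ℕ, X.right.δ 0 ≫ s n = 𝟙 _
  δ_succ_s : ∀ (n : ℕ) (i : Fin (n + 2)), X.right.δ i.succ ≫ s (n + 1) = s n ≫ X.right.δ i
  σ_zero_s' : X.right.σ 0 ≫ s' = s 0 ≫ s'
  σ_zero_s : ∀ n : ℕ, X.right.σ 0 ≫ s n = s (n + 1) ≫ s n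
  σ_succ_s : ∀ (n : ℕ) (i : Fin (n + 1)), X.right.σ i.succ ≫ s n = s (n + 1) ≫ X.right.σ i

end CooperadComplex

end

open CooperadComplex

/-! By the universal property of the right Kan extension, a morphism `A ⟶ X^m` is the same as a
natural transformation from `A γ` to `O^{⊚ m} ⊚ M`; for `m = 0` this is trivial, as `γ` is then the
identity. Existence and uniqueness of `Δᵢ` and `εⱼ` are therefore the naturality of `Δ̃ᵢ`, `ε̃ⱼ` and
of the bijections `γ ≅ γ ∂ᵢ`, `γ ≅ γ sⱼ` (`existsUnique_induces`).

The same property allows an equation between maps into `X^m` to be tested after `ι`. Each structure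
map is governed by a `LevelMap`: an assignment on nested families, a bijection of leaves and a
morphism of `C`. Composites of level maps induce composites (`Induces.comp`), and level maps that
differ by a morphism of their object parts induce the same map (`Induces.of_equivalent`). So every
cosimplicial identity becomes a statement about level maps, free of Kan extensions, and is proved by
induction on the nesting depth. If neither operation touches the outermost level, the identity is
`succ` of an earlier one. If one acts there and the other acts strictly inside, they commute by
naturality (`coface_zero_comp_succ_succ`, `codegen_zero_comp`). If they meet there, the identity is
an axiom of `O`, or of `M` when no factor `O` is left.

The axioms of `O` concern `O` alone, but are needed tensored with further inner factors
(`cocompBottom_coassoc`, `cocompBottom_left_counit`, `cocompBottom_right_counit`). The discrepancy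
consists of regroupings of unordered tensor products. All of these are canonical morphisms, and two
canonical morphisms agree as soon as the factors carry distinct labels (`IsCanon.unique`).

Finally, a functor on the simplex category is obtained from maps satisfying the simplicial
identities because these identities generate all relations: the category presented by them is
equivalent to the simplex category. The substance there is faithfulness,
`SimplexCategoryGenRel.map_injective`. -/

noncomputable section

namespace CooperadComplex

universe v u

set_option linter.unusedSectionVars false

section Canonical

variable {C : Type u} [Category.{v} C] [MonoidalCategory C] [SymmetricCategory C]

/-! ### Canonical morphisms between tensor products -/

/-- The reverse of a rearrangement. -/
def Rearr.symm {κ : Type} : ∀ {l l' : List κ}, Rearr l l' → Rearr l' l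
  | _, _, .nil => .nil
  | _, _, .cons a w => .cons a w.symm
  | _, _, .swap a b l => .swap b a l
  | _, _, .trans w w' => .trans w'.symm w.symm

theorem Rearr.hom_symm {κ : Type} (X : κ → C) {l l' : List κ} (w : Rearr l l') :
    w.hom X ≫ w.symm.hom X = 𝟙 _ ∧ w.symm.hom X ≫ w.hom X = 𝟙 _ := by
  induction w with
  | nil => simp [Rearr.hom, Rearr.symm]
  | cons a w ih =>
    simp only [Rearr.hom, Rearr.symm]
    rw [← MonoidalCategory.whiskerLeft_comp, ← MonoidalCategory.whiskerLeft_comp, ih.1, ih.2]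
    simp
  | swap a b l => exact ⟨swapFirst_swapFirst _ _ _, swapFirst_swapFirst _ _ _⟩
  | trans w w' ih ih' =>
    simp only [Rearr.hom, Rearr.symm, Category.assoc]
    constructor
    · rw [reassoc_of% ih'.1, ih.1]
    · rw [reassoc_of% ih.2, ih'.2]

def Rearr.appendLeft {κ : Type} {m m' : List κ} (w : Rearr m m') :
    ∀ l : List κ, Rearr (l ++ m) (l ++ m')
  | [] => w
  | a :: l => .cons a (w.appendLeft l)

def Rearr.appendRight {κ : Type} (m : List κ) :
    ∀ {l l' : List κ}, Rearr l l' → Rearr (l ++ m) (l' ++ m)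
  | _, _, .nil => Rearr.refl m
  | _, _, .cons a w => .cons a (w.appendRight m)
  | _, _, .swap a b l => .swap a b (l ++ m)
  | _, _, .trans w w' => .trans (w.appendRight m) (w'.appendRight m)

theorem Rearr.hom_appendLeft {κ : Type} (X : κ → C) {m m' : List κ} (w : Rearr m m')
    (l : List κ) : (w.appendLeft l).hom X ≫ (listTensorAppend X l m').hom =
      (listTensorAppend X l m).hom ≫ listTensor X l ◁ w.hom X := by
  induction l with
  | nil => simp [Rearr.appendLeft, listTensorAppend]
  | cons a l ih =>
    simp only [Rearr.appendLeft, Rearr.hom, listTensorAppend, Iso.trans_hom, whiskerLeftIso_hom,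
      Iso.symm_hom, Category.assoc]
    erw [← MonoidalCategory.whiskerLeft_comp_assoc, ih]
    simp

theorem Rearr.hom_appendRight {κ : Type} (X : κ → C) {l l' : List κ} (w : Rearr l l')
    (m : List κ) : (w.appendRight m).hom X ≫ (listTensorAppend X l' m).hom =
      (listTensorAppend X l m).hom ≫ w.hom X ▷ listTensor X m := by
  induction w with
  | nil => simp [Rearr.appendRight, Rearr.hom, Rearr.hom_refl]
  | cons a w ih =>
    simp only [Rearr.appendRight, Rearr.hom, listTensorAppend, Iso.trans_hom, whiskerLeftIso_hom,
      Iso.symm_hom, Category.assoc]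
    erw [← MonoidalCategory.whiskerLeft_comp_assoc, ih]
    simp
  | swap a b l =>
    have h := swapFirst_natural (𝟙 (X a)) (𝟙 (X b)) (listTensorAppend X l m).hom
    simp only [id_tensorHom] at h
    simp only [Rearr.appendRight, Rearr.hom, listTensorAppend, Iso.trans_hom, whiskerLeftIso_hom,
      Iso.symm_hom, Category.assoc, MonoidalCategory.whiskerLeft_comp]
    erw [← reassoc_of% h]
    simp only [swapFirst]
    congr 1
    monoidal
  | trans w w' ih ih' =>
    simp only [Rearr.appendRight, Rearr.hom, Category.assoc, comp_whiskerRight]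
    rw [ih', reassoc_of% ih]

/-- `l ++ []` equals `l` only propositionally, so the right unit law of concatenation is recorded by
a rearrangement instead of an equality of words, which would force casts between tensor products.
Associativity of concatenation is treated in the same way. -/
theorem exists_rearr_append_nil {κ : Type} (X : κ → C) (l : List κ) :
    ∃ w : Rearr (l ++ []) l, (listTensorAppend X l []).hom ≫ (ρ_ _).hom = w.hom X := by
  induction l with
  | nil => exact ⟨.nil, by
    change (λ_ (𝟙_ C)).inv ≫ (ρ_ (𝟙_ C)).hom = 𝟙 _
    rw [← unitors_equal, Iso.inv_hom_id]⟩
  | cons a l ih =>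
    obtain ⟨w, h⟩ := ih
    refine ⟨.cons a w, ?_⟩
    simp only [listTensorAppend, Rearr.hom, ← h]
    simp

theorem exists_rearr_append_assoc {κ : Type} (X : κ → C) (l m n : List κ) :
    ∃ w : Rearr ((l ++ m) ++ n) (l ++ (m ++ n)),
      (listTensorAppend X (l ++ m) n).hom ≫ (listTensorAppend X l m).hom ▷ _ ≫ (α_ _ _ _).hom =
        w.hom X ≫ (listTensorAppend X l (m ++ n)).hom ≫ _ ◁ (listTensorAppend X m n).hom := by
  induction l with
  | nil => exact ⟨Rearr.refl _, by simp [listTensorAppend, Rearr.hom_refl]⟩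
  | cons a l ih =>
    obtain ⟨w, h⟩ := ih
    refine ⟨.cons a w, ?_⟩
    have h' := congrArg (fun f => X a ◁ f) h
    simp only [MonoidalCategory.whiskerLeft_comp] at h'
    change (X a ◁ (listTensorAppend X (l ++ m) n).hom ≫ (α_ _ _ _).inv) ≫
        (X a ◁ (listTensorAppend X l m).hom ≫ (α_ _ _ _).inv) ▷ _ ≫ (α_ _ _ _).hom =
      X a ◁ w.hom X ≫ (X a ◁ (listTensorAppend X l (m ++ n)).hom ≫ (α_ _ _ _).inv) ≫
        (X a ⊗ listTensor X l) ◁ (listTensorAppend X m n).hom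
    calc
      _ = (X a ◁ (listTensorAppend X (l ++ m) n).hom ≫
          X a ◁ (listTensorAppend X l m).hom ▷ _ ≫ X a ◁ (α_ _ _ _).hom) ≫ (α_ _ _ _).inv := by
        simp
      _ = _ := by rw [h']; simp

/-- A presentation of an object as the tensor product of the objects `Z t` along a word. -/
structure Pres {τ : Type} (Z : τ → C) (A : C) where
  word : List τ
  iso : A ≅ listTensor Z word

variable {τ : Type} {Z : τ → C}

namespace Pres

variable (Z) in
def unit : Pres Z (𝟙_ C) := ⟨[], Iso.refl _⟩

variable (Z) in
def leaf (t : τ) : Pres Z (Z t) := ⟨[t], (ρ_ (Z t)).symm⟩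

def tensor {A B : C} (p : Pres Z A) (q : Pres Z B) : Pres Z (A ⊗ B) :=
  ⟨p.word ++ q.word, (p.iso ⊗ᵢ q.iso) ≪≫ (listTensorAppend Z p.word q.word).symm⟩

def ofList {κ : Type} {X : κ → C} (p : ∀ k, Pres Z (X k)) :
    ∀ l : List κ, Pres Z (listTensor X l)
  | [] => unit Z
  | a :: l => (p a).tensor (ofList p l)

def all {κ : Type} [Fintype κ] {X : κ → C} (p : ∀ k, Pres Z (X k)) : Pres Z (tensorOver X) :=
  ofList p (enum κ)

theorem word_ofList {κ : Type} {X : κ → C} (p : ∀ k, Pres Z (X k)) (l : List κ) :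
    (ofList p l).word = l.flatMap fun k => (p k).word := by
  induction l with
  | nil => rfl
  | cons a l ih => simp [ofList, tensor, ih]

theorem nodup_tensor {A B : C} {p : Pres Z A} {q : Pres Z B} (hp : p.word.Nodup)
    (hq : q.word.Nodup) (h : ∀ t ∈ p.word, t ∉ q.word) : (p.tensor q).word.Nodup :=
  hp.append hq fun _ ht ht' => h _ ht ht'

theorem mem_word_all {κ : Type} [Fintype κ] {X : κ → C} {p : ∀ k, Pres Z (X k)} {t : τ} :
    t ∈ (all p).word ↔ ∃ k, t ∈ (p k).word := by
  simp [all, word_ofList, mem_enum]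

theorem mem_word_tensor {A B : C} {p : Pres Z A} {q : Pres Z B} {t : τ} :
    t ∈ (p.tensor q).word ↔ t ∈ p.word ∨ t ∈ q.word :=
  List.mem_append

theorem mem_word_leaf {t t' : τ} : t ∈ (leaf Z t').word ↔ t = t' := List.mem_singleton

theorem nodup_all {κ : Type} [Fintype κ] {X : κ → C} {p : ∀ k, Pres Z (X k)}
    (hp : ∀ k, (p k).word.Nodup) (h : ∀ k k' t, t ∈ (p k).word → t ∈ (p k').word → k = k') :
    (all p).word.Nodup := by
  rw [all, word_ofList, List.nodup_flatMap]
  refine ⟨fun k _ => hp k, (enum_nodup κ).imp fun hne => ?_⟩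
  intro t ht ht'
  exact hne (h _ _ t ht ht')

theorem nodup_all_leaf {κ : Type} [Fintype κ] {φ : κ → τ} (hφ : Function.Injective φ) :
    (all fun k => leaf Z (φ k)).word.Nodup :=
  nodup_all (fun _ => List.nodup_singleton _) fun _ _ _ h h' =>
    hφ ((mem_word_leaf.1 h).symm.trans (mem_word_leaf.1 h'))

end Pres

/-- A morphism between presented objects is canonical if it is induced by a rearrangement of
the presenting words. -/
def IsCanon {A B : C} (p : Pres Z A) (q : Pres Z B) (f : A ⟶ B) : Prop :=
  ∃ w : Rearr p.word q.word, f = p.iso.hom ≫ w.hom Z ≫ q.iso.inv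

namespace IsCanon

variable {A B D E : C} {p : Pres Z A} {q : Pres Z B} {r : Pres Z D} {r' : Pres Z E}

/-- The form in which coherence is applied. The label type is free, so the factors of a diagram can
be given distinct labels even when they coincide as objects. With a repeated label the symmetry of
the two equal factors would be canonical besides the identity, hence the hypothesis on the word. -/
theorem unique (hp : p.word.Nodup) {f g : A ⟶ B} (hf : IsCanon p q f) (hg : IsCanon p q g) :
    f = g := by
  obtain ⟨w, rfl⟩ := hf
  obtain ⟨w', rfl⟩ := hg
  rw [Rearr.coherence Z hp w w']

theorem id (p : Pres Z A) : IsCanon p p (𝟙 A) :=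
  ⟨Rearr.refl _, by simp [Rearr.hom_refl]⟩

theorem comp {f : A ⟶ B} {g : B ⟶ D} (hf : IsCanon p q f) (hg : IsCanon q r g) :
    IsCanon p r (f ≫ g) := by
  obtain ⟨w, rfl⟩ := hf
  obtain ⟨w', rfl⟩ := hg
  exact ⟨w.trans w', by simp [Rearr.hom]⟩

theorem inv {f : A ≅ B} (hf : IsCanon p q f.hom) : IsCanon q p f.inv := by
  obtain ⟨w, hw⟩ := hf
  refine ⟨w.symm, ?_⟩
  rw [← cancel_epi f.hom, f.hom_inv_id, hw]
  simp [reassoc_of% (w.hom_symm Z).1]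

theorem of_inv {f : A ≅ B} (hf : IsCanon q p f.inv) : IsCanon p q f.hom :=
  inv (f := f.symm) hf

theorem whiskerLeft (p : Pres Z A) {f : B ⟶ D} (hf : IsCanon q r f) :
    IsCanon (p.tensor q) (p.tensor r) (A ◁ f) := by
  obtain ⟨w, rfl⟩ := hf
  refine ⟨w.appendLeft p.word, ?_⟩
  change _ = ((p.iso.hom ⊗ₘ q.iso.hom) ≫ (listTensorAppend Z _ _).inv) ≫
    (w.appendLeft p.word).hom Z ≫ (listTensorAppend Z _ _).hom ≫ (p.iso.inv ⊗ₘ r.iso.inv)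
  rw [reassoc_of% w.hom_appendLeft Z p.word, Category.assoc, Iso.inv_hom_id_assoc, ← id_tensorHom,
    ← id_tensorHom, tensorHom_comp_tensorHom, tensorHom_comp_tensorHom]
  simp

theorem whiskerRight {f : A ⟶ B} (hf : IsCanon p q f) (r : Pres Z D) :
    IsCanon (p.tensor r) (q.tensor r) (f ▷ D) := by
  obtain ⟨w, rfl⟩ := hf
  refine ⟨w.appendRight r.word, ?_⟩
  change _ = ((p.iso.hom ⊗ₘ r.iso.hom) ≫ (listTensorAppend Z _ _).inv) ≫
    (w.appendRight r.word).hom Z ≫ (listTensorAppend Z _ _).hom ≫ (q.iso.inv ⊗ₘ r.iso.inv)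
  rw [reassoc_of% w.hom_appendRight Z r.word, Category.assoc, Iso.inv_hom_id_assoc,
    ← tensorHom_id, ← tensorHom_id, tensorHom_comp_tensorHom, tensorHom_comp_tensorHom]
  simp

theorem tensor {f : A ⟶ B} {g : D ⟶ E} (hf : IsCanon p q f) (hg : IsCanon r r' g) :
    IsCanon (p.tensor r) (q.tensor r') (f ⊗ₘ g) := by
  rw [MonoidalCategory.tensorHom_def]
  exact (hf.whiskerRight r).comp (whiskerLeft q hg)

theorem leftUnitor (p : Pres Z A) : IsCanon ((Pres.unit Z).tensor p) p (λ_ A).hom := by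
  refine ⟨Rearr.refl _, ?_⟩
  simp [Pres.tensor, Pres.unit, listTensorAppend, Rearr.hom_refl]

theorem rightUnitor (p : Pres Z A) : IsCanon (p.tensor (Pres.unit Z)) p (ρ_ A).hom := by
  obtain ⟨w, h⟩ := exists_rearr_append_nil Z p.word
  refine ⟨w, ?_⟩
  change _ = ((p.iso.hom ⊗ₘ 𝟙 _) ≫ (listTensorAppend Z _ _).inv) ≫ w.hom Z ≫ p.iso.inv
  rw [← h]
  simp

theorem associator (p : Pres Z A) (q : Pres Z B) (r : Pres Z D) :
    IsCanon ((p.tensor q).tensor r) (p.tensor (q.tensor r)) (α_ A B D).hom := by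
  obtain ⟨w, h⟩ := exists_rearr_append_assoc Z p.word q.word r.word
  refine ⟨w, ?_⟩
  change _ = ((((p.iso.hom ⊗ₘ q.iso.hom) ≫ (listTensorAppend Z _ _).inv) ⊗ₘ r.iso.hom) ≫
      (listTensorAppend Z _ _).inv) ≫ w.hom Z ≫ (listTensorAppend Z _ _).hom ≫
      (p.iso.inv ⊗ₘ ((listTensorAppend Z _ _).hom ≫ (q.iso.inv ⊗ₘ r.iso.inv)))
  have e : p.iso.inv ⊗ₘ ((listTensorAppend Z q.word r.word).hom ≫ (q.iso.inv ⊗ₘ r.iso.inv)) =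
      _ ◁ (listTensorAppend Z q.word r.word).hom ≫ (p.iso.inv ⊗ₘ (q.iso.inv ⊗ₘ r.iso.inv)) := by
    rw [← id_tensorHom, tensorHom_comp_tensorHom, Category.id_comp]
  rw [e, ← reassoc_of% h, Category.assoc, Iso.inv_hom_id_assoc, ← tensorHom_id,
    tensorHom_comp_tensorHom_assoc, ← associator_naturality, tensorHom_comp_tensorHom_assoc]
  simp

/-- The braiding of two single factors is one adjacent transposition. The work is to cancel the
monoidal units that end the one-letter list tensors. -/
theorem braiding_leaf_leaf (s t : τ) :
    IsCanon ((Pres.leaf Z s).tensor (Pres.leaf Z t)) ((Pres.leaf Z t).tensor (Pres.leaf Z s))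
      (β_ (Z s) (Z t)).hom := by
  refine ⟨.swap s t [], ?_⟩
  have key : ((ρ_ (Z s)).inv ⊗ₘ (ρ_ (Z t)).inv) ≫ (α_ (Z s) (𝟙_ C) (Z t ⊗ 𝟙_ C)).hom ≫
      Z s ◁ (λ_ (Z t ⊗ 𝟙_ C)).hom = Z s ◁ (ρ_ (Z t)).inv := by
    rw [MonoidalCategory.tensorHom_def]
    monoidal
  have key' : Z t ◁ (λ_ (Z s ⊗ 𝟙_ C)).inv ≫ (α_ (Z t) (𝟙_ C) (Z s ⊗ 𝟙_ C)).inv ≫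
      ((ρ_ (Z t)).hom ⊗ₘ (ρ_ (Z s)).hom) = Z t ◁ (ρ_ (Z s)).hom := by
    rw [MonoidalCategory.tensorHom_def]
    monoidal
  change _ = (((ρ_ (Z s)).inv ⊗ₘ (ρ_ (Z t)).inv) ≫ (α_ (Z s) (𝟙_ C) (Z t ⊗ 𝟙_ C)).hom ≫
      Z s ◁ (λ_ (Z t ⊗ 𝟙_ C)).hom) ≫ ((α_ (Z s) (Z t) (𝟙_ C)).inv ≫
      (β_ (Z s) (Z t)).hom ▷ 𝟙_ C ≫ (α_ (Z t) (Z s) (𝟙_ C)).hom) ≫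
      (Z t ◁ (λ_ (Z s ⊗ 𝟙_ C)).inv ≫ (α_ (Z t) (𝟙_ C) (Z s ⊗ 𝟙_ C)).inv) ≫
      ((ρ_ (Z t)).hom ⊗ₘ (ρ_ (Z s)).hom)
  rw [key, Category.assoc, Category.assoc, Category.assoc, key']
  simp

/-- Canonicity may be checked after conjugating with canonical isomorphisms. -/
theorem of_conj {A' B' : C} {p' : Pres Z A'} {q' : Pres Z B'} (a : A ≅ A') (b : B ≅ B')
    (ha : IsCanon p p' a.hom) (hb : IsCanon q q' b.hom) {f : A ⟶ B} {f' : A' ⟶ B'}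
    (hf' : IsCanon p' q' f') (h : f = a.hom ≫ f' ≫ b.inv) : IsCanon p q f :=
  h ▸ ha.comp (hf'.comp hb.inv)

theorem braiding_unit_left (p : Pres Z A) :
    IsCanon ((Pres.unit Z).tensor p) (p.tensor (Pres.unit Z)) (β_ (𝟙_ C) A).hom := by
  rw [braiding_tensorUnit_left]
  exact (leftUnitor p).comp (rightUnitor p).inv

theorem braiding_unit_right (p : Pres Z A) :
    IsCanon (p.tensor (Pres.unit Z)) ((Pres.unit Z).tensor p) (β_ A (𝟙_ C)).hom := by
  rw [braiding_tensorUnit_right]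
  exact (rightUnitor p).comp (leftUnitor p).inv

theorem braiding_tensor_left (hp : IsCanon (p.tensor r) (r.tensor p) (β_ A D).hom)
    (hq : IsCanon (q.tensor r) (r.tensor q) (β_ B D).hom) :
    IsCanon ((p.tensor q).tensor r) (r.tensor (p.tensor q)) (β_ (A ⊗ B) D).hom := by
  rw [BraidedCategory.braiding_tensor_left_hom]
  exact (associator p q r).comp <| (whiskerLeft p hq).comp <| (associator p r q).inv.comp <|
    (hp.whiskerRight q).comp (associator r p q)

theorem braiding_tensor_right (hp : IsCanon (r.tensor p) (p.tensor r) (β_ D A).hom)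
    (hq : IsCanon (r.tensor q) (q.tensor r) (β_ D B).hom) :
    IsCanon (r.tensor (p.tensor q)) ((p.tensor q).tensor r) (β_ D (A ⊗ B)).hom := by
  rw [BraidedCategory.braiding_tensor_right_hom]
  exact (associator r p q).inv.comp <| (hp.whiskerRight q).comp <| (associator p r q).comp <|
    (whiskerLeft p hq).comp (associator p q r).inv

/-- Both presentations have the same word, but the first is assembled factor by factor. The
comparison lets an arbitrary presentation be replaced by one built from leaves, on which induction
over the word is possible. -/
theorem ofList_leaf (l : List τ) :
    IsCanon (Pres.ofList (Pres.leaf Z) l) ⟨l, Iso.refl _⟩ (𝟙 _) := by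
  induction l with
  | nil => exact ⟨Rearr.refl _, by simp [Pres.ofList, Pres.unit, Rearr.hom_refl]⟩
  | cons t l ih =>
    have h : IsCanon ((Pres.leaf Z t).tensor ⟨l, Iso.refl _⟩) ⟨t :: l, Iso.refl _⟩ (𝟙 _) := by
      refine ⟨Rearr.refl _, ?_⟩
      change 𝟙 _ = (((ρ_ (Z t)).inv ⊗ₘ 𝟙 _) ≫ (α_ (Z t) (𝟙_ C) _).hom ≫ Z t ◁ (λ_ _).hom) ≫
        (Rearr.refl (t :: l)).hom Z ≫ 𝟙 _
      rw [Rearr.hom_refl]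
      simp
    have h' := (whiskerLeft (Pres.leaf Z t) ih).comp h
    rwa [MonoidalCategory.whiskerLeft_id, Category.id_comp] at h'

theorem iso_hom (p : Pres Z A) : IsCanon p (Pres.ofList (Pres.leaf Z) p.word) p.iso.hom := by
  have h : IsCanon p ⟨p.word, Iso.refl _⟩ p.iso.hom := ⟨Rearr.refl _, by simp [Rearr.hom_refl]⟩
  have h' := h.comp (of_inv (f := Iso.refl _) (ofList_leaf p.word))
  rwa [Iso.refl_hom, Category.comp_id] at h'

/-- After conjugation with the presenting isomorphisms both objects are list tensors of leaves. The
two hexagon identities then reduce the braiding, one argument at a time, to pairs of leaves and to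
braidings with the unit. -/
theorem braiding (p : Pres Z A) (q : Pres Z B) :
    IsCanon (p.tensor q) (q.tensor p) (β_ A B).hom := by
  have h₁ : ∀ (s : τ) (l : List τ), IsCanon ((Pres.leaf Z s).tensor (.ofList (Pres.leaf Z) l))
      ((Pres.ofList (Pres.leaf Z) l).tensor (Pres.leaf Z s)) (β_ (Z s) (listTensor Z l)).hom := by
    intro s l
    induction l with
    | nil => exact braiding_unit_right _
    | cons t l ih => exact braiding_tensor_right (braiding_leaf_leaf s t) ih
  have h₂ : ∀ l m : List τ,
      IsCanon ((Pres.ofList (Pres.leaf Z) l).tensor (.ofList (Pres.leaf Z) m))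
        ((Pres.ofList (Pres.leaf Z) m).tensor (.ofList (Pres.leaf Z) l))
        (β_ (listTensor Z l) (listTensor Z m)).hom := by
    intro l m
    induction l with
    | nil => exact braiding_unit_left _
    | cons t l ih => exact braiding_tensor_left (h₁ t m) ih
  refine of_conj (p.iso ⊗ᵢ q.iso) (q.iso ⊗ᵢ p.iso) ((iso_hom p).tensor (iso_hom q))
    ((iso_hom q).tensor (iso_hom p)) (h₂ p.word q.word) ?_
  simp only [tensorIso_hom, tensorIso_inv]
  rw [BraidedCategory.braiding_naturality_assoc, tensorHom_comp_tensorHom]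
  simp

theorem swapFirst (p : Pres Z A) (q : Pres Z B) (r : Pres Z D) :
    IsCanon (p.tensor (q.tensor r)) (q.tensor (p.tensor r)) (swapFirst A B D) :=
  (associator p q r).inv.comp <| ((braiding p q).whiskerRight r).comp (associator q p r)

theorem tensorμ (p : Pres Z A) (q : Pres Z B) (r : Pres Z D) (r' : Pres Z E) :
    IsCanon ((p.tensor q).tensor (r.tensor r')) ((p.tensor r).tensor (q.tensor r'))
      (tensorμ A B D E) :=
  (associator p q _).comp <| (whiskerLeft p (associator q r r').inv).comp <|
    (whiskerLeft p ((braiding q r).whiskerRight r')).comp <|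
    (whiskerLeft p (associator r q r')).comp (associator p r _).inv

section List

variable {ι κ : Type} {X : κ → C} {Y : ι → C}

/-- A transposition of two entries moves whole words past each other. This is why the braiding has
to be canonical for arbitrary presentations and not only for single labels. -/
theorem rearr_hom (p : ∀ k, Pres Z (X k)) {l l' : List κ} (w : Rearr l l') :
    IsCanon (Pres.ofList p l) (Pres.ofList p l') (w.hom X) := by
  induction w with
  | nil => exact id _
  | cons a w ih => exact whiskerLeft _ ih
  | swap a b l => exact swapFirst _ _ _
  | trans w w' ih ih' => exact ih.comp ih'

theorem permHom (p : ∀ k, Pres Z (X k)) {l l' : List κ} (h : l.Perm l') :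
    IsCanon (Pres.ofList p l) (Pres.ofList p l') (permHom X h) :=
  rearr_hom p _

theorem listTensorMap {X' : κ → C} {p : ∀ k, Pres Z (X k)} {p' : ∀ k, Pres Z (X' k)}
    {f : ∀ k, X k ⟶ X' k} (hf : ∀ k, IsCanon (p k) (p' k) (f k)) (l : List κ) :
    IsCanon (Pres.ofList p l) (Pres.ofList p' l) (listTensorMap f l) := by
  induction l with
  | nil => exact id _
  | cons a l ih => exact (hf a).tensor ih

theorem listTensorRelabel (e : ι → κ) (p : ∀ k, Pres Z (X k)) (l : List ι) :
    IsCanon (Pres.ofList (fun i => p (e i)) l) (Pres.ofList p (l.map e))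
      (listTensorRelabel e X l).hom := by
  induction l with
  | nil => exact id _
  | cons a l ih => exact whiskerLeft _ ih

theorem listTensorAppend (p : ∀ k, Pres Z (X k)) (l m : List κ) :
    IsCanon (Pres.ofList p (l ++ m)) ((Pres.ofList p l).tensor (Pres.ofList p m))
      (listTensorAppend X l m).hom := by
  induction l with
  | nil => exact (leftUnitor _).inv
  | cons a l ih => exact (whiskerLeft _ ih).comp (associator _ _ _).inv

theorem listTensorUnits (l : List κ) :
    IsCanon (Pres.ofList (fun _ => Pres.unit Z) l) (Pres.unit Z) (listTensorUnits l) := by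
  induction l with
  | nil => exact id _
  | cons a l ih => exact (leftUnitor _).comp ih

theorem listTensorZip {X' : κ → C} (p : ∀ k, Pres Z (X k)) (p' : ∀ k, Pres Z (X' k))
    (l : List κ) : IsCanon ((Pres.ofList p l).tensor (Pres.ofList p' l))
      (Pres.ofList (fun k => (p k).tensor (p' k)) l) (listTensorZip X X' l) := by
  induction l with
  | nil => exact leftUnitor _
  | cons a l ih => exact (tensorμ _ _ _ _).comp (whiskerLeft _ ih)

theorem listTensorSigma {β : ι → Type} {Y : (Σ i, β i) → C} (p : ∀ x, Pres Z (Y x))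
    (m : ∀ i, List (β i)) (l : List ι) :
    IsCanon (Pres.ofList p (l.sigma m))
      (Pres.ofList (fun i => Pres.ofList (fun b => p ⟨i, b⟩) (m i)) l)
      (listTensorSigma Y m l) := by
  induction l with
  | nil => exact id _
  | cons a l ih =>
    exact (listTensorAppend p _ _).comp ((listTensorRelabel (Sigma.mk a) p (m a)).inv.tensor ih)

end List

section Over

variable {ι κ : Type} [Fintype ι] [Fintype κ] {X : κ → C} {Y : ι → C}

theorem tensorOverMap {p : ∀ i, Pres Z (Y i)} {q : ∀ k, Pres Z (X k)} (e : ι ≃ κ)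
    {f : ∀ i, Y i ⟶ X (e i)} (hf : ∀ i, IsCanon (p i) (q (e i)) (f i)) :
    IsCanon (Pres.all p) (Pres.all q) (tensorOverMap e f) :=
  (listTensorMap hf _).comp <| (listTensorRelabel e q _).comp (permHom q _)

theorem tensorOverPUnit {X : PUnit.{1} → C} (p : ∀ k, Pres Z (X k)) :
    IsCanon (Pres.all p) (p PUnit.unit) (tensorOverPUnit X) :=
  (permHom p _).comp (rightUnitor _)

theorem tensorOverUnits :
    IsCanon (Pres.all fun _ : κ => Pres.unit Z) (Pres.unit Z) (tensorOverUnits κ) :=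
  listTensorUnits _

theorem tensorOverZip {X' : κ → C} (p : ∀ k, Pres Z (X k)) (p' : ∀ k, Pres Z (X' k)) :
    IsCanon ((Pres.all p).tensor (Pres.all p')) (Pres.all fun k => (p k).tensor (p' k))
      (tensorOverZip X X') :=
  listTensorZip p p' _

theorem tensorOverSigma {β : ι → Type} [∀ i, Fintype (β i)] {Y : (Σ i, β i) → C}
    (p : ∀ x, Pres Z (Y x)) :
    IsCanon (Pres.all p) (Pres.all fun i => Pres.all fun b => p ⟨i, b⟩) (tensorOverSigma Y) :=
  (permHom p _).comp (listTensorSigma p _ _)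

end Over

end IsCanon

end Canonical
end CooperadComplex
end

noncomputable section

namespace CooperadComplex

universe v u

set_option linter.unusedSectionVars false

section Distrib

variable {C : Type u} [Category.{v} C] [MonoidalCategory C] [SymmetricCategory C]

/-! ### Naturality and coherence of grouping and interchange -/

theorem permHom_natural {κ : Type} {X Y : κ → C} (f : ∀ k, X k ⟶ Y k) {l l' : List κ}
    (h : l.Perm l') :
    permHom X h ≫ listTensorMap f l' = listTensorMap f l ≫ permHom Y h :=
  Rearr.hom_natural f _

theorem listTensorAppend_natural {κ : Type} {X Y : κ → C} (f : ∀ k, X k ⟶ Y k) (l m : List κ) :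
    listTensorMap f (l ++ m) ≫ (listTensorAppend Y l m).hom =
      (listTensorAppend X l m).hom ≫ (listTensorMap f l ⊗ₘ listTensorMap f m) := by
  induction l with
  | nil => simp [listTensorAppend, listTensorMap]
  | cons a l ih =>
    change (f a ⊗ₘ listTensorMap f (l ++ m)) ≫ Y a ◁ (listTensorAppend Y l m).hom ≫
        (α_ _ _ _).inv = (X a ◁ (listTensorAppend X l m).hom ≫ (α_ _ _ _).inv) ≫
        ((f a ⊗ₘ listTensorMap f l) ⊗ₘ listTensorMap f m)
    rw [Category.assoc, ← associator_inv_naturality, ← id_tensorHom, ← id_tensorHom,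
      tensorHom_comp_tensorHom_assoc, tensorHom_comp_tensorHom_assoc, ih]
    simp

theorem listTensorZip_natural {κ : Type} {U U' V V' : κ → C} (f : ∀ k, U k ⟶ U' k)
    (g : ∀ k, V k ⟶ V' k) (l : List κ) :
    (listTensorMap f l ⊗ₘ listTensorMap g l) ≫ listTensorZip U' V' l =
      listTensorZip U V l ≫ listTensorMap (fun k => f k ⊗ₘ g k) l := by
  induction l with
  | nil => simp [listTensorMap, listTensorZip]
  | cons a l ih =>
    change ((f a ⊗ₘ listTensorMap f l) ⊗ₘ (g a ⊗ₘ listTensorMap g l)) ≫ tensorμ _ _ _ _ ≫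
        _ ◁ listTensorZip U' V' l =
      (tensorμ _ _ _ _ ≫ _ ◁ listTensorZip U V l) ≫ ((f a ⊗ₘ g a) ⊗ₘ listTensorMap _ l)
    rw [tensorμ_natural_assoc, ← id_tensorHom, ← id_tensorHom, tensorHom_comp_tensorHom, ih,
      Category.assoc, tensorHom_comp_tensorHom]
    simp

theorem listTensorSigma_natural {ι : Type} {β : ι → Type} {Y Y' : (Σ i, β i) → C}
    (f : ∀ x, Y x ⟶ Y' x) (m : ∀ i, List (β i)) (l : List ι) :
    listTensorMap f (l.sigma m) ≫ listTensorSigma Y' m l =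
      listTensorSigma Y m l ≫
        listTensorMap (fun i => listTensorMap (fun b => f ⟨i, b⟩) (m i)) l := by
  induction l with
  | nil => simp [listTensorMap, listTensorSigma]
  | cons a l ih =>
    have h := listTensorRelabel_natural (Sigma.mk a) f (m a)
    rw [← Iso.eq_inv_comp, ← Category.assoc, ← Iso.comp_inv_eq] at h
    change listTensorMap f ((m a).map (Sigma.mk a) ++ l.sigma m) ≫
        (listTensorAppend Y' _ _).hom ≫
          ((listTensorRelabel (Sigma.mk a) Y' (m a)).inv ⊗ₘ listTensorSigma Y' m l) =
      ((listTensorAppend Y _ _).hom ≫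
          ((listTensorRelabel (Sigma.mk a) Y (m a)).inv ⊗ₘ listTensorSigma Y m l)) ≫
        (listTensorMap (fun b => f ⟨a, b⟩) (m a) ⊗ₘ listTensorMap _ l)
    rw [← Category.assoc, listTensorAppend_natural, Category.assoc, Category.assoc,
      tensorHom_comp_tensorHom, tensorHom_comp_tensorHom, ih, h]

/-- Factorwise morphisms between unordered tensor products. -/
def tensorOverPi {κ : Type} [Fintype κ] {X Y : κ → C} (f : ∀ k, X k ⟶ Y k) :
    tensorOver X ⟶ tensorOver Y :=
  tensorOverMap (Equiv.refl κ) f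

/-- Renaming the indices of an unordered tensor product. -/
abbrev tensorOverRelabel {ι κ : Type} [Fintype ι] [Fintype κ] (e : ι ≃ κ) (Y : κ → C) :
    tensorOver (fun i => Y (e i)) ⟶ tensorOver Y :=
  tensorOverMap e fun i => 𝟙 (Y (e i))

theorem tensorOverPi_eq {κ : Type} [Fintype κ] {X Y : κ → C} (f : ∀ k, X k ⟶ Y k) :
    tensorOverPi f = listTensorMap f (enum κ) := by
  have h : (listTensorRelabel (Equiv.refl κ) Y (enum κ)).hom ≫
      permHom Y (enum_map_perm (Equiv.refl κ)) = 𝟙 _ :=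
    listTensorRelabel_id Y (enum κ) _ (enum_nodup κ)
  exact (congrArg (listTensorMap f (enum κ) ≫ ·) h).trans (Category.comp_id _)

theorem tensorOverMap_eq {ι κ : Type} [Fintype ι] [Fintype κ] {X : ι → C} {Y : κ → C} (e : ι ≃ κ)
    (f : ∀ i, X i ⟶ Y (e i)) :
    tensorOverMap e f = tensorOverPi f ≫ tensorOverRelabel e Y := by
  have h := tensorOverMap_comp (Equiv.refl ι) e f fun i => 𝟙 (Y (e i))
  exact (congrArg (tensorOverMap e) (funext fun i => (Category.comp_id (f i)).symm)).trans h

theorem tensorOverPi_id {κ : Type} [Fintype κ] (X : κ → C) :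
    tensorOverPi (fun k => 𝟙 (X k)) = 𝟙 (tensorOver X) :=
  tensorOverMap_id X

theorem tensorOverPi_comp {κ : Type} [Fintype κ] {X Y Z : κ → C} (f : ∀ k, X k ⟶ Y k)
    (g : ∀ k, Y k ⟶ Z k) :
    tensorOverPi (fun k => f k ≫ g k) = tensorOverPi f ≫ tensorOverPi g :=
  tensorOverMap_comp (Equiv.refl κ) (Equiv.refl κ) f g

theorem tensorOverPi_comp_map {ι κ : Type} [Fintype ι] [Fintype κ] {X Y : ι → C} {Z : κ → C}
    (e : ι ≃ κ) (f : ∀ i, X i ⟶ Y i) (g : ∀ i, Y i ⟶ Z (e i)) :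
    tensorOverMap e (fun i => f i ≫ g i) = tensorOverPi f ≫ tensorOverMap e g :=
  tensorOverMap_comp (Equiv.refl ι) e f g

/-- Pastes a square of factorwise morphisms (`h₃`) to a square of relabellings (`h₂`). Bare
variables keep the dependent index types out of the rewriting. -/
theorem square_paste {A A₁ B B₁ B₂ D : C} {f : A ⟶ D} {a : A ⟶ A₁} {k : A₁ ⟶ D} {s' : D ⟶ B₂}
    {s : A₁ ⟶ B₁} {m : B₁ ⟶ B₂} {s₀ : A ⟶ B} {n : B ⟶ B₁} {r : B ⟶ B₂} (h₁ : f = a ≫ k)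
    (h₂ : k ≫ s' = s ≫ m) (h₃ : a ≫ s = s₀ ≫ n) (h₄ : r = n ≫ m) : f ≫ s' = s₀ ≫ r := by
  rw [h₁, h₄, Category.assoc, h₂, reassoc_of% h₃]

theorem tensorOverZip_natural_pi {κ : Type} [Fintype κ] {U V U' V' : κ → C}
    (f : ∀ k, U k ⟶ U' k) (g : ∀ k, V k ⟶ V' k) :
    (tensorOverPi f ⊗ₘ tensorOverPi g) ≫ tensorOverZip U' V' =
      tensorOverZip U V ≫ tensorOverPi fun k => f k ⊗ₘ g k := by
  rw [tensorOverPi_eq f, tensorOverPi_eq g, tensorOverPi_eq]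
  exact listTensorZip_natural f g (enum κ)

/-- A morphism over a bijection is a factorwise morphism followed by a relabelling. For the former,
naturality holds already along lists; the latter changes the chosen enumeration and is a matter of
coherence. `tensorOverSigma_natural` is proved by the same splitting. -/
theorem tensorOverZip_natural {ι κ : Type} [Fintype ι] [Fintype κ] {U V : ι → C} {U' V' : κ → C}
    (e : ι ≃ κ) (f : ∀ i, U i ⟶ U' (e i)) (g : ∀ i, V i ⟶ V' (e i)) :
    (tensorOverMap e f ⊗ₘ tensorOverMap e g) ≫ tensorOverZip U' V' =
      tensorOverZip U V ≫ tensorOverMap (Y := fun k => U' k ⊗ V' k) e fun i => f i ⊗ₘ g i := by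
  have key : (tensorOverRelabel e U' ⊗ₘ tensorOverRelabel e V') ≫ tensorOverZip U' V' =
      tensorOverZip (fun i => U' (e i)) (fun i => V' (e i)) ≫
        tensorOverRelabel e fun k => U' k ⊗ V' k := by
    -- Labels in `κ ⊕ κ` keep the factors `U' k` and `V' k` apart.
    let p : ∀ k, Pres (Sum.elim U' V') (U' k) := fun k => Pres.leaf (Sum.elim U' V') (Sum.inl k)
    let q : ∀ k, Pres (Sum.elim U' V') (V' k) := fun k => Pres.leaf (Sum.elim U' V') (Sum.inr k)
    refine IsCanon.unique (p := (Pres.all fun i => p (e i)).tensor (Pres.all fun i => q (e i)))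
      (q := Pres.all fun k => (p k).tensor (q k)) ?_
      (((IsCanon.tensorOverMap (q := p) e fun i => IsCanon.id _).tensor
        (IsCanon.tensorOverMap (q := q) e fun i => IsCanon.id _)).comp
          (IsCanon.tensorOverZip p q))
      ((IsCanon.tensorOverZip _ _).comp (IsCanon.tensorOverMap
        (q := fun k => (p k).tensor (q k)) e fun i => IsCanon.id _))
    refine Pres.nodup_tensor (Pres.nodup_all_leaf (Sum.inl_injective.comp e.injective))
      (Pres.nodup_all_leaf (Sum.inr_injective.comp e.injective)) fun t ht ht' => ?_
    obtain ⟨i, hi⟩ := Pres.mem_word_all.1 ht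
    obtain ⟨i', hi'⟩ := Pres.mem_word_all.1 ht'
    cases (Pres.mem_word_leaf.1 hi).symm.trans (Pres.mem_word_leaf.1 hi')
  exact square_paste (((congrArg₂ (· ⊗ₘ ·) (tensorOverMap_eq e f) (tensorOverMap_eq e g))).trans
    (tensorHom_comp_tensorHom _ _ _ _).symm) key (tensorOverZip_natural_pi f g)
    (tensorOverMap_eq (Y := fun k => U' k ⊗ V' k) e _)

theorem tensorOverSigma_natural_pi {ι : Type} [Fintype ι] {β : ι → Type} [∀ i, Fintype (β i)]
    {Y Y' : (Σ i, β i) → C} (f : ∀ x, Y x ⟶ Y' x) :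
    tensorOverPi f ≫ tensorOverSigma Y' =
      tensorOverSigma Y ≫ tensorOverPi fun i => tensorOverPi fun b => f ⟨i, b⟩ := by
  have h : (fun i => tensorOverPi fun b => f ⟨i, b⟩) =
    fun i => listTensorMap (fun b => f ⟨i, b⟩) (enum (β i)) := funext fun i => tensorOverPi_eq _
  have h₁ := permHom_natural f (enum_sigma_perm (ι := ι) (β := β)).symm
  have h₂ := listTensorSigma_natural f (fun i => enum (β i)) (enum ι)
  have h₃ : listTensorMap f (enum (Σ i, β i)) ≫ permHom Y' enum_sigma_perm.symm ≫
      listTensorSigma Y' (fun i => enum (β i)) (enum ι) =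
    (permHom Y enum_sigma_perm.symm ≫ listTensorSigma Y (fun i => enum (β i)) (enum ι)) ≫
      listTensorMap (fun i => listTensorMap (fun b => f ⟨i, b⟩) (enum (β i))) (enum ι) := by
    rw [← reassoc_of% h₁, h₂, Category.assoc]
  exact ((congrArg (· ≫ tensorOverSigma Y') (tensorOverPi_eq f)).trans h₃).trans
    (congrArg (tensorOverSigma Y ≫ ·) ((tensorOverPi_eq _).trans
      (congrArg (fun g => listTensorMap g (enum ι)) h)).symm)

theorem tensorOverSigma_natural {ι κ : Type} [Fintype ι] [Fintype κ] {β : ι → Type}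
    {δ : κ → Type} [∀ i, Fintype (β i)] [∀ k, Fintype (δ k)] {Y : (Σ i, β i) → C}
    {Y' : (Σ k, δ k) → C} (e : ι ≃ κ) (e' : ∀ i, β i ≃ δ (e i))
    (f : ∀ x : Σ i, β i, Y x ⟶ Y' ⟨e x.1, e' x.1 x.2⟩) :
    tensorOverMap (Equiv.sigmaCongr e e') f ≫ tensorOverSigma Y' =
      tensorOverSigma Y ≫ tensorOverMap (Y := fun k => tensorOver fun d : δ k => Y' ⟨k, d⟩) e
        fun i => tensorOverMap (Y := fun d => Y' ⟨e i, d⟩) (e' i) fun b => f ⟨i, b⟩ := by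
  have key : tensorOverRelabel (Equiv.sigmaCongr e e') Y' ≫ tensorOverSigma Y' =
      tensorOverSigma (fun x : Σ i, β i => Y' ⟨e x.1, e' x.1 x.2⟩) ≫
        tensorOverMap (Y := fun k => tensorOver fun d : δ k => Y' ⟨k, d⟩) e
          fun i => tensorOverRelabel (e' i) fun d => Y' ⟨e i, d⟩ := by
    refine IsCanon.unique
      (p := Pres.all fun x : Σ i, β i => Pres.leaf Y' (Equiv.sigmaCongr e e' x))
      (q := Pres.all fun k => Pres.all fun d => Pres.leaf Y' ⟨k, d⟩) ?_
      ((IsCanon.tensorOverMap (q := Pres.leaf Y') _ fun i => IsCanon.id _).comp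
        (IsCanon.tensorOverSigma _))
      ((IsCanon.tensorOverSigma fun x : Σ i, β i => Pres.leaf Y' ⟨e x.1, e' x.1 x.2⟩).comp
        (IsCanon.tensorOverMap
        (q := fun k => Pres.all fun d => Pres.leaf Y' ⟨k, d⟩) _ fun i =>
          IsCanon.tensorOverMap (q := fun d => Pres.leaf Y' ⟨e i, d⟩) _ fun b => IsCanon.id _))
    exact Pres.nodup_all_leaf (Equiv.sigmaCongr e e').injective
  refine square_paste (tensorOverMap_eq (Y := Y') (Equiv.sigmaCongr e e') f) key
    (tensorOverSigma_natural_pi f) ?_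
  refine Eq.trans ?_ (tensorOverPi_comp_map (Z := fun k => tensorOver fun d : δ k => Y' ⟨k, d⟩) e
    (fun i => tensorOverPi fun b => f ⟨i, b⟩) fun i => tensorOverRelabel (e' i) fun d => Y' ⟨e i, d⟩)
  exact congrArg (tensorOverMap e) (funext fun i => tensorOverMap_eq (Y := fun d => Y' ⟨e i, d⟩) _ _)

/-- The canonical morphism `(⨂ cᵢ) ⊗ (⨂ Y (i,b)) ⟶ ⨂ᵢ (cᵢ ⊗ ⨂_b Y (i,b))`. -/
def tensorOverDistrib {ι : Type} [Fintype ι] {β : ι → Type} [∀ i, Fintype (β i)] (c : ι → C)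
    (Y : (Σ i, β i) → C) :
    tensorOver c ⊗ tensorOver Y ⟶ tensorOver fun i => c i ⊗ tensorOver fun b => Y ⟨i, b⟩ :=
  _ ◁ tensorOverSigma Y ≫ tensorOverZip _ _

theorem IsCanon.tensorOverDistrib {τ : Type} {Z : τ → C} {ι : Type} [Fintype ι] {β : ι → Type}
    [∀ i, Fintype (β i)] {c : ι → C} {Y : (Σ i, β i) → C} (p : ∀ i, Pres Z (c i))
    (q : ∀ x, Pres Z (Y x)) :
    IsCanon ((Pres.all p).tensor (Pres.all q))
      (Pres.all fun i => (p i).tensor (Pres.all fun b => q ⟨i, b⟩)) (tensorOverDistrib c Y) :=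
  (IsCanon.whiskerLeft _ (IsCanon.tensorOverSigma q)).comp (IsCanon.tensorOverZip _ _)

theorem tensorOverDistrib_natural {ι κ : Type} [Fintype ι] [Fintype κ] {β : ι → Type}
    {δ : κ → Type} [∀ i, Fintype (β i)] [∀ k, Fintype (δ k)] {c : ι → C} {c' : κ → C}
    {Y : (Σ i, β i) → C} {Y' : (Σ k, δ k) → C} (e : ι ≃ κ) (e' : ∀ i, β i ≃ δ (e i))
    (g : ∀ i, c i ⟶ c' (e i)) (f : ∀ x : Σ i, β i, Y x ⟶ Y' ⟨e x.1, e' x.1 x.2⟩) :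
    (tensorOverMap e g ⊗ₘ tensorOverMap (Equiv.sigmaCongr e e') f) ≫ tensorOverDistrib c' Y' =
      tensorOverDistrib c Y ≫
        tensorOverMap (Y := fun k => c' k ⊗ tensorOver fun d : δ k => Y' ⟨k, d⟩) e fun i =>
          g i ⊗ₘ tensorOverMap (Y := fun d => Y' ⟨e i, d⟩) (e' i) fun b => f ⟨i, b⟩ := by
  have h := tensorOverSigma_natural e e' f
  have h' := tensorOverZip_natural (V' := fun k => tensorOver fun d : δ k => Y' ⟨k, d⟩) e g
    fun i => tensorOverMap (Y := fun d => Y' ⟨e i, d⟩) (e' i) fun b => f ⟨i, b⟩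
  simp only [tensorOverDistrib]
  rw [Category.assoc, ← h', ← id_tensorHom, ← id_tensorHom, tensorHom_comp_tensorHom_assoc,
    tensorHom_comp_tensorHom_assoc, ← h, Category.id_comp, Category.comp_id]

theorem tensorOverDistrib_natural_pi {ι : Type} [Fintype ι] {β : ι → Type}
    [∀ i, Fintype (β i)] {c c' : ι → C} {Y Y' : (Σ i, β i) → C} (g : ∀ i, c i ⟶ c' i)
    (f : ∀ x, Y x ⟶ Y' x) :
    (tensorOverPi g ⊗ₘ tensorOverPi f) ≫ tensorOverDistrib c' Y' =
      tensorOverDistrib c Y ≫ tensorOverPi fun i => g i ⊗ₘ tensorOverPi fun b => f ⟨i, b⟩ := by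
  simp only [tensorOverDistrib]
  rw [Category.assoc, ← tensorOverZip_natural_pi, ← id_tensorHom, ← id_tensorHom,
    tensorHom_comp_tensorHom_assoc, tensorHom_comp_tensorHom_assoc, ← tensorOverSigma_natural_pi,
    Category.id_comp, Category.comp_id]

theorem tensorOverDistrib_natural_left {ι : Type} [Fintype ι] {β : ι → Type}
    [∀ i, Fintype (β i)] {c c' : ι → C} (Y : (Σ i, β i) → C) (g : ∀ i, c i ⟶ c' i) :
    tensorOverPi g ▷ tensorOver Y ≫ tensorOverDistrib c' Y =
      tensorOverDistrib c Y ≫ tensorOverPi fun i => g i ▷ tensorOver fun b => Y ⟨i, b⟩ := by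
  have h := tensorOverDistrib_natural_pi g fun x => 𝟙 (Y x)
  simpa only [tensorOverPi_id, tensorHom_id] using h

theorem tensorOverDistrib_natural_right {ι : Type} [Fintype ι] {β : ι → Type}
    [∀ i, Fintype (β i)] (c : ι → C) {Y Y' : (Σ i, β i) → C} (f : ∀ x, Y x ⟶ Y' x) :
    tensorOver c ◁ tensorOverPi f ≫ tensorOverDistrib c Y' =
      tensorOverDistrib c Y ≫ tensorOverPi fun i => c i ◁ tensorOverPi fun b => f ⟨i, b⟩ := by
  have h := tensorOverDistrib_natural_pi (fun i => 𝟙 (c i)) f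
  simpa only [tensorOverPi_id, id_tensorHom] using h

/-- The coherence behind coassociativity: distributing from the innermost level outwards agrees with
distributing from the outside inwards. Both composites are canonical, and the disjoint union of the
three index sets labels all factors differently. -/
theorem tensorOverDistrib_assoc {ι : Type} [Fintype ι] {β : ι → Type} [∀ i, Fintype (β i)]
    {δ : ∀ i, β i → Type} [∀ i b, Fintype (δ i b)] (c : ι → C) (c' : (Σ i, β i) → C)
    (Y : (Σ x : Σ i, β i, δ x.1 x.2) → C) :
    _ ◁ tensorOverMap (X := fun x : Σ i, Σ b : β i, δ i b => Y ⟨⟨x.1, x.2.1⟩, x.2.2⟩)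
          (Equiv.sigmaAssoc δ).symm (fun x => 𝟙 (Y ⟨⟨x.1, x.2.1⟩, x.2.2⟩)) ≫
        (α_ _ _ _).hom ≫
        tensorOver c ◁ tensorOverDistrib (β := fun x : Σ i, β i => δ x.1 x.2) c' Y ≫
        tensorOverDistrib c (fun x : Σ i, β i => c' x ⊗ tensorOver fun d => Y ⟨x, d⟩) =
      tensorOverDistrib c c' ▷ _ ≫
        tensorOverDistrib (fun i => c i ⊗ tensorOver fun b => c' ⟨i, b⟩)
          (fun x : Σ i, Σ b : β i, δ i b => Y ⟨⟨x.1, x.2.1⟩, x.2.2⟩) ≫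
        tensorOverPi fun i => (α_ _ _ _).hom ≫
          c i ◁ tensorOverDistrib (fun b => c' ⟨i, b⟩) fun x : Σ b : β i, δ i b =>
            Y ⟨⟨i, x.1⟩, x.2⟩ := by
  let Z : ι ⊕ (Σ i, β i) ⊕ (Σ x : Σ i, β i, δ x.1 x.2) → C := Sum.elim c (Sum.elim c' Y)
  let p : ∀ i, Pres Z (c i) := fun i => Pres.leaf Z (.inl i)
  let p' : ∀ x, Pres Z (c' x) := fun x => Pres.leaf Z (.inr (.inl x))
  let q : ∀ x, Pres Z (Y x) := fun x => Pres.leaf Z (.inr (.inr x))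
  let q' : ∀ x : Σ i, Σ b : β i, δ i b, Pres Z (Y ⟨⟨x.1, x.2.1⟩, x.2.2⟩) :=
    fun x => q ⟨⟨x.1, x.2.1⟩, x.2.2⟩
  refine IsCanon.unique (p := ((Pres.all p).tensor (Pres.all p')).tensor (Pres.all q'))
    (q := Pres.all fun i => (p i).tensor (Pres.all fun b =>
      (p' ⟨i, b⟩).tensor (Pres.all fun d => q ⟨⟨i, b⟩, d⟩))) ?_ ?_ ?_
  · refine Pres.nodup_tensor (Pres.nodup_tensor (Pres.nodup_all_leaf Sum.inl_injective)
      (Pres.nodup_all_leaf (Sum.inr_injective.comp Sum.inl_injective)) fun t ht ht' => ?_)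
      (Pres.nodup_all_leaf (Sum.inr_injective.comp (Sum.inr_injective.comp
        (Equiv.sigmaAssoc δ).symm.injective))) fun t ht ht' => ?_
    · obtain ⟨i, hi⟩ := Pres.mem_word_all.1 ht
      obtain ⟨i', hi'⟩ := Pres.mem_word_all.1 ht'
      cases (Pres.mem_word_leaf.1 hi).symm.trans (Pres.mem_word_leaf.1 hi')
    · obtain ⟨i', hi'⟩ := Pres.mem_word_all.1 ht'
      rcases Pres.mem_word_tensor.1 ht with ht | ht <;>
      · obtain ⟨i, hi⟩ := Pres.mem_word_all.1 ht
        cases (Pres.mem_word_leaf.1 hi).symm.trans (Pres.mem_word_leaf.1 hi')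
  · exact (IsCanon.whiskerLeft _ (IsCanon.tensorOverMap (q := q) (Equiv.sigmaAssoc δ).symm
      fun x => IsCanon.id (q' x))).comp <|
      (IsCanon.associator _ _ _).comp <| (IsCanon.whiskerLeft _
      (IsCanon.tensorOverDistrib (β := fun x : Σ i, β i => δ x.1 x.2) p' q)).comp
      (IsCanon.tensorOverDistrib p fun x => (p' x).tensor (Pres.all fun d => q ⟨x, d⟩))
  · exact ((IsCanon.tensorOverDistrib p p').whiskerRight _).comp <|
      (IsCanon.tensorOverDistrib (fun i => (p i).tensor (Pres.all fun b => p' ⟨i, b⟩)) q').comp <|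
      IsCanon.tensorOverMap (Equiv.refl ι) fun i => (IsCanon.associator _ _ _).comp <|
        IsCanon.whiskerLeft _ (IsCanon.tensorOverDistrib (fun b => p' ⟨i, b⟩)
          fun x : Σ b : β i, δ i b => q ⟨⟨i, x.1⟩, x.2⟩)

theorem tensorOverDistrib_point {β : Type} [Fintype β] (c : PUnit.{1} → C)
    (Y : (Σ _ : PUnit.{1}, β) → C) :
    tensorOver c ◁ tensorOverMap (X := fun b => Y ⟨PUnit.unit, b⟩)
        (Equiv.uniqueSigma fun _ : PUnit.{1} => β).symm (fun b => 𝟙 (Y ⟨PUnit.unit, b⟩)) ≫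
      tensorOverDistrib c Y ≫ tensorOverPUnit (fun i => c i ⊗ tensorOver fun b => Y ⟨i, b⟩) =
      tensorOverPUnit c ▷ _ := by
  let Z : PUnit.{1} ⊕ β → C := Sum.elim c fun b => Y ⟨PUnit.unit, b⟩
  let p : ∀ i, Pres Z (c i) := fun i => Pres.leaf Z (.inl i)
  -- `Y x` is definitionally `Y ⟨PUnit.unit, x.2⟩` by eta, so labels in `β` suffice.
  let q : ∀ x, Pres Z (Y x) := fun x => Pres.leaf Z (.inr x.2)
  refine IsCanon.unique (p := (Pres.all p).tensor (Pres.all fun b => q ⟨PUnit.unit, b⟩))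
    (q := (p PUnit.unit).tensor (Pres.all fun b => q ⟨PUnit.unit, b⟩)) ?_ ?_ ?_
  · refine Pres.nodup_tensor (Pres.nodup_all_leaf Sum.inl_injective)
      (Pres.nodup_all_leaf Sum.inr_injective) fun t ht ht' => ?_
    obtain ⟨i, hi⟩ := Pres.mem_word_all.1 ht
    obtain ⟨i', hi'⟩ := Pres.mem_word_all.1 ht'
    cases (Pres.mem_word_leaf.1 hi).symm.trans (Pres.mem_word_leaf.1 hi')
  · exact (IsCanon.whiskerLeft _ (IsCanon.tensorOverMap (q := q)
      (Equiv.uniqueSigma fun _ : PUnit.{1} => β).symm fun b => IsCanon.id _)).comp <|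
      (IsCanon.tensorOverDistrib p q).comp (IsCanon.tensorOverPUnit _)
  · exact (IsCanon.tensorOverPUnit p).whiskerRight _

/-- The units are presented by empty words, so the word of the source contains each label of `κ`
exactly once. -/
theorem tensorOverDistrib_points {κ : Type} [Fintype κ] (X : κ → C) :
    tensorOver (fun _ : κ => 𝟙_ C) ◁ tensorOverMap (Y := fun x : Σ _ : κ, PUnit.{1} => X x.1)
        (Equiv.sigmaPUnit κ).symm (fun k => 𝟙 (X k)) ≫
      tensorOverDistrib (fun _ : κ => 𝟙_ C) (fun x : Σ _ : κ, PUnit.{1} => X x.1) ≫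
        (tensorOverPi fun k => 𝟙_ C ◁ tensorOverPUnit (fun _ => X k) ≫ (λ_ (X k)).hom) =
      tensorOverUnits κ ▷ _ ≫ (λ_ _).hom := by
  let q : ∀ x : Σ _ : κ, PUnit.{1}, Pres X (X x.1) := fun x => Pres.leaf X x.1
  refine IsCanon.unique (p := (Pres.all fun _ => Pres.unit X).tensor (Pres.all (Pres.leaf X)))
    (q := Pres.all (Pres.leaf X)) ?_ ?_ ?_
  · refine Pres.nodup_tensor (Pres.nodup_all (fun _ => List.nodup_nil) fun _ _ t h => ?_)
      (Pres.nodup_all_leaf fun _ _ h => h) fun t ht => ?_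
    · cases h
    · obtain ⟨i, hi⟩ := Pres.mem_word_all.1 ht
      cases hi
  · exact (IsCanon.whiskerLeft _ (IsCanon.tensorOverMap (q := q) (Equiv.sigmaPUnit κ).symm
      fun b => IsCanon.id _)).comp <|
      (IsCanon.tensorOverDistrib _ q).comp <| IsCanon.tensorOverMap (Equiv.refl κ) fun k =>
        (IsCanon.whiskerLeft _ (IsCanon.tensorOverPUnit _)).comp (IsCanon.leftUnitor _)
  · exact (IsCanon.tensorOverUnits.whiskerRight _).comp (IsCanon.leftUnitor _)

theorem tensorOverPUnit_natural {X Y : PUnit.{1} → C} (f : ∀ k, X k ⟶ Y k) :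
    tensorOverPi f ≫ tensorOverPUnit Y = tensorOverPUnit X ≫ f PUnit.unit := by
  have h := permHom_natural f
    (enum_perm (l := [PUnit.unit]) (by simp) (by simp) : [PUnit.unit.{1}].Perm (enum _)).symm
  have h' : listTensorMap f [PUnit.unit] ≫ (ρ_ (Y PUnit.unit)).hom =
      (ρ_ (X PUnit.unit)).hom ≫ f PUnit.unit := by
    change (f PUnit.unit ⊗ₘ 𝟙 (𝟙_ C)) ≫ _ = _
    simp
  rw [tensorOverPi_eq]
  change listTensorMap f (enum PUnit) ≫ permHom Y _ ≫ _ = (permHom X _ ≫ _) ≫ _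
  rw [← reassoc_of% h, h', Category.assoc]

end Distrib
end CooperadComplex
end

noncomputable section

namespace CooperadComplex

universe v u

set_option linter.unusedSectionVars false

/-! ### Axioms for a cocomposition persist after tensoring with inner factors -/

section Expand

variable {C : Type u} [Category.{v} C] [MonoidalCategory C] [SymmetricCategory C]
  {ι : Type} [Fintype ι] {β : ι → Type} [∀ i, Fintype (β i)]

/-- Expanding the first factor of `P ⊗ ⨂ Y (i,b)` by `d : P ⟶ a ⊗ ⨂ cᵢ`, and distributing
the factors `Y (i,b)` over the factors `cᵢ`. -/
def expand {P a : C} {c : ι → C} (d : P ⟶ a ⊗ tensorOver c) (Y : (Σ i, β i) → C) :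
    P ⊗ tensorOver Y ⟶ a ⊗ tensorOver fun i => c i ⊗ tensorOver fun b => Y ⟨i, b⟩ :=
  d ▷ _ ≫ (α_ _ _ _).hom ≫ a ◁ tensorOverDistrib c Y

/-- Only the compatibility `h` of the two expansions is assumed; for a cocomposition it is the
naturality square of `Δ̃`. The factors `Y` are carried along by naturality of the distribution. -/
theorem expand_natural {κ : Type} [Fintype κ] {δ : κ → Type} [∀ k, Fintype (δ k)] {P P' a a' : C}
    {c : ι → C} {c' : κ → C} {d : P ⟶ a ⊗ tensorOver c} {d' : P' ⟶ a' ⊗ tensorOver c'}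
    {Y : (Σ i, β i) → C} {Y' : (Σ k, δ k) → C} {m : P ⟶ P'} {k : a ⟶ a'} (e : ι ≃ κ)
    (e' : ∀ i, β i ≃ δ (e i)) {g : ∀ i, c i ⟶ c' (e i)}
    (f : ∀ x : Σ i, β i, Y x ⟶ Y' ⟨e x.1, e' x.1 x.2⟩)
    (h : m ≫ d' = d ≫ (k ⊗ₘ tensorOverMap e g)) :
    (m ⊗ₘ tensorOverMap (Equiv.sigmaCongr e e') f) ≫ expand d' Y' =
      expand d Y ≫
        (k ⊗ₘ tensorOverMap (Y := fun k => c' k ⊗ tensorOver fun d : δ k => Y' ⟨k, d⟩) e fun i =>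
          g i ⊗ₘ tensorOverMap (Y := fun d => Y' ⟨e i, d⟩) (e' i) fun b => f ⟨i, b⟩) := by
  have hn := tensorOverDistrib_natural e e' g f
  simp only [expand, Category.assoc]
  rw [← id_tensorHom a, tensorHom_comp_tensorHom, Category.id_comp, ← hn,
    ← tensorHom_id, ← tensorHom_id, tensorHom_comp_tensorHom_assoc, h, Category.comp_id,
    ← Category.comp_id k, ← tensorHom_comp_tensorHom, ← associator_naturality_assoc,
    tensorHom_comp_tensorHom_assoc, Category.id_comp, id_tensorHom]
  simp

theorem expand_natural_pi {P a : C} {c : ι → C} (d : P ⟶ a ⊗ tensorOver c)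
    {Y Y' : (Σ i, β i) → C} (f : ∀ x, Y x ⟶ Y' x) :
    P ◁ tensorOverPi f ≫ expand d Y' =
      expand d Y ≫ a ◁ tensorOverPi fun i => c i ◁ tensorOverPi fun b => f ⟨i, b⟩ := by
  have hn := tensorOverDistrib_natural_right c f
  simp only [expand, Category.assoc]
  rw [← MonoidalCategory.whiskerLeft_comp, ← hn, whisker_exchange_assoc]
  simp

/-- The part of coassociativity that uses only the monoidal structure. Of the inputs, `h` is the
axiom without the inner factors, `ha` the coherence of iterated distribution, and `hn` the
naturality of distribution in its left argument. -/
theorem expand_expand_aux {P₀ P₁ P₂ a Tc Tc' TY TY' Te Q E F G G' : C} {m : P₀ ⟶ P₁} {R : TY' ⟶ TY}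
    {d₁ : P₁ ⟶ P₂ ⊗ Tc'} {d₂ : P₂ ⟶ a ⊗ Tc} {d₃ : P₀ ⟶ a ⊗ Te} {p₄ : Te ⟶ F}
    {D₁ : Tc' ⊗ TY ⟶ Q} {D₂ : Tc ⊗ Q ⟶ E} {D₁₂ : Tc ⊗ Tc' ⟶ F} {D₃ : F ⊗ TY' ⟶ G} {l : G ⟶ E}
    {De : Te ⊗ TY' ⟶ G'} {n₄ : G' ⟶ G}
    (h : m ≫ d₁ ≫ d₂ ▷ Tc' ≫ (α_ _ _ _).hom ≫ a ◁ D₁₂ = d₃ ≫ a ◁ p₄)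
    (ha : (Tc ⊗ Tc') ◁ R ≫ (α_ _ _ _).hom ≫ Tc ◁ D₁ ≫ D₂ = D₁₂ ▷ TY' ≫ D₃ ≫ l)
    (hn : p₄ ▷ TY' ≫ D₃ = De ≫ n₄) :
    (m ⊗ₘ R) ≫ (d₁ ▷ TY ≫ (α_ _ _ _).hom ≫ P₂ ◁ D₁) ≫ (d₂ ▷ Q ≫ (α_ _ _ _).hom ≫ a ◁ D₂) =
      (d₃ ▷ TY' ≫ (α_ _ _ _).hom ≫ a ◁ De) ≫ a ◁ (n₄ ≫ l) := by
  calc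
    _ = (m ≫ d₁ ≫ d₂ ▷ Tc' ≫ (α_ _ _ _).hom) ▷ TY' ≫ (α_ _ _ _).hom ≫
        a ◁ ((Tc ⊗ Tc') ◁ R ≫ (α_ _ _ _).hom ≫ Tc ◁ D₁ ≫ D₂) := by
      rw [MonoidalCategory.tensorHom_def]
      simp only [Category.assoc]
      rw [whisker_exchange_assoc, whisker_exchange_assoc, ← associator_naturality_left_assoc,
        whisker_exchange_assoc]
      simp
    _ = (m ≫ d₁ ≫ d₂ ▷ Tc' ≫ (α_ _ _ _).hom ≫ a ◁ D₁₂) ▷ TY' ≫ (α_ _ _ _).hom ≫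
        a ◁ (D₃ ≫ l) := by
      rw [ha]; simp
    _ = d₃ ▷ TY' ≫ (α_ _ _ _).hom ≫ a ◁ (p₄ ▷ TY' ≫ D₃) ≫ a ◁ l := by
      rw [h]; simp
    _ = _ := by rw [hn]; simp

theorem expand_expand {δ : ∀ i, β i → Type} [∀ i b, Fintype (δ i b)] {P₀ P₁ P₂ a : C}
    {c e : ι → C} {c' : (Σ i, β i) → C} {m : P₀ ⟶ P₁} {d₁ : P₁ ⟶ P₂ ⊗ tensorOver c'}
    {d₂ : P₂ ⟶ a ⊗ tensorOver c} {d₃ : P₀ ⟶ a ⊗ tensorOver e}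
    {d₄ : ∀ i, e i ⟶ c i ⊗ tensorOver fun b => c' ⟨i, b⟩}
    (h : m ≫ d₁ ≫ expand d₂ c' = d₃ ≫ a ◁ tensorOverPi d₄)
    (Y : (Σ x : Σ i, β i, δ x.1 x.2) → C) :
    (m ⊗ₘ tensorOverMap (X := fun x : Σ i, Σ b : β i, δ i b => Y ⟨⟨x.1, x.2.1⟩, x.2.2⟩)
          (Equiv.sigmaAssoc δ).symm (fun x => 𝟙 (Y ⟨⟨x.1, x.2.1⟩, x.2.2⟩))) ≫
        expand (β := fun x : Σ i, β i => δ x.1 x.2) d₁ Y ≫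
        expand d₂ (fun x : Σ i, β i => c' x ⊗ tensorOver fun d => Y ⟨x, d⟩) =
      expand d₃ (fun x : Σ i, Σ b : β i, δ i b => Y ⟨⟨x.1, x.2.1⟩, x.2.2⟩) ≫
        a ◁ tensorOverPi fun i =>
          expand (d₄ i) fun x : Σ b : β i, δ i b => Y ⟨⟨i, x.1⟩, x.2⟩ := by
  have ha := tensorOverDistrib_assoc (δ := δ) c c' Y
  have hn := tensorOverDistrib_natural_left (β := fun i => Σ b : β i, δ i b)
    (fun x : Σ i, Σ b : β i, δ i b => Y ⟨⟨x.1, x.2.1⟩, x.2.2⟩) d₄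
  exact (expand_expand_aux h ha hn).trans
    (congrArg (_ ≫ a ◁ ·) (tensorOverPi_comp _ _).symm)

/-- The passage from the left counit axiom `h` to the same axiom with inner factors `Y`. Over a
one-point set distribution is trivial, so `Y` is merely whiskered. -/
theorem expand_point {β : Type} [Fintype β] {P a : C} {c : PUnit.{1} → C}
    {m : c PUnit.unit ⟶ P} {d : P ⟶ a ⊗ tensorOver c} {ε : a ⟶ 𝟙_ C}
    (h : m ≫ d ≫ (ε ⊗ₘ tensorOverPUnit c) ≫ (λ_ _).hom = 𝟙 _) (Y : (Σ _ : PUnit.{1}, β) → C) :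
    (m ⊗ₘ tensorOverMap (X := fun b => Y ⟨PUnit.unit, b⟩)
        (Equiv.uniqueSigma fun _ : PUnit.{1} => β).symm (fun b => 𝟙 (Y ⟨PUnit.unit, b⟩))) ≫
      expand d Y ≫ (ε ⊗ₘ tensorOverPUnit fun i => c i ⊗ tensorOver fun b => Y ⟨i, b⟩) ≫
        (λ_ _).hom = 𝟙 _ := by
  have hp := tensorOverDistrib_point c Y
  set R := tensorOverMap (X := fun b => Y ⟨PUnit.unit, b⟩)
    (Equiv.uniqueSigma fun _ : PUnit.{1} => β).symm (fun b => 𝟙 (Y ⟨PUnit.unit, b⟩))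
  set q := tensorOverPUnit fun i => c i ⊗ tensorOver fun b => Y ⟨i, b⟩
  calc
    _ = (m ≫ d) ▷ _ ≫ (α_ _ _ _).hom ≫
        (ε ⊗ₘ (tensorOver c ◁ R ≫ tensorOverDistrib c Y ≫ q)) ≫ (λ_ _).hom := by
      rw [MonoidalCategory.tensorHom_def m, MonoidalCategory.tensorHom_def' ε,
        MonoidalCategory.tensorHom_def' ε]
      simp only [expand, Category.assoc]
      rw [whisker_exchange_assoc]
      simp
    _ = (m ≫ d ≫ (ε ⊗ₘ tensorOverPUnit c) ≫ (λ_ _).hom) ▷ _ := by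
      rw [hp, MonoidalCategory.tensorHom_def, MonoidalCategory.tensorHom_def]
      simp
    _ = _ := by rw [h]; simp

/-- The passage from the right counit axiom `h` to the same axiom with inner factors `X`. The
counits are moved across the distribution by naturality; what is left distributes the factors over
units, which is coherence. -/
theorem expand_points {P P' a : C} {m : P ⟶ P'} {d : P' ⟶ P ⊗ tensorOver fun _ : ι => a}
    {ε : a ⟶ 𝟙_ C}
    (h : m ≫ d ≫ P ◁ (tensorOverPi fun _ => ε) ≫ P ◁ tensorOverUnits ι ≫ (ρ_ P).hom = 𝟙 P)
    (X : ι → C) :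
    (m ⊗ₘ tensorOverMap (Y := fun x : Σ _ : ι, PUnit.{1} => X x.1)
        (Equiv.sigmaPUnit ι).symm (fun k => 𝟙 (X k))) ≫
      expand d (fun x : Σ _ : ι, PUnit.{1} => X x.1) ≫
        (P ◁ tensorOverPi fun k => (ε ⊗ₘ tensorOverPUnit fun _ => X k) ≫ (λ_ _).hom) = 𝟙 _ := by
  have hp := tensorOverDistrib_points X
  have hn := tensorOverDistrib_natural_left (fun x : Σ _ : ι, PUnit.{1} => X x.1) fun _ => ε
  set R := tensorOverMap (Y := fun x : Σ _ : ι, PUnit.{1} => X x.1)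
    (Equiv.sigmaPUnit ι).symm (fun k => 𝟙 (X k))
  have hq : (tensorOverPi fun k => (ε ⊗ₘ tensorOverPUnit fun _ => X k) ≫ (λ_ (X k)).hom) =
      (tensorOverPi fun k => ε ▷ tensorOver fun _ : PUnit.{1} => X k) ≫
        tensorOverPi fun k => 𝟙_ C ◁ tensorOverPUnit (fun _ => X k) ≫ (λ_ (X k)).hom := by
    rw [← tensorOverPi_comp]
    simp only [MonoidalCategory.tensorHom_def, Category.assoc]
  rw [hq]
  set q := tensorOverPi fun k => 𝟙_ C ◁ tensorOverPUnit (fun _ => X k) ≫ (λ_ (X k)).hom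
  calc
    _ = (m ≫ d) ▷ _ ≫ (α_ _ _ _).hom ≫ P ◁ (_ ◁ R ≫ (tensorOverDistrib _ _ ≫
        tensorOverPi fun k => ε ▷ tensorOver fun _ : PUnit.{1} => X k) ≫ q) := by
      rw [MonoidalCategory.tensorHom_def m]
      simp only [expand, Category.assoc]
      rw [whisker_exchange_assoc]
      simp
    _ = (m ≫ d ≫ P ◁ (tensorOverPi fun _ => ε)) ▷ _ ≫ (α_ _ _ _).hom ≫
        P ◁ (_ ◁ R ≫ tensorOverDistrib _ _ ≫ q) := by
      rw [← hn]
      simp [whisker_exchange_assoc]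
    _ = (m ≫ d ≫ P ◁ (tensorOverPi fun _ => ε) ≫ P ◁ tensorOverUnits ι ≫ (ρ_ P).hom) ▷ _ := by
      rw [hp]
      simp
    _ = _ := by rw [h]; simp

theorem tensorOverPi_point_comp {a b b' : C} (ε : a ⟶ 𝟙_ C) (f : b ⟶ b') :
    a ◁ (tensorOverPi fun _ : PUnit.{1} => f) ≫ (ε ⊗ₘ tensorOverPUnit fun _ => b') ≫
        (λ_ b').hom =
      ((ε ⊗ₘ tensorOverPUnit fun _ => b) ≫ (λ_ b).hom) ≫ f := by
  have h := tensorOverPUnit_natural fun _ => f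
  rw [← id_tensorHom, tensorHom_comp_tensorHom_assoc, h, Category.id_comp, Category.assoc,
    ← leftUnitor_naturality, ← id_tensorHom, tensorHom_comp_tensorHom_assoc, Category.comp_id]

end Expand
end CooperadComplex
end

noncomputable section

namespace CooperadComplex

universe v u v₁ u₁

set_option linter.unusedSectionVars false

/-! ### Cocomposition and counit at the outermost level -/

section Bottom

variable {C : Type u} [Category.{v} C] [MonoidalCategory C] [SymmetricCategory C]
  {𝒜 : Type u₁} [Category.{v₁} 𝒜]

/-- A morphism of families of families induces a morphism of shapes. -/
def Wreath.shapeMap {W W' : Wreath (Wreath 𝒜)} (f : W ⟶ W') : W.shape ⟶ W'.shape :=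
  ⟨f.base, fun s => (f.app s).base⟩

/-- `cocompBottom` unfolds to `expand` of the component of `Δ` at the shape of the family, so only
the naturality of `Δ` at the induced morphism of shapes is needed. -/
theorem cocompBottom_natural {A : SymSeq C} (Δ : coprod ⋙ A ⟶ odot A A) (B : 𝒜 ⥤ C)
    {W W' : Wreath (Wreath 𝒜)} (f : W ⟶ W') :
    (odot A B).map (merge.map f) ≫ cocompBottom Δ B W' =
      cocompBottom Δ B W ≫ (odot A (odot A B)).map f :=
  expand_natural (d := Δ.app W.shape) (d' := Δ.app W'.shape)
    (Y' := fun p : Σ s, (W'.fam s).index.carrier => B.obj ((W'.fam p.1).fam p.2))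
    (c' := fun s => A.obj (W'.fam s).index)
    f.base.equiv (fun s => (f.app s).base.equiv)
    (fun p => B.map ((f.app p.1).app p.2)) (Δ.naturality (Wreath.shapeMap f))

theorem odotWhisker_comp (A : SymSeq C) {S : FinBij} {b b' b'' : S.carrier → C}
    (f : ∀ s, b s ⟶ b' s) (g : ∀ s, b' s ⟶ b'' s) :
    (odotWhisker A fun s => f s ≫ g s) = odotWhisker A f ≫ odotWhisker A g :=
  (congrArg (A.obj S ◁ ·) (tensorOverPi_comp f g)).trans
    (MonoidalCategory.whiskerLeft_comp _ _ _)

theorem odotWhisker_id (A : SymSeq C) {S : FinBij} (b : S.carrier → C) :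
    (odotWhisker A fun s => 𝟙 (b s)) = 𝟙 _ :=
  (congrArg (A.obj S ◁ ·) (tensorOverPi_id b)).trans (MonoidalCategory.whiskerLeft_id _ _)

/-- The morphism of families over the identity of the index set. -/
def Wreath.homOfFamily {S : FinBij} {W W' : S.carrier → 𝒜} (f : ∀ s, W s ⟶ W' s) :
    (⟨S, W⟩ : Wreath 𝒜) ⟶ ⟨S, W'⟩ :=
  ⟨𝟙 S, f⟩

theorem odot_map_homOfFamily (A : SymSeq C) (B : 𝒜 ⥤ C) {S : FinBij} {W W' : S.carrier → 𝒜}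
    (f : ∀ s, W s ⟶ W' s) :
    (odot A B).map (Wreath.homOfFamily f) = odotWhisker A fun s => B.map (f s) := by
  change A.map (𝟙 S) ⊗ₘ _ = _
  rw [A.map_id, id_tensorHom]
  rfl

/-- `cocompBottom` is natural with respect to arbitrary factorwise morphisms. -/
theorem odotWhisker_comp_cocompBottom {A : SymSeq C} (Δ : coprod ⋙ A ⟶ odot A A)
    {ℬ : Type*} [Category* ℬ] (B : 𝒜 ⥤ C) (B' : ℬ ⥤ C) (W : Wreath (Wreath ℬ)) (P : ℬ → 𝒜)
    (f : ∀ b, B.obj (P b) ⟶ B'.obj b) :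
    (odotWhisker A (S := coprod.obj W.shape) fun p : Σ s, (W.fam s).index.carrier =>
        f ((W.fam p.1).fam p.2)) ≫ cocompBottom Δ B' W =
      cocompBottom Δ B ⟨W.index, fun s => ⟨(W.fam s).index, fun t => P ((W.fam s).fam t)⟩⟩ ≫
        odotWhisker A (S := W.index) fun s => odotWhisker A fun t => f ((W.fam s).fam t) :=
  expand_natural_pi (β := fun s => (W.fam s).index.carrier) (Δ.app W.shape)
    fun p => f ((W.fam p.1).fam p.2)

/-- The canonical reassociation of triply nested families. -/
def mergeAssoc (W : Wreath (Wreath (Wreath 𝒜))) :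
    merge.obj ((Wreath.map merge).obj W) ⟶ merge.obj (merge.obj W) :=
  ⟨⟨(Equiv.sigmaAssoc fun (s : W.index.carrier) (t : (W.fam s).index.carrier) =>
    ((W.fam s).fam t).index.carrier).symm⟩, fun _ => 𝟙 _⟩

/-- The shape of triply nested families, as doubly nested families of sets. -/
def Wreath.doubleShape (W : Wreath (Wreath (Wreath 𝒜))) : Wreath (Wreath FinBij) :=
  ⟨W.index, fun s => (W.fam s).shape⟩

/-- The factors `A` depend only on the index sets. The axiom is thus evaluated on the family of
shapes, and `expand_expand` adds the values of `B` on the innermost objects. -/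
theorem cocompBottom_coassoc {A : SymSeq C} {Δ : coprod ⋙ A ⟶ odot A A}
    (h : IsCoassociative Δ Δ) (B : 𝒜 ⥤ C) (W : Wreath (Wreath (Wreath 𝒜))) :
    (odot A B).map (mergeAssoc W) ≫ cocompBottom Δ B (merge.obj W) ≫
        cocompBottom Δ (odot A B) W =
      cocompBottom Δ B ((Wreath.map merge).obj W) ≫
        odotWhisker A (S := W.index) fun s => cocompBottom Δ B (W.fam s) := by
  have hW := expand_expand (ι := W.index.carrier) (β := fun s => (W.fam s).index.carrier)
    (δ := fun s t => ((W.fam s).fam t).index.carrier) (m := A.map (coprodAssoc W.doubleShape))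
    (d₁ := Δ.app (merge.obj W.doubleShape)) (d₂ := Δ.app W.doubleShape.shape)
    (d₃ := Δ.app ((Wreath.map coprod).obj W.doubleShape))
    (d₄ := fun s => Δ.app (W.doubleShape.fam s)) (h W.doubleShape)
    (fun x : Σ p : Σ s, (W.fam s).index.carrier, ((W.fam p.1).fam p.2).index.carrier =>
      B.obj (((W.fam x.1.1).fam x.1.2).fam x.2))
  refine Eq.trans (congrArg (· ≫ _) ?_) hW
  -- The canonical morphism of families is the identity on members; functoriality of `B` turns its
  -- values into the literal identities of `expand_expand`.
  exact congrArg (A.map (mergeAssoc W).base ⊗ₘ ·) (congrArg (tensorOverMap _)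
    (funext fun x => B.map_id _))

/-- The canonical isomorphism of a family with the merged one-element family of it. -/
def mergeSingle (W : Wreath 𝒜) : W ⟶ merge.obj (singleFam.obj W) :=
  ⟨sigmaPoint W.index, fun s => 𝟙 (W.fam s)⟩

/-- The canonical isomorphism of a family with the merged family of its one-element families. -/
def mergeSingles (W : Wreath 𝒜) : W ⟶ merge.obj ((Wreath.map singleFam).obj W) :=
  ⟨sigmaPoints W.index, fun s => 𝟙 (W.fam s)⟩

variable [HasLimitsOfSize.{0, 0} C]

/-- `counitBottom` is natural with respect to arbitrary morphisms. -/
theorem odotWhisker_comp_counitBottom {A : SymSeq C} (ε : A ⟶ counitSeq C) {ℬ : Type*}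
    [Category* ℬ] (B : 𝒜 ⥤ C) (B' : ℬ ⥤ C) {a : 𝒜} {b : ℬ} (f : B.obj a ⟶ B'.obj b) :
    (odotWhisker A (S := FinBij.point) fun _ => f) ≫ counitBottom ε B' b =
      counitBottom ε B a ≫ f :=
  tensorOverPi_point_comp (ε.app FinBij.point ≫ counitSeqPoint) f

theorem cocompBottom_left_counit {A : SymSeq C} {Δ : coprod ⋙ A ⟶ odot A A}
    {ε : A ⟶ counitSeq C} (h : IsLeftCounital ε Δ) (B : 𝒜 ⥤ C) (W : Wreath 𝒜) :
    (odot A B).map (mergeSingle W) ≫ cocompBottom Δ B (singleFam.obj W) ≫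
      counitBottom ε (odot A B) W = 𝟙 _ := by
  have hW := expand_point (β := W.index.carrier) (c := fun _ => A.obj W.index)
    (m := A.map (sigmaPoint W.index)) (d := Δ.app (singleFam.obj W.index))
    (ε := ε.app FinBij.point ≫ counitSeqPoint) (h W.index) (fun x => B.obj (W.fam x.2))
  refine Eq.trans (congrArg (· ≫ _) ?_) hW
  exact congrArg (A.map (sigmaPoint W.index) ⊗ₘ ·) (congrArg (tensorOverMap _)
    (funext fun x => B.map_id _))

theorem cocompBottom_right_counit {A : SymSeq C} {Δ : coprod ⋙ A ⟶ odot A A}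
    {ε : A ⟶ counitSeq C} (h : IsRightCounital ε Δ) (B : 𝒜 ⥤ C) (W : Wreath 𝒜) :
    (odot A B).map (mergeSingles W) ≫ cocompBottom Δ B ((Wreath.map singleFam).obj W) ≫
      (odotWhisker A (S := W.index) fun s => counitBottom ε B (W.fam s)) = 𝟙 _ := by
  have hW := expand_points (ι := W.index.carrier) (a := A.obj FinBij.point)
    (m := A.map (sigmaPoints W.index)) (d := Δ.app ⟨W.index, fun _ => FinBij.point⟩)
    (ε := ε.app FinBij.point ≫ counitSeqPoint) (h W.index) (fun s => B.obj (W.fam s))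
  refine Eq.trans (congrArg (· ≫ _) ?_) hW
  exact congrArg (A.map (sigmaPoints W.index) ⊗ₘ ·) (congrArg (tensorOverMap _)
    (funext fun x => B.map_id _))

end Bottom
end CooperadComplex
end

noncomputable section

namespace CooperadComplex

universe v u

set_option linter.unusedSectionVars false

/-! ### Level maps and the universal property of the Kan extension -/

section LevelMaps

variable {C : Type u} [Category.{v} C] [MonoidalCategory C] [SymmetricCategory C]
  [HasLimitsOfSize.{0, 0} C] {O : Cooperad C} (M : LeftComodule O)

/-- The data at the level of wreath categories that induces a morphism
`O^{∘̂ n} ∘̂ M ⟶ O^{∘̂ m} ∘̂ M`. -/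
structure LevelMap (n m : ℕ) where
  obj : Level m → Level n
  bij : ∀ W, (gamma m).obj W ⟶ (gamma n).obj (obj W)
  app : ∀ W, (M.iter n).obj (obj W) ⟶ (M.iter m).obj W

namespace LevelMap

variable {M} {n m k : ℕ}

/-- `d` is the morphism on right Kan extensions induced by `S`. -/
def Induces (S : LevelMap M n m) (d : M.compProd n ⟶ M.compProd m) : Prop :=
  ∀ W, d.app ((gamma m).obj W) ≫ (M.iota m).app W =
    (M.compProd n).map (S.bij W) ≫ (M.iota n).app (S.obj W) ≫ S.app W

variable (M n) in
protected def id : LevelMap M n n := ⟨fun W => W, fun _ => 𝟙 _, fun _ => 𝟙 _⟩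

/-- The object parts compose contravariantly, as restriction along them does. -/
def comp (S : LevelMap M n m) (T : LevelMap M m k) : LevelMap M n k where
  obj W := S.obj (T.obj W)
  bij W := T.bij W ≫ S.bij (T.obj W)
  app W := S.app (T.obj W) ≫ T.app W

/-- The application of a level map to all members of a family. -/
def succ (S : LevelMap M n m) : LevelMap M (n + 1) (m + 1) where
  obj W := ⟨W.index, fun s => S.obj (W.fam s)⟩
  bij W := ⟨Equiv.sigmaCongrRight fun s => (S.bij (W.fam s)).equiv⟩
  app W := odotWhisker O.seq (S := W.index) fun s => S.app (W.fam s)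

/-- Two level maps that agree up to an isomorphism of their object parts. -/
def Equivalent (S T : LevelMap M n m) : Prop :=
  ∀ W, ∃ θ : S.obj W ⟶ T.obj W, S.bij W ≫ (gamma n).map θ = T.bij W ∧
    S.app W = (M.iter n).map θ ≫ T.app W

theorem succ_comp (S : LevelMap M n m) (T : LevelMap M m k) :
    (S.comp T).succ = S.succ.comp T.succ := by
  have h : (S.comp T).succ.app = (S.succ.comp T.succ).app :=
    funext fun W => odotWhisker_comp O.seq _ _
  -- The object parts and the bijections agree by definition, so equality of the components
  -- suffices. The other strict equalities of level maps rest on the same observation.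
  exact congrArg (LevelMap.mk (S.comp T).succ.obj (S.comp T).succ.bij) h

theorem succ_id : (LevelMap.id M n).succ = LevelMap.id M (n + 1) := by
  have h : (LevelMap.id M n).succ.app = (LevelMap.id M (n + 1)).app :=
    funext fun W => odotWhisker_id O.seq _
  exact congrArg (LevelMap.mk (LevelMap.id M n).succ.obj (LevelMap.id M n).succ.bij) h

theorem Equivalent.succ {S T : LevelMap M n m} (h : S.Equivalent T) :
    S.succ.Equivalent T.succ := by
  intro W
  choose θ h₁ h₂ using h
  refine ⟨Wreath.homOfFamily fun s => θ (W.fam s), ?_, ?_⟩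
  · refine FinBij.Hom.ext (Equiv.ext fun x => ?_)
    have := congrArg (fun g => g.equiv x.2) (h₁ (W.fam x.1))
    exact congrArg (Sigma.mk x.1) this
  · have e : (M.iter (n + 1)).map (Wreath.homOfFamily fun s => θ (W.fam s)) =
        odotWhisker O.seq fun s => (M.iter n).map (θ (W.fam s)) :=
      odot_map_homOfFamily O.seq (M.iter n) _
    refine Eq.trans ?_ (congrArg (· ≫ T.succ.app W) e.symm)
    refine Eq.trans ?_ (odotWhisker_comp O.seq _ _)
    exact congrArg (odotWhisker O.seq) (funext fun s => h₂ (W.fam s))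

/-- The comparison `θ` slides through `ι` by naturality and is absorbed into the bijection of
leaves. This makes the canonical identifications between composites of face and degeneracy functors
harmless. -/
theorem Induces.of_equivalent {S T : LevelMap M n m} (h : S.Equivalent T)
    {d : M.compProd n ⟶ M.compProd m} (hd : T.Induces d) : S.Induces d := by
  intro W
  obtain ⟨θ, h₁, h₂⟩ := h W
  have := (M.iota n).naturality θ
  dsimp at this
  rw [hd W, h₂, ← h₁, Functor.map_comp, Category.assoc, reassoc_of% this]

/-- The bijection of `T` is moved past `d`, which is natural on finite sets; the defining equation
of `d` then applies at `T.obj W`. -/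
theorem Induces.comp {S : LevelMap M n m} {T : LevelMap M m k}
    {d : M.compProd n ⟶ M.compProd m} {d' : M.compProd m ⟶ M.compProd k}
    (hS : S.Induces d) (hT : T.Induces d') : (S.comp T).Induces (d ≫ d') := by
  intro W
  have h := d.naturality (T.bij W)
  simp only [LevelMap.comp, NatTrans.comp_app, Category.assoc, Functor.map_comp]
  rw [hT W, ← reassoc_of% h, reassoc_of% (hS (T.obj W))]

theorem induces_id : (LevelMap.id M n).Induces (𝟙 _) := by
  intro W
  simp [LevelMap.id]

end LevelMap

theorem kan_hom_ext (n : ℕ) (F : Level n ⥤ C) {A : SymSeq C} {d d' : A ⟶ kan n F}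
    (h : ∀ W, d.app ((gamma n).obj W) ≫ (kanCounit n F).app W =
      d'.app ((gamma n).obj W) ≫ (kanCounit n F).app W) : d = d' :=
  (gamma n).hom_ext_of_isRightKanExtension (F' := (gamma n).rightKanExtension F)
    ((gamma n).rightKanExtensionCounit F) d d' (NatTrans.ext (funext h))

theorem kan_exists_lift (n : ℕ) (F : Level n ⥤ C) {A : SymSeq C} (τ : gamma n ⋙ A ⟶ F) :
    ∃ d : A ⟶ kan n F, ∀ W,
      d.app ((gamma n).obj W) ≫ (kanCounit n F).app W = τ.app W :=
  ⟨((gamma n).rightKanExtension F).liftOfIsRightKanExtension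
    ((gamma n).rightKanExtensionCounit F) A τ,
    ((gamma n).rightKanExtension F).liftOfIsRightKanExtension_fac_app _ A τ⟩

namespace LeftComodule

/-- For `n = 0` the target is `M` itself rather than a chosen Kan extension, and `ι` is the
identity. -/
theorem hom_ext (n : ℕ) {A : SymSeq C} {d d' : A ⟶ M.compProd n}
    (h : ∀ W, d.app ((gamma n).obj W) ≫ (M.iota n).app W =
      d'.app ((gamma n).obj W) ≫ (M.iota n).app W) : d = d' := by
  cases n with
  | zero =>
    exact NatTrans.ext (funext fun W =>
      (Category.comp_id _).symm.trans ((h W).trans (Category.comp_id _)))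
  | succ n => exact kan_hom_ext (n + 1) (M.iter (n + 1)) h

theorem exists_lift (n : ℕ) {A : SymSeq C} (τ : gamma n ⋙ A ⟶ M.iter n) :
    ∃ d : A ⟶ M.compProd n, ∀ W,
      d.app ((gamma n).obj W) ≫ (M.iota n).app W = τ.app W := by
  cases n with
  | zero =>
    exact ⟨(Functor.leftUnitor A).inv ≫ τ, fun W =>
      (Category.comp_id _).trans (Category.id_comp (τ.app W))⟩
  | succ n => exact kan_exists_lift (n + 1) (M.iter (n + 1)) τ

end LeftComodule

end LevelMaps
end CooperadComplex
end

noncomputable section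

namespace CooperadComplex

universe v u v₁ u₁ v₂ u₂

set_option linter.unusedSectionVars false

/-! ### Naturality at each level; existence and uniqueness of the structure maps -/

section Naturality

theorem gammaFace_natural : ∀ (n : ℕ) (i : Fin (n + 1)) {W W' : Level (n + 1)} (f : W ⟶ W'),
    (gamma (n + 1)).map f ≫ gammaFace n i W' =
      gammaFace n i W ≫ (gamma n).map ((face n i).map f)
  | 0 => fun _ W W' f => rfl
  | n + 1 => by
    refine Fin.cases ?_ ?_
    · intro W W' f
      exact FinBij.Hom.ext (Equiv.ext fun x => rfl)
    · intro i W W' f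
      refine FinBij.Hom.ext (Equiv.ext fun x => ?_)
      have h := congrArg (fun g => g.equiv x.2) (gammaFace_natural n i (f.app x.1))
      exact congrArg (Sigma.mk (f.base.equiv x.1)) h

theorem sigmaPoint_natural {S T : FinBij} (f : S ⟶ T) :
    f ≫ sigmaPoint T = sigmaPoint S ≫ (singleFam ⋙ coprod).map f :=
  FinBij.Hom.ext (Equiv.ext fun _ => rfl)

theorem gammaDegen_natural : ∀ (n : ℕ) (j : Fin (n + 1)) {W W' : Level n} (f : W ⟶ W'),
    (gamma n).map f ≫ gammaDegen n j W' =
      gammaDegen n j W ≫ (gamma (n + 1)).map ((degen n j).map f)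
  | 0 => fun _ W W' f => sigmaPoint_natural f
  | n + 1 => by
    refine Fin.cases ?_ ?_
    · intro W W' f
      exact sigmaPoint_natural ((gamma (n + 1)).map f)
    · intro j W W' f
      refine FinBij.Hom.ext (Equiv.ext fun x => ?_)
      have h := congrArg (fun g => g.equiv x.2) (gammaDegen_natural n j (f.app x.1))
      exact congrArg (Sigma.mk (f.base.equiv x.1)) h

variable {C : Type u} [Category.{v} C] [MonoidalCategory C] [SymmetricCategory C]

/-- The inductive step for the naturality of `Δ̃ᵢ` and `ε̃ⱼ`: an operation inside the members of a
family is natural once it is so on each member. -/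
theorem odotWhisker_natural {𝒜 : Type u₁} [Category.{v₁} 𝒜] {ℬ : Type u₂} [Category.{v₂} ℬ]
    (A : SymSeq C) {B : 𝒜 ⥤ C} {B' : ℬ ⥤ C} {P : ℬ ⥤ 𝒜} {φ : ∀ b, B.obj (P.obj b) ⟶ B'.obj b}
    (hφ : ∀ {b b' : ℬ} (f : b ⟶ b'), B.map (P.map f) ≫ φ b' = φ b ≫ B'.map f)
    {W W' : Wreath ℬ} (f : W ⟶ W') :
    (odot A B).map ((Wreath.map P).map f) ≫
        (odotWhisker A (S := W'.index) fun s => φ (W'.fam s)) =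
      (odotWhisker A (S := W.index) fun s => φ (W.fam s)) ≫ (odot A B').map f := by
  have h₁ := tensorOverMap_comp (Z := fun s => B'.obj (W'.fam s)) f.base.equiv
    (Equiv.refl W'.index.carrier) (fun s => B.map (P.map (f.app s))) fun s => φ (W'.fam s)
  have h₂ := tensorOverMap_comp (Z := fun s => B'.obj (W'.fam s)) (Equiv.refl W.index.carrier)
    f.base.equiv (fun s => φ (W.fam s)) fun s => B'.map (f.app s)
  have h₃ : (fun s => B.map (P.map (f.app s)) ≫ φ (W'.fam (f.base.equiv s))) =
    fun s => φ (W.fam s) ≫ B'.map (f.app s) := funext fun s => hφ (f.app s)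
  have h₄ := h₁.symm.trans ((congrArg (tensorOverMap f.base.equiv) h₃).trans h₂)
  have aux : ∀ {P P' T₁ T₂ T₃ T₄ : C} (a : P ⟶ P') (x : T₁ ⟶ T₂) (y : T₂ ⟶ T₄) (x' : T₁ ⟶ T₃)
      (y' : T₃ ⟶ T₄), x ≫ y = x' ≫ y' → (a ⊗ₘ x) ≫ P' ◁ y = P ◁ x' ≫ (a ⊗ₘ y') := by
    intro _ _ _ _ _ _ a x y x' y' h
    rw [← id_tensorHom, ← id_tensorHom, tensorHom_comp_tensorHom, tensorHom_comp_tensorHom, h]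
    simp
  exact aux _ _ _ _ _ h₄

variable [HasLimitsOfSize.{0, 0} C]

theorem counitBottom_natural {𝒜 : Type u₁} [Category.{v₁} 𝒜] {A : SymSeq C} (ε : A ⟶ counitSeq C)
    (B : 𝒜 ⥤ C) {a a' : 𝒜} (f : a ⟶ a') :
    (odot A B).map (singleFam.map f) ≫ counitBottom ε B a' = counitBottom ε B a ≫ B.map f :=
  (congrArg (· ≫ _) (odot_map_homOfFamily A B (S := FinBij.point) fun _ => f)).trans
    (odotWhisker_comp_counitBottom ε B B (B.map f))

variable {O : Cooperad C} (M : LeftComodule O)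

namespace LeftComodule

theorem cofaceApp_natural : ∀ (n : ℕ) (i : Fin (n + 1)) {W W' : Level (n + 1)} (f : W ⟶ W'),
    (M.iter n).map ((face n i).map f) ≫ M.cofaceApp n i W' =
      M.cofaceApp n i W ≫ (M.iter (n + 1)).map f
  | 0 => fun _ W W' f => M.coact.naturality f
  | n + 1 => by
    refine Fin.cases ?_ ?_
    · intro W W' f
      exact cocompBottom_natural O.cocomp (M.iter n) f
    · intro i W W' f
      exact odotWhisker_natural O.seq (fun g => cofaceApp_natural n i g) f

theorem codegenApp_natural : ∀ (n : ℕ) (j : Fin (n + 1)) {W W' : Level n} (f : W ⟶ W'),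
    (M.iter (n + 1)).map ((degen n j).map f) ≫ M.codegenApp n j W' =
      M.codegenApp n j W ≫ (M.iter n).map f
  | 0 => fun _ W W' f => counitBottom_natural O.counit (M.iter 0) f
  | n + 1 => by
    refine Fin.cases ?_ ?_
    · intro W W' f
      exact counitBottom_natural O.counit (M.iter (n + 1)) f
    · intro i W W' f
      exact odotWhisker_natural O.seq (fun g => codegenApp_natural n i g) f

/-- The right-hand side of `Induces` is a natural transformation out of the restriction of `X^n`
along `γ`, by `hg`, naturality of `ι` and `hφ`. The induced map is its unique lift. -/
theorem existsUnique_induces {n m : ℕ} (P : Level m ⥤ Level n)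
    (g : ∀ W, (gamma m).obj W ⟶ (gamma n).obj (P.obj W))
    (φ : ∀ W, (M.iter n).obj (P.obj W) ⟶ (M.iter m).obj W)
    (hg : ∀ {W W'} (f : W ⟶ W'), (gamma m).map f ≫ g W' = g W ≫ (gamma n).map (P.map f))
    (hφ : ∀ {W W'} (f : W ⟶ W'), (M.iter n).map (P.map f) ≫ φ W' = φ W ≫ (M.iter m).map f) :
    ∃! d, (LevelMap.mk P.obj g φ).Induces d := by
  obtain ⟨d, hd⟩ := M.exists_lift m (A := M.compProd n)
    { app W := (M.compProd n).map (g W) ≫ (M.iota n).app (P.obj W) ≫ φ W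
      naturality W W' f := by
        have := (M.iota n).naturality (P.map f)
        dsimp at this ⊢
        rw [← Functor.map_comp_assoc, hg, Functor.map_comp_assoc, reassoc_of% this, hφ]
        simp }
  refine ⟨d, hd, fun d' hd' => M.hom_ext m fun W => ?_⟩
  exact (hd' W).trans (hd W).symm

theorem existsUnique_isCoface (n : ℕ) (i : Fin (n + 1)) : ∃! d, M.IsCoface n i d :=
  M.existsUnique_induces (face n i) (gammaFace n i) (M.cofaceApp n i) (gammaFace_natural n i)
    (M.cofaceApp_natural n i)

theorem existsUnique_isCodegen (n : ℕ) (j : Fin (n + 1)) : ∃! s, M.IsCodegen n j s :=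
  M.existsUnique_induces (degen n j) (gammaDegen n j) (M.codegenApp n j) (gammaDegen_natural n j)
    (M.codegenApp_natural n j)

end LeftComodule

end Naturality
end CooperadComplex
end

noncomputable section

namespace CooperadComplex

universe v u

set_option linter.unusedSectionVars false

/-! ### The cosimplicial identities -/

section Identities

theorem gamma_map_id_apply (n : ℕ) {W : Level n} (x : ((gamma n).obj W).carrier) :
    ((gamma n).map (𝟙 W)).equiv x = x := by
  rw [(gamma n).map_id]
  rfl

variable {C : Type u} [Category.{v} C] [MonoidalCategory C] [SymmetricCategory C]
  [HasLimitsOfSize.{0, 0} C] {O : Cooperad C} (M : LeftComodule O)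

namespace LevelMap

def coface (n : ℕ) (i : Fin (n + 1)) : LevelMap M n (n + 1) :=
  ⟨(face n i).obj, gammaFace n i, M.cofaceApp n i⟩

def codegen (n : ℕ) (j : Fin (n + 1)) : LevelMap M (n + 1) n :=
  ⟨(degen n j).obj, gammaDegen n j, M.codegenApp n j⟩

/-- The recursive definitions have a separate clause for depth zero; this gives one formula for all
depths. -/
theorem codegen_zero (n : ℕ) :
    codegen M n 0 = ⟨fun W => (singleFam (𝒜 := Level n)).obj W,
      fun W => sigmaPoint ((gamma n).obj W), counitBottom O.counit (M.iter n)⟩ := by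
  cases n <;> rfl

variable {M} {n m : ℕ}

/-- Merging the two outermost levels does not see what happens inside them. As `S` is arbitrary,
this covers the exchange of the outermost coface with deeper cofaces and with deeper codegeneracies.
-/
theorem coface_zero_comp_succ_succ (S : LevelMap M n m) :
    (coface M (n + 1) 0).comp S.succ.succ = S.succ.comp (coface M (m + 1) 0) := by
  have h : ((coface M (n + 1) 0).comp S.succ.succ).app = (S.succ.comp (coface M (m + 1) 0)).app :=
    funext fun W =>
      (odotWhisker_comp_cocompBottom O.cocomp (M.iter n) (M.iter m) W S.obj S.app).symm
  exact congrArg (LevelMap.mk ((coface M (n + 1) 0).comp S.succ.succ).obj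
    ((coface M (n + 1) 0).comp S.succ.succ).bij) h

/-- Applying the counit to an outermost one-element family is natural in its only member. Hence `ε₀`
commutes, up to the index shift, with every operation, which gives all exchange relations of the
extra codegeneracy. -/
theorem codegen_zero_comp (S : LevelMap M n m) :
    (codegen M n 0).comp S = S.succ.comp (codegen M m 0) := by
  rw [codegen_zero, codegen_zero]
  have h : ∀ W, counitBottom O.counit (M.iter n) (S.obj W) ≫ S.app W =
      (odotWhisker O.seq (S := FinBij.point) fun _ => S.app W) ≫
        counitBottom O.counit (M.iter m) W := fun W =>
      (odotWhisker_comp_counitBottom O.counit (M.iter n) (M.iter m) (S.app W)).symm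
  exact congrArg (LevelMap.mk (n := n + 1) (m := m) (fun W => singleFam.obj (S.obj W))
    fun W => S.bij W ≫ sigmaPoint ((gamma n).obj (S.obj W))) (funext h)

theorem Equivalent.of_eq {S T : LevelMap M n m} (h : S = T) : S.Equivalent T := by
  subst h
  exact fun W => ⟨𝟙 _, by simp, by simp⟩

/-- Coassociativity of the coaction enters only at depth zero. At greater depth, `i = j = 0` is
coassociativity of `O`, `i = 0 < j` is an exchange, and `0 < i` is inherited from the members of the
family. -/
theorem coface_comp_coface : ∀ {n : ℕ} {i j : Fin (n + 1)}, i ≤ j →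
    ((coface M n i).comp (coface M (n + 1) j.succ)).Equivalent
      ((coface M n j).comp (coface M (n + 1) i.castSucc))
  | 0, i, j, _ => by
    obtain rfl : i = 0 := Fin.eq_zero i
    obtain rfl : j = 0 := Fin.eq_zero j
    exact fun W => ⟨coprodAssoc W, FinBij.Hom.ext (Equiv.ext fun _ => rfl), (M.coassoc W).symm⟩
  | n + 1, i, j, h => by
    induction i using Fin.cases with
    | zero =>
      induction j using Fin.cases with
      | zero =>
        exact fun W => ⟨mergeAssoc (𝒜 := Level n) W,
          FinBij.Hom.ext (Equiv.ext fun x => congrArg (Sigma.mk _) (gamma_map_id_apply n x.2.2.2)),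
          (cocompBottom_coassoc O.coassoc (M.iter n) W).symm⟩
      | succ j =>
        exact .of_eq (coface_zero_comp_succ_succ (coface M n j))
    | succ i =>
      induction j using Fin.cases with
      | zero => exact absurd h (by simp)
      | succ j =>
        have := (coface_comp_coface (Fin.succ_le_succ_iff.1 h)).succ
        rw [succ_comp, succ_comp] at this
        exact this

theorem codegen_comp_codegen : ∀ {n : ℕ} {i j : Fin (n + 1)}, i ≤ j →
    (codegen M (n + 1) i.castSucc).comp (codegen M n j) =
      (codegen M (n + 1) j.succ).comp (codegen M n i)
  | 0, i, j, _ => by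
    obtain rfl : i = 0 := Fin.eq_zero i
    exact codegen_zero_comp (codegen M 0 j)
  | n + 1, i, j, h => by
    induction i using Fin.cases with
    | zero => exact codegen_zero_comp (codegen M (n + 1) j)
    | succ i =>
      induction j using Fin.cases with
      | zero => exact absurd h (by simp)
      | succ j =>
        have := congrArg succ (codegen_comp_codegen (Fin.succ_le_succ_iff.1 h))
        rw [succ_comp, succ_comp] at this
        exact this

theorem coface_comp_codegen_self : ∀ {n : ℕ} (i : Fin (n + 1)),
    (LevelMap.id M n).Equivalent ((coface M n i).comp (codegen M n i))
  | 0, i => by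
    obtain rfl : i = 0 := Fin.eq_zero i
    exact fun W => ⟨sigmaPoint W, FinBij.Hom.ext (Equiv.ext fun _ => rfl), (M.left_counit W).symm⟩
  | n + 1, i => by
    induction i using Fin.cases with
    | zero =>
      exact fun W => ⟨mergeSingle (𝒜 := Level n) W,
        FinBij.Hom.ext (Equiv.ext fun x => congrArg (Sigma.mk _) (gamma_map_id_apply n x.2)),
        (cocompBottom_left_counit O.left_counit (M.iter n) W).symm⟩
    | succ i =>
      have := (coface_comp_codegen_self i).succ
      rw [succ_comp, succ_id] at this
      exact this

/-- `i.castSucc` is never the top index, at which `M` coacts, so only the right counit axiom of `O`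
is used and none is needed for `M`. -/
theorem coface_comp_codegen_succ : ∀ {n : ℕ} (i : Fin (n + 1)),
    (LevelMap.id M (n + 1)).Equivalent
      ((coface M (n + 1) i.castSucc).comp (codegen M (n + 1) i.succ)) := by
  have h₀ : ∀ n : ℕ, (LevelMap.id M (n + 1)).Equivalent
      -- The codegeneracy at level one is written as `succ` of the outermost one, to which
      -- `codegen_zero` applies uniformly in `n`.
      ((coface M (n + 1) 0).comp (codegen M n 0).succ) := by
    intro n
    rw [codegen_zero]
    exact fun W => ⟨mergeSingles (𝒜 := Level n) W,
      FinBij.Hom.ext (Equiv.ext fun x => congrArg (Sigma.mk _) (gamma_map_id_apply n x.2)),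
      (cocompBottom_right_counit O.right_counit (M.iter n) W).symm⟩
  intro n
  induction n with
  | zero =>
    intro i
    obtain rfl : i = 0 := Fin.eq_zero i
    exact h₀ 0
  | succ n ih =>
    intro i
    induction i using Fin.cases with
    | zero => exact h₀ (n + 1)
    | succ i =>
      have := (ih i).succ
      rw [succ_comp, succ_id] at this
      exact this

theorem coface_succ_comp_codegen : ∀ {n : ℕ} {i j : Fin (n + 1)}, j ≤ i →
    (coface M (n + 1) i.succ).comp (codegen M (n + 1) j.castSucc) =
      (codegen M n j).comp (coface M n i)
  | 0, i, j, _ => by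
    obtain rfl : j = 0 := Fin.eq_zero j
    exact (codegen_zero_comp (coface M 0 i)).symm
  | n + 1, i, j, h => by
    induction j using Fin.cases with
    | zero => exact (codegen_zero_comp (coface M (n + 1) i)).symm
    | succ j =>
      induction i using Fin.cases with
      | zero => exact absurd h (by simp)
      | succ i =>
        have := congrArg succ (coface_succ_comp_codegen (Fin.succ_le_succ_iff.1 h))
        rw [succ_comp, succ_comp] at this
        exact this

theorem coface_castSucc_comp_codegen : ∀ {n : ℕ} {i j : Fin (n + 1)}, i < j →
    (coface M (n + 1) i.castSucc).comp (codegen M (n + 1) j.succ) =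
      (codegen M n j).comp (coface M n i)
  | 0, i, j, h => absurd h (by omega)
  | n + 1, i, j, h => by
    induction j using Fin.cases with
    | zero => exact absurd h (by simp)
    | succ j =>
      induction i using Fin.cases with
      | zero => exact coface_zero_comp_succ_succ (codegen M n j)
      | succ i =>
        have := congrArg succ (coface_castSucc_comp_codegen (Fin.succ_lt_succ_iff.1 h))
        rw [succ_comp, succ_comp] at this
        exact this

end LevelMap

namespace LeftComodule

/-- The coface `Δᵢ : O^{∘̂ n} ∘̂ M ⟶ O^{∘̂ (n+1)} ∘̂ M`. -/
def coface (n : ℕ) (i : Fin (n + 1)) : M.compProd n ⟶ M.compProd (n + 1) :=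
  (M.existsUnique_isCoface n i).choose

/-- The codegeneracy `εⱼ : O^{∘̂ (n+1)} ∘̂ M ⟶ O^{∘̂ n} ∘̂ M`. -/
def codegen (n : ℕ) (j : Fin (n + 1)) : M.compProd (n + 1) ⟶ M.compProd n :=
  (M.existsUnique_isCodegen n j).choose

theorem isCoface_coface (n : ℕ) (i : Fin (n + 1)) : M.IsCoface n i (M.coface n i) :=
  (M.existsUnique_isCoface n i).choose_spec.1

theorem isCodegen_codegen (n : ℕ) (j : Fin (n + 1)) : M.IsCodegen n j (M.codegen n j) :=
  (M.existsUnique_isCodegen n j).choose_spec.1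

theorem induces_coface (n : ℕ) (i : Fin (n + 1)) :
    (LevelMap.coface M n i).Induces (M.coface n i) :=
  M.isCoface_coface n i

theorem induces_codegen (n : ℕ) (j : Fin (n + 1)) :
    (LevelMap.codegen M n j).Induces (M.codegen n j) :=
  M.isCodegen_codegen n j

variable {M} in
-- The passage from level maps to symmetric sequences, used for every identity below.
theorem eq_of_induces {n m : ℕ} {S T : LevelMap M n m} (h : S.Equivalent T)
    {d d' : M.compProd n ⟶ M.compProd m} (hd : S.Induces d) (hd' : T.Induces d') : d = d' :=
  M.hom_ext m fun W => (hd W).trans (hd'.of_equivalent h W).symm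

theorem coface_comp_coface {n : ℕ} {i j : Fin (n + 1)} (h : i ≤ j) :
    M.coface n i ≫ M.coface (n + 1) j.succ = M.coface n j ≫ M.coface (n + 1) i.castSucc :=
  eq_of_induces (LevelMap.coface_comp_coface h)
    ((M.induces_coface _ _).comp (M.induces_coface _ _))
    ((M.induces_coface _ _).comp (M.induces_coface _ _))

theorem codegen_comp_codegen {n : ℕ} {i j : Fin (n + 1)} (h : i ≤ j) :
    M.codegen (n + 1) i.castSucc ≫ M.codegen n j = M.codegen (n + 1) j.succ ≫ M.codegen n i :=
  eq_of_induces (.of_eq (LevelMap.codegen_comp_codegen h))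
    ((M.induces_codegen _ _).comp (M.induces_codegen _ _))
    ((M.induces_codegen _ _).comp (M.induces_codegen _ _))

theorem coface_comp_codegen_self {n : ℕ} (i : Fin (n + 1)) :
    M.coface n i ≫ M.codegen n i = 𝟙 _ :=
  (eq_of_induces (LevelMap.coface_comp_codegen_self i) LevelMap.induces_id
    ((M.induces_coface _ _).comp (M.induces_codegen _ _))).symm

theorem coface_comp_codegen_succ {n : ℕ} (i : Fin (n + 1)) :
    M.coface (n + 1) i.castSucc ≫ M.codegen (n + 1) i.succ = 𝟙 _ :=
  (eq_of_induces (LevelMap.coface_comp_codegen_succ i) LevelMap.induces_id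
    ((M.induces_coface _ _).comp (M.induces_codegen _ _))).symm

theorem coface_succ_comp_codegen {n : ℕ} {i j : Fin (n + 1)} (h : j ≤ i) :
    M.coface (n + 1) i.succ ≫ M.codegen (n + 1) j.castSucc = M.codegen n j ≫ M.coface n i :=
  eq_of_induces (.of_eq (LevelMap.coface_succ_comp_codegen h))
    ((M.induces_coface _ _).comp (M.induces_codegen _ _))
    ((M.induces_codegen _ _).comp (M.induces_coface _ _))

theorem coface_castSucc_comp_codegen {n : ℕ} {i j : Fin (n + 1)} (h : i < j) :
    M.coface (n + 1) i.castSucc ≫ M.codegen (n + 1) j.succ = M.codegen n j ≫ M.coface n i :=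
  eq_of_induces (.of_eq (LevelMap.coface_castSucc_comp_codegen h))
    ((M.induces_coface _ _).comp (M.induces_codegen _ _))
    ((M.induces_codegen _ _).comp (M.induces_coface _ _))

end LeftComodule

end Identities
end CooperadComplex
end

/-! ### The simplicial identities present the simplex category -/

namespace SimplexCategoryGenRel

/-- Induction on the target, removing the last face `δ k` of `f`. If `k ≠ i`, then `i = k.succAbove
i'` and the remaining word misses `i'`. It thus ends in `δ i'`, and the relation between two faces
turns `δ i' ≫ δ k` into a word ending in `δ i`. -/
theorem exists_eq_comp_δ_of_P_δ {m : ℕ} {x : SimplexCategoryGenRel} {f : x ⟶ mk (m + 1)}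
    (hf : P_δ f) (i : Fin (m + 2)) (hi : ∀ a, toSimplexCategory.map f a ≠ i) :
    ∃ f' : x ⟶ mk m, f = f' ≫ δ i := by
  induction m generalizing x with
  | zero =>
    have key : ∀ (f₀ : x ⟶ mk 0) (k : Fin 2), f = f₀ ≫ δ k → ∃ f' : x ⟶ mk 0, f = f' ≫ δ i := by
      rintro f₀ k rfl
      obtain rfl | hk := eq_or_ne i k
      · exact ⟨f₀, rfl⟩
      · obtain ⟨i', rfl⟩ := Fin.exists_succAbove_eq hk
        -- The vertex `i'` of `mk 0` is the only one, so it cannot be missed.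
        refine absurd ?_ (hi 0)
        rw [Functor.map_comp]
        exact congrArg k.succAbove (Subsingleton.elim (α := Fin 1) _ _)
    cases hf with
    | of _ h => cases h; exact key (𝟙 _) _ (Category.id_comp _).symm
    | id => exact absurd rfl (hi i)
    | comp_of f₀ g hf₀ hg => cases hg; exact key _ _ rfl
  | succ m ih =>
    have key : ∀ (f₀ : x ⟶ mk (m + 1)) (k : Fin (m + 3)), P_δ f₀ → f = f₀ ≫ δ k →
        ∃ f' : x ⟶ mk (m + 1), f = f' ≫ δ i := by
      rintro f₀ k hf₀ rfl
      obtain rfl | hk := eq_or_ne i k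
      · exact ⟨f₀, rfl⟩
      · obtain ⟨i', rfl⟩ := Fin.exists_succAbove_eq hk
        obtain ⟨f', rfl⟩ := ih hf₀ i' fun a ha => hi a <| by
          rw [Functor.map_comp]
          exact congrArg k.succAbove ha
        obtain h | h := lt_or_ge i'.castSucc k
        · obtain ⟨k, rfl⟩ := Fin.eq_succ_of_ne_zero (Fin.ne_zero_of_lt h)
          refine ⟨f' ≫ δ k, ?_⟩
          rw [Fin.succAbove_of_castSucc_lt _ _ h, Category.assoc, Category.assoc,
            δ_comp_δ (Fin.castSucc_lt_succ_iff.1 h)]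
        · obtain ⟨k, rfl⟩ := Fin.eq_castSucc_of_ne_last
            (Fin.ne_last_of_lt (h.trans_lt (Fin.castSucc_lt_last i')))
          refine ⟨f' ≫ δ k, ?_⟩
          rw [Fin.succAbove_of_le_castSucc _ _ h, Category.assoc, Category.assoc,
            δ_comp_δ (Fin.castSucc_le_castSucc_iff.1 h)]
    cases hf with
    | of _ h => cases h; exact key (𝟙 _) _ (P_δ.id_mem _) (Category.id_comp _).symm
    | id => exact absurd rfl (hi i)
    | comp_of f₀ g hf₀ hg => cases hg; exact key _ _ hf₀ rfl

/-- A morphism whose image misses `i` factors through `δ i`. -/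
theorem exists_eq_comp_δ {m : ℕ} {x : SimplexCategoryGenRel} (f : x ⟶ mk (m + 1))
    (i : Fin (m + 2)) (hi : ∀ a, toSimplexCategory.map f a ≠ i) :
    ∃ f' : x ⟶ mk m, f = f' ≫ δ i := by
  obtain ⟨z, e, d, he, hd, rfl⟩ := exists_P_σ_P_δ_factorization f
  -- `e` is surjective on vertices, so `d` has the same image as the composite and misses `i` as
  -- well.
  have := isSplitEpi_toSimplexCategory_map_of_P_σ he
  have hsurj := SimplexCategory.epi_iff_surjective.1
    (inferInstance : Epi (toSimplexCategory.map e))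
  obtain ⟨d', rfl⟩ := exists_eq_comp_δ_of_P_δ hd i fun b hb => by
    obtain ⟨a, rfl⟩ := hsurj b
    refine hi a ?_
    rw [Functor.map_comp]
    exact hb
  exact ⟨e ≫ d', (Category.assoc _ _ _).symm⟩

theorem exists_eq_σ_comp_of_P_σ {n : ℕ} {y : SimplexCategoryGenRel} {f : mk (n + 1) ⟶ y}
    (hf : P_σ f) (i : Fin (n + 1))
    (hi : toSimplexCategory.map f i.castSucc = toSimplexCategory.map f i.succ) :
    ∃ f' : mk n ⟶ y, f = σ i ≫ f' := by
  -- In this form of the closure words are extended on the left, so the first degeneracy can be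
  -- removed; the argument is dual to the one for faces.
  rw [P_σ, MorphismProperty.multiplicativeClosure_eq_multiplicativeClosure'] at hf
  induction n generalizing y with
  | zero =>
    have key : ∀ (f₀ : mk 0 ⟶ y) (k : Fin 1), f = σ k ≫ f₀ → ∃ f' : mk 0 ⟶ y, f = σ i ≫ f' := by
      rintro f₀ k rfl
      exact ⟨f₀, by rw [Subsingleton.elim k i]⟩
    cases hf with
    | of _ h => cases h; exact key (𝟙 _) _ (Category.comp_id _).symm
    | id => exact absurd hi (Fin.castSucc_lt_succ (i := i)).ne
    | of_comp g f₀ hg hf₀ => cases hg; exact key _ _ rfl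
  | succ n ih =>
    have key : ∀ (f₀ : mk (n + 1) ⟶ y) (k : Fin (n + 2)), degeneracies.multiplicativeClosure' f₀ →
        f = σ k ≫ f₀ → ∃ f' : mk (n + 1) ⟶ y, f = σ i ≫ f' := by
      rintro f₀ k hf₀ rfl
      rw [Functor.map_comp] at hi
      change toSimplexCategory.map f₀ (k.predAbove i.castSucc) =
        toSimplexCategory.map f₀ (k.predAbove i.succ) at hi
      -- For `i ≠ k`, `σ k` sends `i` and `i + 1` to two neighbours, which `f₀` must identify. By
      -- induction `f₀` begins with their degeneracy, and the relation between two degeneracies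
      -- brings `σ i` to the front.
      obtain h | rfl | h := lt_trichotomy i k
      · obtain ⟨k, rfl⟩ := Fin.eq_succ_of_ne_zero (Fin.ne_zero_of_lt h)
        obtain ⟨i, rfl⟩ := Fin.eq_castSucc_of_ne_last (Fin.ne_last_of_lt h)
        have h' : i ≤ k := Fin.castSucc_lt_succ_iff.1 h
        obtain ⟨f', rfl⟩ := ih hf₀ i <| by
          convert hi using 2
          · rw [Fin.predAbove_of_le_castSucc _ _
              (by simp only [Fin.le_def, Fin.val_castSucc, Fin.val_succ] at h' ⊢; omega)]
            rfl
          · rw [Fin.predAbove_of_le_castSucc _ _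
              (by simp only [Fin.le_def, Fin.val_castSucc, Fin.val_succ] at h' ⊢; omega)]
            rfl
        refine ⟨σ k ≫ f', ?_⟩
        rw [← Category.assoc, ← Category.assoc, σ_comp_σ h']
      · exact ⟨f₀, rfl⟩
      · obtain ⟨i, rfl⟩ := Fin.eq_succ_of_ne_zero (Fin.ne_zero_of_lt h)
        obtain ⟨k, rfl⟩ := Fin.eq_castSucc_of_ne_last (Fin.ne_last_of_lt h)
        have h' : k ≤ i := Fin.castSucc_lt_succ_iff.1 h
        obtain ⟨f', rfl⟩ := ih hf₀ i <| by
          convert hi using 2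
          · rw [Fin.predAbove_of_castSucc_lt _ _ (by simpa [Fin.lt_def, Nat.lt_succ_iff] using h')]
            rfl
          · rw [Fin.predAbove_of_castSucc_lt _ _
              (by simp only [Fin.lt_def, Fin.le_def, Fin.val_castSucc, Fin.val_succ] at h' ⊢; omega)]
            rfl
        refine ⟨σ k ≫ f', ?_⟩
        rw [← Category.assoc, ← Category.assoc, σ_comp_σ h']
    cases hf with
    | of _ h => cases h; exact key (𝟙 _) _ (.id _) (Category.comp_id _).symm
    | id => exact absurd hi (Fin.castSucc_lt_succ (i := i)).ne
    | of_comp g f₀ hg hf₀ => cases hg; exact key _ _ hf₀ rfl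

/-- A morphism which identifies `i` and `i + 1` factors through `σ i`. -/
theorem exists_eq_σ_comp {n : ℕ} {y : SimplexCategoryGenRel} (f : mk (n + 1) ⟶ y)
    (i : Fin (n + 1))
    (hi : toSimplexCategory.map f i.castSucc = toSimplexCategory.map f i.succ) :
    ∃ f' : mk n ⟶ y, f = σ i ≫ f' := by
  obtain ⟨z, e, d, he, hd, rfl⟩ := exists_P_σ_P_δ_factorization f
  have := isSplitMono_toSimplexCategory_map_of_P_δ hd
  have hinj := SimplexCategory.mono_iff_injective.1
    (inferInstance : Mono (toSimplexCategory.map d))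
  rw [Functor.map_comp] at hi
  obtain ⟨e', rfl⟩ := exists_eq_σ_comp_of_P_σ he i (hinj hi)
  exact ⟨e' ≫ d, Category.assoc _ _ _⟩

theorem eq_or_len_lt_of_P_σ {x y : SimplexCategoryGenRel} {f : x ⟶ y} (hf : P_σ f) :
    (∃ h : x = y, f = eqToHom h) ∨ y.len < x.len := by
  induction hf with
  | of _ h => cases h; right; simp
  | id => left; use rfl; simp
  | comp_of f g _ hg ih =>
    right
    cases hg
    obtain ⟨rfl, -⟩ | h := ih
    · exact Nat.lt_succ_self _
    · exact (Nat.lt_succ_self _).trans h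

/-- In the factorization into degeneracies and faces, injectivity prevents the dimension from
dropping, so there are no degeneracies. The faces then preserve the dimension, so there are none of
these either. -/
theorem eq_id_of_bijective {n : ℕ} (f : mk n ⟶ mk n)
    (hf : Function.Bijective (toSimplexCategory.map f)) : f = 𝟙 _ := by
  obtain ⟨z, e, d, he, hd, rfl⟩ := exists_P_σ_P_δ_factorization f
  have h₁ : n ≤ z.len := by
    have : Mono (toSimplexCategory.map e ≫ toSimplexCategory.map d) := by
      rw [← Functor.map_comp]; exact SimplexCategory.mono_iff_injective.2 hf.1
    have := mono_of_mono (toSimplexCategory.map e) (toSimplexCategory.map d)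
    exact SimplexCategory.len_le_of_mono (toSimplexCategory.map e)
  obtain ⟨rfl, rfl⟩ | h := eq_or_len_lt_of_P_σ he
  · obtain ⟨h, rfl⟩ | h := eq_or_len_le_of_P_δ hd
    · simp
    · exact absurd h (lt_irrefl _)
  · exact absurd h (not_lt.2 h₁)

/-- The simplicial identities generate all relations in the simplex category. -/
theorem map_injective : ∀ (N n m : ℕ), n + m ≤ N → ∀ f g : mk n ⟶ mk m,
    toSimplexCategory.map f = toSimplexCategory.map g → f = g := by
  intro N
  induction N with
  | zero =>
    intro n m h f g hfg
    obtain ⟨rfl, rfl⟩ : n = 0 ∧ m = 0 := by omega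
    have (f : mk 0 ⟶ mk 0) : f = 𝟙 _ := eq_id_of_bijective f
      ⟨fun _ _ _ => Subsingleton.elim (α := Fin 1) _ _,
        fun b => ⟨0, Subsingleton.elim (α := Fin 1) _ _⟩⟩
    rw [this f, this g]
  | succ N ih =>
    intro n m h f g hfg
    -- `f` and `g` have the same underlying map. If it is not surjective, a common face splits off
    -- on the right; if it is not injective, a common degeneracy splits off on the left. Either is
    -- cancelled and the sum of the dimensions drops. A bijection leaves only the identity.
    by_cases hs : Function.Surjective (toSimplexCategory.map f)
    · by_cases hi : Function.Injective (toSimplexCategory.map f)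
      · have h₁ : n = m := by
          simpa using Fintype.card_congr (Equiv.ofBijective _ ⟨hi, hs⟩ : Fin (n + 1) ≃ Fin (m + 1))
        subst h₁
        rw [eq_id_of_bijective f ⟨hi, hs⟩, eq_id_of_bijective g (hfg ▸ ⟨hi, hs⟩)]
      · obtain _ | n := n
        · exact absurd (fun _ _ _ => Subsingleton.elim (α := Fin 1) _ _) hi
        obtain ⟨i, hi⟩ : ∃ i : Fin (n + 1),
            toSimplexCategory.map f i.castSucc = toSimplexCategory.map f i.succ := by
          by_contra! hne
          -- A monotone map that separates consecutive vertices is strictly monotone.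
          refine hi (Fin.strictMono_iff_lt_succ (f := toSimplexCategory.map f)
            |>.2 fun i => lt_of_le_of_ne ?_ (hne i)).injective
          exact (toSimplexCategory.map f).toOrderHom.monotone (Fin.castSucc_lt_succ (i := i)).le
        obtain ⟨f', rfl⟩ := exists_eq_σ_comp f i hi
        obtain ⟨g', rfl⟩ := exists_eq_σ_comp g i (hfg ▸ hi)
        rw [ih n m (by omega) f' g']
        rw [Functor.map_comp, Functor.map_comp] at hfg
        exact (cancel_epi (SimplexCategory.σ i)).1 hfg
    · simp only [Function.Surjective, not_forall, not_exists] at hs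
      obtain ⟨i, hi⟩ := hs
      obtain _ | m := m
      · exact absurd (Subsingleton.elim (α := Fin 1) _ _) (hi 0)
      obtain ⟨f', rfl⟩ := exists_eq_comp_δ f i hi
      obtain ⟨g', rfl⟩ := exists_eq_comp_δ g i (hfg ▸ hi)
      rw [ih n m (by omega) f' g']
      rw [Functor.map_comp, Functor.map_comp] at hfg
      have : Mono (SimplexCategory.δ (n := m) i) :=
        SimplexCategory.mono_iff_injective.2 (Fin.succAbove_right_injective (p := i))
      exact this.right_cancellation _ _ hfg

instance : toSimplexCategory.Faithful where
  map_injective {x y f g} h := map_injective _ x.len y.len le_rfl f g h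

/-- The morphisms in the image form a multiplicative class containing all cofaces and
codegeneracies, and these generate the simplex category. -/
theorem exists_map_eq {n m : SimplexCategory} (φ : n ⟶ m) :
    ∃ f : mk n.len ⟶ mk m.len, toSimplexCategory.map f = φ := by
  let W : MorphismProperty SimplexCategory :=
    fun n m φ => ∃ f : mk n.len ⟶ mk m.len, toSimplexCategory.map f = φ
  have : W.IsMultiplicative :=
    { id_mem := fun n => ⟨𝟙 _, toSimplexCategory.map_id _⟩
      comp_mem := by
        rintro _ _ _ _ _ ⟨f, rfl⟩ ⟨g, rfl⟩
        exact ⟨f ≫ g, toSimplexCategory.map_comp f g⟩ }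
  have h := SimplexCategory.morphismProperty_eq_top W (fun i => ⟨δ i, rfl⟩) (fun i => ⟨σ i, rfl⟩)
  have : W φ := h ▸ MorphismProperty.top_apply φ
  exact this

instance : toSimplexCategory.Full where
  map_surjective {_ _} φ := exists_map_eq φ

instance : toSimplexCategory.EssSurj where
  mem_essImage n := ⟨mk n.len, ⟨Iso.refl _⟩⟩

instance : toSimplexCategory.IsEquivalence where

end SimplexCategoryGenRel

noncomputable section
namespace CooperadComplex
universe v u
set_option linter.unusedSectionVars false
-- The coaugmented cosimplicial object and its extra codegeneracy
section

variable {C : Type u} [Category.{v} C] [MonoidalCategory C] [SymmetricCategory C]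
  [HasLimitsOfSize.{0, 0} C] {O : Cooperad C} (M : LeftComodule O)

namespace LeftComodule

/-- The faces and degeneracies of the complex on the generators of the simplex category. -/
def complexPrefunctor : FreeSimplexQuiver ⥤q SymSeq C where
  obj n := M.compProd (FreeSimplexQuiver.len n + 1)
  map f := match f with
    | @FreeSimplexQuiver.Hom.δ n i => M.coface (n + 1) i
    | @FreeSimplexQuiver.Hom.σ n j => M.codegen (n + 1) j.succ

theorem lift_complexPrefunctor_map_comp {a b c : FreeSimplexQuiver} (f : a ⟶ b) (g : b ⟶ c) :
    (Paths.lift M.complexPrefunctor).map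
      ((Paths.of FreeSimplexQuiver).map f ≫ (Paths.of FreeSimplexQuiver).map g) =
      M.complexPrefunctor.map f ≫ M.complexPrefunctor.map g :=
  congrArg (· ≫ M.complexPrefunctor.map g) (Category.id_comp (M.complexPrefunctor.map f))

/-- The cosimplicial symmetric sequence `O^{∘̂ (k+1)} ∘̂ M` as a functor on the simplex category
presented by generators and relations. -/
def complexGenRel : SimplexCategoryGenRel ⥤ SymSeq C :=
  CategoryTheory.Quotient.lift _ (Paths.lift M.complexPrefunctor) <| by
    -- `σ j` is `ε_{j+1}` while `δ i` is the coface at level `i`. This shift makes the relation for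
    -- `δ i.castSucc` and `σ i` a right counit identity, and the one for `δ i.succ` and `σ i` a left
    -- counit identity.
    rintro _ _ _ _ (H | H | _ | _ | H | H) <;>
      simp only [lift_complexPrefunctor_map_comp]
    · exact M.coface_comp_coface H
    · exact M.coface_castSucc_comp_codegen (Fin.le_castSucc_iff.1 H)
    · exact M.coface_comp_codegen_succ _
    · exact M.coface_comp_codegen_self _
    · have h := M.coface_succ_comp_codegen (Fin.castSucc_lt_iff_succ_le.1 H)
      rw [← Fin.succ_castSucc] at h
      exact h
    · have h := M.codegen_comp_codegen (Fin.succ_le_succ_iff.2 H)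
      rw [← Fin.succ_castSucc] at h
      exact h

theorem complexGenRel_map_δ {n : ℕ} (i : Fin (n + 2)) :
    M.complexGenRel.map (SimplexCategoryGenRel.δ i) = M.coface (n + 1) i :=
  Category.id_comp _

theorem complexGenRel_map_σ {n : ℕ} (j : Fin (n + 1)) :
    M.complexGenRel.map (SimplexCategoryGenRel.σ j) = M.codegen (n + 1) j.succ :=
  Category.id_comp _

/-- The cosimplicial symmetric sequence `O^{∘̂ (k+1)} ∘̂ M`. -/
def complex : SimplexCategory ⥤ SymSeq C :=
  SimplexCategoryGenRel.toSimplexCategory.inv ⋙ M.complexGenRel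

/-- The terms of the cosimplicial symmetric sequence. -/
def complexIso (n : ℕ) : M.complex.obj (.mk n) ≅ M.compProd (n + 1) :=
  M.complexGenRel.mapIso (SimplexCategoryGenRel.toSimplexCategory.asEquivalence.unitIso.symm.app
    (SimplexCategoryGenRel.mk n))

/-- The inverse of the equivalence is chosen, so the terms of `complex` are only isomorphic to the
`X^{n+1}`. Naturality of the unit transports the structure maps along these isomorphisms. -/
theorem complex_map_comp_complexIso {n m : ℕ}
    (f : SimplexCategoryGenRel.mk n ⟶ SimplexCategoryGenRel.mk m) :
    M.complex.map (SimplexCategoryGenRel.toSimplexCategory.map f) ≫ (M.complexIso m).hom =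
      (M.complexIso n).hom ≫ M.complexGenRel.map f := by
  have h := SimplexCategoryGenRel.toSimplexCategory.asEquivalence.unitIso.inv.naturality f
  exact (M.complexGenRel.map_comp _ _).symm.trans
    ((congrArg M.complexGenRel.map h).trans (M.complexGenRel.map_comp _ _))

theorem complex_map_δ {n : ℕ} (i : Fin (n + 2)) : M.complex.map (SimplexCategory.δ i) =
    (M.complexIso n).hom ≫ M.coface (n + 1) i ≫ (M.complexIso (n + 1)).inv := by
  have h : M.complex.map (SimplexCategory.δ i) ≫ (M.complexIso (n + 1)).hom =
      (M.complexIso n).hom ≫ M.coface (n + 1) i :=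
    (M.complex_map_comp_complexIso (SimplexCategoryGenRel.δ i)).trans
      (congrArg (_ ≫ ·) (M.complexGenRel_map_δ i))
  rw [← Category.assoc, Iso.eq_comp_inv, h]

theorem complex_map_σ {n : ℕ} (j : Fin (n + 1)) : M.complex.map (SimplexCategory.σ j) =
    (M.complexIso (n + 1)).hom ≫ M.codegen (n + 1) j.succ ≫ (M.complexIso n).inv := by
  have h : M.complex.map (SimplexCategory.σ j) ≫ (M.complexIso n).hom =
      (M.complexIso (n + 1)).hom ≫ M.codegen (n + 1) j.succ :=
    (M.complex_map_comp_complexIso (SimplexCategoryGenRel.σ j)).trans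
      (congrArg (_ ≫ ·) (M.complexGenRel_map_σ j))
  rw [← Category.assoc, Iso.eq_comp_inv, h]

/-- The coaugmentation `M ⟶ O ∘̂ M`. -/
def coaug : M.compProd 0 ⟶ M.complex.obj (.mk 0) :=
  M.coface 0 0 ≫ (M.complexIso 0).inv

theorem coaug_comp_map_δ :
    M.coaug ≫ M.complex.map (SimplexCategory.δ 0) =
      M.coaug ≫ M.complex.map (SimplexCategory.δ 1) := by
  have h : M.coface 0 0 ≫ M.coface 1 1 = M.coface 0 0 ≫ M.coface 1 0 :=
    M.coface_comp_coface (n := 0) (i := 0) (j := 0) le_rfl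
  simp only [coaug, complex_map_δ, Category.assoc, Iso.inv_hom_id_assoc]
  rw [reassoc_of% h]

/-- Two vertices of a simplex lie on a common edge, so the cone condition of a coaugmentation
reduces to the two cofaces out of `[0]`. -/
theorem coaug_comp_map {n : SimplexCategory} (g₁ g₂ : SimplexCategory.mk 0 ⟶ n) :
    M.coaug ≫ M.complex.map g₁ = M.coaug ≫ M.complex.map g₂ := by
  wlog h : g₁ 0 ≤ g₂ 0 generalizing g₁ g₂
  · exact (this g₂ g₁ (le_of_not_ge h)).symm
  obtain ⟨k, h₁, h₂⟩ : ∃ k : SimplexCategory.mk 1 ⟶ n,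
      g₁ = SimplexCategory.δ 1 ≫ k ∧ g₂ = SimplexCategory.δ 0 ≫ k := by
    refine ⟨SimplexCategory.mkOfLe (g₁ 0) (g₂ 0) h, ?_, ?_⟩ <;>
    · ext x
      obtain rfl : x = 0 := Subsingleton.elim (α := Fin 1) _ _
      rfl
  rw [h₁, h₂, Functor.map_comp, Functor.map_comp, ← Category.assoc, ← Category.assoc,
    coaug_comp_map_δ]

/-- The coaugmented cosimplicial symmetric sequence `M ⟶ O ∘̂ M ⇉ O ∘̂ O ∘̂ M ⋯`. -/
def augComplex : CosimplicialObject.Augmented (SymSeq C) :=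
  CosimplicialObject.augment M.complex (M.compProd 0) M.coaug fun _ => M.coaug_comp_map

theorem augComplex_hom_app_zero : M.augComplex.hom.app (.mk 0) = M.coaug :=
  CosimplicialObject.augment_hom_zero _ _ _ _

/-- The codegeneracy `ε₀ : O ∘̂ M ⟶ M`. -/
def extraZero : M.complex.obj (.mk 0) ⟶ M.compProd 0 :=
  (M.complexIso 0).hom ≫ M.codegen 0 0

/-- The codegeneracy `ε₀ : O^{∘̂ (n+2)} ∘̂ M ⟶ O^{∘̂ (n+1)} ∘̂ M`. -/
def extra (n : ℕ) : M.complex.obj (.mk (n + 1)) ⟶ M.complex.obj (.mk n) :=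
  (M.complexIso (n + 1)).hom ≫ M.codegen (n + 1) 0 ≫ (M.complexIso n).inv

theorem coaug_comp_extraZero : M.coaug ≫ M.extraZero = 𝟙 _ := by
  simp only [coaug, extraZero, Category.assoc, Iso.inv_hom_id_assoc]
  exact M.coface_comp_codegen_self (n := 0) 0

theorem map_δ_one_comp_extra :
    M.complex.map (SimplexCategory.δ 1) ≫ M.extra 0 = M.extraZero ≫ M.coaug := by
  have h : M.coface 1 1 ≫ M.codegen 1 0 = M.codegen 0 0 ≫ M.coface 0 0 :=
    M.coface_succ_comp_codegen (n := 0) (i := 0) (j := 0) le_rfl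
  simp only [complex_map_δ, extra, extraZero, coaug, Category.assoc, Iso.inv_hom_id_assoc]
  rw [reassoc_of% h]

theorem map_δ_zero_comp_extra (n : ℕ) :
    M.complex.map (SimplexCategory.δ 0) ≫ M.extra n = 𝟙 _ := by
  have h := M.coface_comp_codegen_self (n := n + 1) 0
  simp only [complex_map_δ, extra, Category.assoc, Iso.inv_hom_id_assoc, reassoc_of% h,
    Iso.hom_inv_id]

theorem map_δ_succ_comp_extra (n : ℕ) (i : Fin (n + 2)) :
    M.complex.map (SimplexCategory.δ i.succ) ≫ M.extra (n + 1) =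
      M.extra n ≫ M.complex.map (SimplexCategory.δ i) := by
  have h := M.coface_succ_comp_codegen (n := n + 1) (i := i) (j := 0) (Fin.zero_le _)
  rw [Fin.castSucc_zero] at h
  simp only [complex_map_δ, extra, Category.assoc, Iso.inv_hom_id_assoc, reassoc_of% h]

theorem map_σ_zero_comp_extraZero :
    M.complex.map (SimplexCategory.σ 0) ≫ M.extraZero = M.extra 0 ≫ M.extraZero := by
  have h : M.codegen 1 0 ≫ M.codegen 0 0 = M.codegen 1 1 ≫ M.codegen 0 0 :=
    M.codegen_comp_codegen (n := 0) (i := 0) (j := 0) le_rfl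
  simp only [complex_map_σ, extra, extraZero, Category.assoc, Iso.inv_hom_id_assoc]
  rw [h]
  rfl

theorem map_σ_zero_comp_extra (n : ℕ) :
    M.complex.map (SimplexCategory.σ 0) ≫ M.extra n = M.extra (n + 1) ≫ M.extra n := by
  have h := M.codegen_comp_codegen (n := n + 1) (i := 0) (j := 0) le_rfl
  rw [Fin.castSucc_zero] at h
  simp only [complex_map_σ, extra, Category.assoc, Iso.inv_hom_id_assoc, reassoc_of% h]

theorem map_σ_succ_comp_extra (n : ℕ) (i : Fin (n + 1)) :
    M.complex.map (SimplexCategory.σ i.succ) ≫ M.extra n =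
      M.extra (n + 1) ≫ M.complex.map (SimplexCategory.σ i) := by
  have h := M.codegen_comp_codegen (n := n + 1) (i := 0) (j := i.succ) (Fin.zero_le _)
  rw [Fin.castSucc_zero] at h
  simp only [complex_map_σ, extra, Category.assoc, Iso.inv_hom_id_assoc, reassoc_of% h]

/-- The extra codegeneracy given by the counit at the outermost factor. -/
def extraCodegeneracy : ExtraCodegeneracy M.augComplex where
  s' := M.extraZero
  s := M.extra
  aug_s' := (congrArg (· ≫ M.extraZero) M.augComplex_hom_app_zero).trans M.coaug_comp_extraZero
  δ_one_s := M.map_δ_one_comp_extra.trans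
    (congrArg (M.extraZero ≫ ·) M.augComplex_hom_app_zero.symm)
  δ_zero_s := M.map_δ_zero_comp_extra
  δ_succ_s := M.map_δ_succ_comp_extra
  σ_zero_s' := M.map_σ_zero_comp_extraZero
  σ_zero_s := M.map_σ_zero_comp_extra
  σ_succ_s := M.map_σ_succ_comp_extra

theorem isCoface_augComplex_hom :
    M.IsCoface 0 0 (M.augComplex.hom.app (.mk 0) ≫ (M.complexIso 0).hom) := by
  have h : M.coaug ≫ (M.complexIso 0).hom = M.coface 0 0 := by
    rw [coaug, Category.assoc, Iso.inv_hom_id, Category.comp_id]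
  exact ((congrArg (· ≫ (M.complexIso 0).hom) M.augComplex_hom_app_zero).trans h).symm ▸
    M.isCoface_coface 0 0

theorem isCoface_complex_map_δ (n : ℕ) (i : Fin (n + 2)) :
    M.IsCoface (n + 1) i ((M.complexIso n).inv ≫ M.complex.map (SimplexCategory.δ i) ≫
      (M.complexIso (n + 1)).hom) := by
  rw [complex_map_δ, Category.assoc, Category.assoc, Iso.inv_hom_id, Category.comp_id,
    Iso.inv_hom_id_assoc]
  exact M.isCoface_coface _ _

theorem isCodegen_complex_map_σ (n : ℕ) (j : Fin (n + 1)) :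
    M.IsCodegen (n + 1) j.succ ((M.complexIso (n + 1)).inv ≫
      M.complex.map (SimplexCategory.σ j) ≫ (M.complexIso n).hom) := by
  rw [complex_map_σ, Category.assoc, Category.assoc, Iso.inv_hom_id, Category.comp_id,
    Iso.inv_hom_id_assoc]
  exact M.isCodegen_codegen _ _

theorem isCodegen_extraZero : M.IsCodegen 0 0 ((M.complexIso 0).inv ≫ M.extraZero) := by
  rw [extraZero, Iso.inv_hom_id_assoc]
  exact M.isCodegen_codegen _ _

theorem isCodegen_extra (n : ℕ) :
    M.IsCodegen (n + 1) 0 ((M.complexIso (n + 1)).inv ≫ M.extra n ≫ (M.complexIso n).hom) := by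
  rw [extra, Category.assoc, Category.assoc, Iso.inv_hom_id, Category.comp_id,
    Iso.inv_hom_id_assoc]
  exact M.isCodegen_codegen _ _

end LeftComodule

end

end CooperadComplex

end

theorem theoremL {C : Type*} [Category C] [MonoidalCategory C] [SymmetricCategory C]
    [HasLimitsOfSize.{0, 0} C] (O : Cooperad C) (M : LeftComodule O) :
    (∀ (n : ℕ) (i : Fin (n + 1)), ∃! d, M.IsCoface n i d) ∧
    (∀ (n : ℕ) (j : Fin (n + 1)), ∃! s, M.IsCodegen n j s) ∧
    ∃ (X : CosimplicialObject.Augmented (SymSeq C)) (e₀ : X.left ≅ M.compProd 0)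
      (e : ∀ n : ℕ, X.right.obj (.mk n) ≅ M.compProd (n + 1)) (h : ExtraCodegeneracy X),
      M.IsCoface 0 0 (e₀.inv ≫ X.hom.app (.mk 0) ≫ (e 0).hom) ∧
      (∀ (n : ℕ) (i : Fin (n + 2)),
        M.IsCoface (n + 1) i ((e n).inv ≫ X.right.δ i ≫ (e (n + 1)).hom)) ∧
      (∀ (n : ℕ) (j : Fin (n + 1)),
        M.IsCodegen (n + 1) j.succ ((e (n + 1)).inv ≫ X.right.σ j ≫ (e n).hom)) ∧
      M.IsCodegen 0 0 ((e 0).inv ≫ h.s' ≫ e₀.hom) ∧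
      ∀ n : ℕ, M.IsCodegen (n + 1) 0 ((e (n + 1)).inv ≫ h.s n ≫ (e n).hom) := by
  -- The coaugmenting object is `X^0 = M` on the nose, so `e₀` is the identity; it is removed in the
  -- two remaining goals.
  refine ⟨M.existsUnique_isCoface, M.existsUnique_isCodegen, M.augComplex, Iso.refl _,
    M.complexIso, M.extraCodegeneracy, ?_, M.isCoface_complex_map_δ, M.isCodegen_complex_map_σ,
    ?_, M.isCodegen_extra⟩
  · exact (Category.id_comp (M.augComplex.hom.app (.mk 0) ≫ (M.complexIso 0).hom)).symm ▸
      M.isCoface_augComplex_hom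
  · exact (congrArg ((M.complexIso 0).inv ≫ ·) (Category.comp_id M.extraZero)).symm ▸
      M.isCodegen_extraZero
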